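/- Let $T>0$, let $U\subset\mathbb R^d$ be a neighbourhood of $0$, and let $a(t,x,\xi)$, $b(t,x,\xi)$ be real functions, $C^\infty$ in a neighbourhood of $[0,T)\times U\times(\mathbb R^d\setminus 0)$ and homogeneous of degree $0$ in $\xi$, with $$4a^3-27b^2\ge 0\quad\text{on } [0,T)\times U\times(\mathbb R^d\setminus 0).$$ Let $p=\tau^3-a|\xi|^2\tau-b|\xi|^3$, let $|\bar\xi|=1$, and assume that $p(0,0,\tau,\bar\xi)$ has the triple root $\tau=0$ and that the singular point $(0,0,0,\bar\xi)$ of $p=0$ is effectively hyperbolic, i.e. the Hamilton map $$F_p=\begin{bmatrix}p_{\Xi Y}&p_{\Xi\Xi}\\-p_{YY}&-p_{Y\Xi}\end{bmatrix},\qquad Y=(t,x),\ \Xi=(\tau,\xi),$$ has a pair of non-zero real eigenvalues $\pm\mu$ there. Write $X=(x,\xi)$, $\bar X=(0,\bar\xi)$. Then: (i) One can write $a(t,X)=e(t,X)\,(t+\alpha(X))$ near $(0,\bar X)$ with $e,\alpha$ smooth and $e>0$. (ii) For any $e,\alpha$ as in (i), put $\rho(X,\epsilon)=\alpha(X)+\epsilon^2$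 and $\Delta(t,X,\epsilon)=4e(t,X)^3(t+\rho(X,\epsilon))^3-27\,b(t,X)^2$. One can write $\Delta=\tilde e\,\bar\Delta$ near $(0,\bar X,0)$ with $$\bar\Delta(t,X,\epsilon)=t^3+a_1(X,\epsilon)t^2+a_2(X,\epsilon)t+a_3(X,\epsilon),$$ where $\tilde e,a_1,a_2,a_3$ are smooth, $\tilde e>0$ and $a_j(\bar X,0)=0$. (iii) For any such factorization, let $\nu_1(X,\epsilon)=\inf\{t\in\mathbb R:\bar\Delta(t,X,\epsilon)>0\}$; let $c_1>0$, let $\chi\in C^\infty(\mathbb R)$ satisfy $0\le\chi\le1$, $\chi(s)=1$ for $s\le0$ and $\chi(s)=0$ for $s\ge1$, and for $\epsilon\neq0$ put $$\psi(X,\epsilon)=-\chi\Big(\frac{\nu_1+a_1}{2c_1\rho}\Big)\frac{\nu_1+a_1}{2}.$$ Then there is a neighbourhood $\mathcal U$ of $(\bar X,0)$ such that for all $(X,\epsilon)\in\mathcal U$ with $\epsilon\ne0$ one has $\rho(X,\epsilon)>0$, $\nu_1(X,\epsilon)\le0$, $\bar\Delta(\nu_1(X,\epsilon),X,\epsilon)=0$,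 and $$\bar\Delta(t,X,\epsilon)\ \ge\ \tfrac1{32}\,\min\big\{t^2,(t-\psi(X,\epsilon))^2\big\}\,\big(t+\rho(X,\epsilon)\big)\qquad\text{for all } t\in[0,T].$$ -/

import Mathlib

open Set Filter Topology
open scoped ContDiff

noncomputable section

/-- Euclidean space `ℝ^d`. -/
abbrev Eucl (d : ℕ) : Type := EuclideanSpace ℝ (Fin d)

/-- `f` is (defined and) of class `C^∞` in a neighbourhood of the point `z`. -/
def SmoothNear {V : Type*} [NormedAddCommGroup V] [NormedSpace ℝ V] (f : V → ℝ) (z : V) : Prop :=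
  ∀ᶠ y in 𝓝 z, ContDiffAt ℝ ∞ f y

/-- `f(t, x, ξ)` is positively homogeneous of degree `0` in `ξ ≠ 0`. -/
def HomogeneousDegreeZero {d : ℕ} (f : ℝ × Eucl d × Eucl d → ℝ) : Prop :=
  ∀ (t : ℝ) (x ξ : Eucl d) (r : ℝ), ξ ≠ 0 → 0 < r → f (t, x, r • ξ) = f (t, x, ξ)

/-! ### The symbol, its characteristic roots and its Hamilton map -/

/-- The polynomial `τ³ - a(t,x,ξ) |ξ|² τ - b(t,x,ξ) |ξ|³` in `τ`. -/
def charPolynomial {d : ℕ} (a b : ℝ × Eucl d × Eucl d → ℝ) (t : ℝ) (x ξ : Eucl d) :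
    Polynomial ℝ :=
  Polynomial.X ^ 3 - Polynomial.C (a (t, x, ξ) * ‖ξ‖ ^ 2) * Polynomial.X
    - Polynomial.C (b (t, x, ξ) * ‖ξ‖ ^ 3)

/-- Points `((t, x), (τ, ξ))` of the cotangent space of `ℝ^{1+d}`. -/
abbrev PhaseSpace (d : ℕ) : Type := (ℝ × Eucl d) × (ℝ × Eucl d)

/-- The principal symbol `p(t,x,τ,ξ) = τ³ - a |ξ|² τ - b |ξ|³` as a function on phase space. -/
def principalSymbol {d : ℕ} (a b : ℝ × Eucl d × Eucl d → ℝ) (z : PhaseSpace d) : ℝ :=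
  (charPolynomial a b z.1.1 z.1.2 z.2.2).eval z.2.1

/-- The standard basis of `ℝ^{1+d} = ℝ × ℝ^d`. -/
def stdVec (d : ℕ) : Unit ⊕ Fin d → ℝ × Eucl d
  | Sum.inl _ => (1, 0)
  | Sum.inr j => (0, EuclideanSpace.single j 1)

/-- The coordinate direction of the `i`-th entry of the base variable `(t, x)`. -/
def baseDir (d : ℕ) (i : Unit ⊕ Fin d) : PhaseSpace d := (stdVec d i, 0)

/-- The coordinate direction of the `i`-th entry of the dual variable `(τ, ξ)`. -/
def fibreDir (d : ℕ) (i : Unit ⊕ Fin d) : PhaseSpace d := (0, stdVec d i)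

/-- The second derivative `∂_w ∂_v p` at `z`. -/
def secondPartial {d : ℕ} (p : PhaseSpace d → ℝ) (z v w : PhaseSpace d) : ℝ :=
  fderiv ℝ (fun y => fderiv ℝ p y v) z w

/-- The Hamilton map (fundamental matrix) `F_p(z)`, the linearization at `z` of the Hamilton field
`(∂p/∂Ξ, -∂p/∂X)`, where `X = (t, x)` and `Ξ = (τ, ξ)`. -/
def hamiltonMap {d : ℕ} (p : PhaseSpace d → ℝ) (z : PhaseSpace d) :
    Matrix ((Unit ⊕ Fin d) ⊕ (Unit ⊕ Fin d)) ((Unit ⊕ Fin d) ⊕ (Unit ⊕ Fin d)) ℝ :=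
  Matrix.fromBlocks
    (Matrix.of fun i j => secondPartial p z (fibreDir d i) (baseDir d j))
    (Matrix.of fun i j => secondPartial p z (fibreDir d i) (fibreDir d j))
    (Matrix.of fun i j => -secondPartial p z (baseDir d i) (baseDir d j))
    (Matrix.of fun i j => -secondPartial p z (baseDir d i) (fibreDir d j))

/-- `z` is an effectively hyperbolic singular point of `p = 0`: `p` and its differential vanish
at `z`, and the Hamilton map has a pair of non-zero real eigenvalues there. -/
def EffectivelyHyperbolic {d : ℕ} (p : PhaseSpace d → ℝ) (z : PhaseSpace d) : Prop :=
  p z = 0 ∧ fderiv ℝ p z = 0 ∧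
    ∃ μ : ℝ, μ ≠ 0 ∧ Module.End.HasEigenvalue (Matrix.toLin' (hamiltonMap p z)) μ ∧
      Module.End.HasEigenvalue (Matrix.toLin' (hamiltonMap p z)) (-μ)

/-! ### The perturbed discriminant and its normalization

From here on `X = (x, ξ)` is a point of `ℝ^d × ℝ^d`. -/

/-- `a(t, X) = e(t, X) (t + α(X))` near `(0, X₀)`, with `e`, `α` smooth and `e > 0`. -/
def IsTimeFactorization {d : ℕ} (a : ℝ × Eucl d × Eucl d → ℝ) (X₀ : Eucl d × Eucl d)
    (e : ℝ × Eucl d × Eucl d → ℝ) (α : Eucl d × Eucl d → ℝ) : Prop :=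
  SmoothNear e (0, X₀) ∧ SmoothNear α X₀ ∧
    ∀ᶠ z in 𝓝 ((0 : ℝ), X₀), 0 < e z ∧ a z = e z * (z.1 + α z.2)

/-- `ρ(X, ε) = α(X) + ε²`. -/
def rho {d : ℕ} (α : Eucl d × Eucl d → ℝ) (X : Eucl d × Eucl d) (ε : ℝ) : ℝ :=
  α X + ε ^ 2

/-- The discriminant `Δ(t, X, ε) = 4 a(t, X, ε)³ - 27 b(t, X)²` of the perturbed symbol, where
`a(t, X, ε) = e(t, X) (t + α(X) + ε²)`. -/
def perturbedDiscriminant {d : ℕ} (b e : ℝ × Eucl d × Eucl d → ℝ) (α : Eucl d × Eucl d → ℝ)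
    (t : ℝ) (X : Eucl d × Eucl d) (ε : ℝ) : ℝ :=
  4 * (e (t, X) * (t + rho α X ε)) ^ 3 - 27 * b (t, X) ^ 2

/-- `Δ̄(t, X, ε) = t³ + a₁(X, ε) t² + a₂(X, ε) t + a₃(X, ε)`. -/
def normalizedDiscriminant {d : ℕ} (a₁ a₂ a₃ : (Eucl d × Eucl d) × ℝ → ℝ)
    (t : ℝ) (X : Eucl d × Eucl d) (ε : ℝ) : ℝ :=
  t ^ 3 + a₁ (X, ε) * t ^ 2 + a₂ (X, ε) * t + a₃ (X, ε)

/-- `Δ = ẽ Δ̄` near `(0, X₀, 0)`, where `ẽ > 0` and the coefficients `a_j` of the monic cubic `Δ̄`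
are smooth and `a_j(X₀, 0) = 0`. -/
def IsCubicNormalization {d : ℕ} (Δ : ℝ → Eucl d × Eucl d → ℝ → ℝ) (X₀ : Eucl d × Eucl d)
    (e' : ℝ × (Eucl d × Eucl d) × ℝ → ℝ) (a₁ a₂ a₃ : (Eucl d × Eucl d) × ℝ → ℝ) : Prop :=
  SmoothNear e' (0, X₀, 0) ∧
    SmoothNear a₁ (X₀, 0) ∧ SmoothNear a₂ (X₀, 0) ∧ SmoothNear a₃ (X₀, 0) ∧
    a₁ (X₀, 0) = 0 ∧ a₂ (X₀, 0) = 0 ∧ a₃ (X₀, 0) = 0 ∧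
    ∀ᶠ z in 𝓝 ((0 : ℝ), X₀, (0 : ℝ)), 0 < e' z ∧
      Δ z.1 z.2.1 z.2.2 = e' z * normalizedDiscriminant a₁ a₂ a₃ z.1 z.2.1 z.2.2

/-- `ν₁(X, ε) = inf {t | Δ̄(t, X, ε) > 0}`; for a monic cubic this set is non-empty and bounded
below, so the infimum is a genuine one, and it is a root. -/
def nuOne {d : ℕ} (a₁ a₂ a₃ : (Eucl d × Eucl d) × ℝ → ℝ) (X : Eucl d × Eucl d) (ε : ℝ) : ℝ :=
  sInf {t : ℝ | 0 < normalizedDiscriminant a₁ a₂ a₃ t X ε}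

/-- `ψ(X, ε) = -χ((ν₁ + a₁) / (2 c₁ ρ)) (ν₁ + a₁) / 2`. -/
def psiFun {d : ℕ} (χ : ℝ → ℝ) (c₁ : ℝ) (α : Eucl d × Eucl d → ℝ)
    (a₁ a₂ a₃ : (Eucl d × Eucl d) × ℝ → ℝ) (X : Eucl d × Eucl d) (ε : ℝ) : ℝ :=
  -χ ((nuOne a₁ a₂ a₃ X ε + a₁ (X, ε)) / (2 * c₁ * rho α X ε))
    * ((nuOne a₁ a₂ a₃ X ε + a₁ (X, ε)) / 2)

end

/-! The triple root gives `a = b = 0` at the base point, and `27 b² ≤ 4 a³` for `t ≥ 0` gives `a ≥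
0` there. If `∂ₜa` vanished at the base point, `a(0,·)` would have a minimum there, so `da = 0` and
`a` would be of second order. Then `b` would be of third order on half-lines into `t ≥ 0`, `p` would
have no second-order part, and the Hamilton map would be zero. Hence `∂ₜa > 0`
(`time_derivative_pos`), and (i) follows from the implicit function theorem and Hadamard's lemma.

On the time axis `27 b² ≤ 4 a³ = O(t³)` forces `∂ₜb = 0`, so `Δ(t, X̄, 0)` vanishes to exact order
three, and (ii) is Malgrange preparation for that order (`exists_cubic_preparation`). The
preparation theorem rests on smooth division by `t³ + p t - q`. By Fourier inversion this reduces to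
dividing `exp(i s)` by `s³ + P s - R` with remainder coefficients of temperate growth in `(P, R)`.
Near and inside the region of three real roots, all complex roots have bounded imaginary part and an
energy estimate bounds the remainder. Elsewhere the real root is unique and Cardano's formula gives
the value of the exponential.

For (iii), passing from `α` to `α + ε²` enlarges `a` strictly and leaves `b` alone, so `Δ̄ > 0` on
`t ≥ 0` and `Δ̄ = (t - ν₁)` times a quadratic that is positive there. When `ν₁ + a₁ ≤ 0`, `ψ` is the
vertex of that quadratic. The lower bound is elementary (`cubic_lower_bound`) unless the
coefficients of `Δ̄` are all small on the scale `ρ`. That case is excluded by comparing `Δ = 4 e³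
(t+ρ)³ - 27 b²` at `t = -ρ, 0, ρ`: the three values of `b` have size `ρ^(3/2)`, while smoothness
makes their second difference `O(ρ²)`, and the two facts contradict each other
(`small_cubic_contradiction`). -/

/-! ### Temperate growth of cut-offs, oscillating exponentials and real powers. -/

theorem hasTemperateGrowth_smoothTransition : Real.smoothTransition.HasTemperateGrowth := by
  have hd : ContDiff ℝ ∞ (fderiv ℝ Real.smoothTransition) :=
    (Real.smoothTransition.contDiff (n := ⊤)).fderiv_right (by simp)
  have hs : HasCompactSupport (fderiv ℝ Real.smoothTransition) := by
    refine HasCompactSupport.of_support_subset_isCompact (isCompact_Icc (a := (0 : ℝ)) (b := 1)) ?_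
    intro x hx
    by_contra hx'
    apply hx
    rcases not_and_or.1 hx' with h | h
    · have : Real.smoothTransition =ᶠ[𝓝 x] fun _ => 0 := by
        filter_upwards [Iio_mem_nhds (not_le.1 h)] with y hy
        exact Real.smoothTransition.zero_of_nonpos (le_of_lt hy)
      rw [this.fderiv_eq]; simp
    · have : Real.smoothTransition =ᶠ[𝓝 x] fun _ => 1 := by
        filter_upwards [Ioi_mem_nhds (not_le.1 h)] with y hy
        exact Real.smoothTransition.one_of_one_le (le_of_lt hy)
      rw [this.fderiv_eq]; simp
  refine Function.HasTemperateGrowth.of_fderiv (hs.hasTemperateGrowth hd)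
    ((Real.smoothTransition.contDiff (n := 1)).differentiable (by simp)) (k := 0) (C := 1) ?_
  intro x
  rw [Real.norm_of_nonneg (Real.smoothTransition.nonneg x)]
  simpa using Real.smoothTransition.le_one x

theorem hasTemperateGrowth_exp_mul_I :
    (fun x : ℝ => Complex.exp (x * Complex.I)).HasTemperateGrowth := by
  have hd : ∀ n : ℕ, iteratedDeriv n (fun x : ℝ => Complex.exp (x * Complex.I)) =
      fun x : ℝ => Complex.I ^ n * Complex.exp (x * Complex.I) := by
    intro n
    induction n with
    | zero => simp
    | succ n ih =>
      rw [iteratedDeriv_succ, ih]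
      ext x
      have h : HasDerivAt (fun x : ℝ => Complex.exp (x * Complex.I))
          (Complex.exp (x * Complex.I) * (1 * Complex.I)) x :=
        ((Complex.ofRealCLM.hasDerivAt (x := x)).mul_const Complex.I).cexp
      rw [(h.const_mul _).deriv]
      ring
  refine ⟨?_, fun n => ⟨0, 1, fun x => ?_⟩⟩
  · exact (Complex.ofRealCLM.contDiff.mul contDiff_const).cexp
  · rw [norm_iteratedFDeriv_eq_norm_iteratedDeriv, hd]
    simp [Complex.norm_exp_ofReal_mul_I]

theorem rpow_le_of_half_lt {y b B : ℝ} (hy : 1 / 2 < y) (hb : |b| ≤ B) :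
    y ^ b ≤ (2 : ℝ) ^ B * (1 + y) ^ B := by
  have hB : 0 ≤ B := (abs_nonneg b).trans hb
  have h1 : (1 : ℝ) ≤ 2 ^ B := Real.one_le_rpow (by norm_num) hB
  have h2 : (1 : ℝ) ≤ (1 + y) ^ B := Real.one_le_rpow (by linarith) hB
  rcases le_total 0 b with h | h
  · calc y ^ b ≤ (1 + y) ^ b := Real.rpow_le_rpow (by linarith) (by linarith) h
      _ ≤ (1 + y) ^ B := Real.rpow_le_rpow_of_exponent_le (by linarith) ((le_abs_self b).trans hb)
      _ ≤ _ := le_mul_of_one_le_left (by linarith) h1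
  · calc y ^ b ≤ (1 / 2 : ℝ) ^ b := Real.rpow_le_rpow_of_nonpos (by norm_num) hy.le h
      _ = 2 ^ (-b) := by rw [one_div, Real.inv_rpow (by norm_num), Real.rpow_neg (by norm_num)]
      _ ≤ 2 ^ B := Real.rpow_le_rpow_of_exponent_le (by norm_num) ((neg_le_abs b).trans hb)
      _ ≤ _ := le_mul_of_one_le_right (by linarith) h2

/-- The range stays in the half-line `y > 1/2`, where every derivative of `y ^ a` is a multiple of
`y ^ (a - n)` and is polynomially bounded even for negative exponents. -/
theorem Function.HasTemperateGrowth.rpow_const {E : Type*} [NormedAddCommGroup E]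
    [NormedSpace ℝ E] {f : E → ℝ} (hf : f.HasTemperateGrowth) (h : ∀ x, 1 ≤ f x) (a : ℝ) :
    (fun x => f x ^ a).HasTemperateGrowth := by
  set t := {y : ℝ | 1 / 2 < y}
  have ht : Set.range f ⊆ t := by
    rintro - ⟨y, rfl⟩
    show 1 / 2 < f y
    linarith [h y]
  have hdiff : ContDiffOn ℝ ∞ (fun x : ℝ => x ^ a) t :=
    contDiffOn_fun_id.rpow_const_of_ne fun x hx => (lt_trans (by norm_num) hx).ne'
  have hunique : UniqueDiffOn ℝ t := (isOpen_lt' (1 / 2)).uniqueDiffOn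
  apply Function.HasTemperateGrowth.comp' ht hunique hdiff _ hf
  intro N
  obtain ⟨k, hk⟩ := exists_nat_ge (|a| + N)
  refine ⟨k, (∑ k ∈ Finset.range (N + 1), ‖Polynomial.eval a (descPochhammer ℝ k)‖) * 2 ^ k,
    by positivity, fun n hn x hx => ?_⟩
  have hx' : 1 / 2 < x := hx
  have : ContDiffAt ℝ n (fun x : ℝ => x ^ a) x :=
    Real.contDiffAt_rpow_const <| Or.inl (lt_trans (by norm_num) hx').ne'
  rw [norm_iteratedFDerivWithin_eq_norm_iteratedDerivWithin,
    iteratedDerivWithin_eq_iteratedDeriv hunique this hx, iteratedDeriv_eq_iterate,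
    Real.iter_deriv_rpow_const, norm_mul, mul_assoc]
  gcongr ?_ * ?_
  · have : n ∈ Finset.range (N + 1) := by grind
    exact Finset.single_le_sum (f := fun k => ‖Polynomial.eval a (descPochhammer ℝ k)‖)
      (fun _ _ => by positivity) this
  · rw [Real.norm_of_nonneg (Real.rpow_nonneg (by linarith) _),
      Real.norm_of_nonneg (by linarith : 0 ≤ x)]
    have := rpow_le_of_half_lt (b := a - n) (B := k) hx' (by
      have : (n : ℝ) ≤ N := by exact_mod_cast hn
      calc |a - n| ≤ |a| + |(n : ℝ)| := abs_sub _ _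
        _ ≤ _ := by rw [Nat.abs_cast]; linarith)
    simpa only [Real.rpow_natCast] using this

/-- A smooth function of temperate growth that agrees with a power away from the origin. -/
theorem exists_hasTemperateGrowth_eq_rpow (a : ℝ) {c : ℝ} (hc : 0 < c) :
    ∃ κ : ℝ → ℝ, κ.HasTemperateGrowth ∧ ∀ x, c ≤ x → κ x = x ^ a := by
  -- `m` is smooth, at least `1` everywhere and equal to `x` for `x ≥ 2`. Rescaling by `c / 2` moves
  -- the threshold from `2` to `c`.
  set m : ℝ → ℝ := fun x => 1 + Real.smoothTransition (x - 1) * (x - 1) with hm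
  have hmt : m.HasTemperateGrowth :=
    (Function.HasTemperateGrowth.const (1 : ℝ)).fun_add
      ((hasTemperateGrowth_smoothTransition.comp
        (Function.HasTemperateGrowth.id'.fun_sub (.const 1))).fun_mul
        (Function.HasTemperateGrowth.id'.fun_sub (.const 1)))
  have hm1 : ∀ x, 1 ≤ m x := by
    intro x
    rcases le_total (x - 1) 0 with h | h
    · simp [hm, Real.smoothTransition.zero_of_nonpos h]
    · have := mul_nonneg (Real.smoothTransition.nonneg (x - 1)) h
      simp only [hm]; linarith
  have hm2 : ∀ x, 2 ≤ x → m x = x := by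
    intro x hx
    simp [hm, Real.smoothTransition.one_of_one_le (show 1 ≤ x - 1 by linarith)]
  refine ⟨fun x => (c / 2) ^ a * m (2 / c * x) ^ a, ?_, fun x hx => ?_⟩
  · exact (Function.HasTemperateGrowth.const _).fun_mul
      ((hmt.rpow_const hm1 a).comp
        ((Function.HasTemperateGrowth.const (2 / c)).fun_mul Function.HasTemperateGrowth.id'))
  · have h2 : 2 ≤ 2 / c * x := by
      rw [div_mul_eq_mul_div, le_div_iff₀ hc]; linarith
    show (c / 2) ^ a * m (2 / c * x) ^ a = x ^ a
    rw [hm2 _ h2, ← Real.mul_rpow (by positivity) (by linarith)]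
    congr 1
    field_simp

/-! ### Cardano's formula where the real root is unique. -/

/-- Minus the discriminant of the cubic `s³ + P s - R`. -/
def cubicDisc (z : ℝ × ℝ) : ℝ := 4 * z.1 ^ 3 + 27 * z.2 ^ 2

theorem hasTemperateGrowth_fst {E F : Type*} [NormedAddCommGroup E] [NormedSpace ℝ E]
    [NormedAddCommGroup F] [NormedSpace ℝ F] :
    (fun z : E × F => z.1).HasTemperateGrowth :=
  (ContinuousLinearMap.fst ℝ E F).hasTemperateGrowth

theorem hasTemperateGrowth_snd {E F : Type*} [NormedAddCommGroup E] [NormedSpace ℝ E]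
    [NormedAddCommGroup F] [NormedSpace ℝ F] :
    (fun z : E × F => z.2).HasTemperateGrowth :=
  (ContinuousLinearMap.snd ℝ E F).hasTemperateGrowth

theorem hasTemperateGrowth_cubicDisc : cubicDisc.HasTemperateGrowth :=
  ((Function.HasTemperateGrowth.const 4).fun_mul (hasTemperateGrowth_fst.fun_pow 3)).fun_add
    ((Function.HasTemperateGrowth.const 27).fun_mul (hasTemperateGrowth_snd.fun_pow 2))

theorem cubicDisc_of_root (s P : ℝ) :
    cubicDisc (P, s ^ 3 + P * s) = (3 * s ^ 2 + P) ^ 2 * (3 * s ^ 2 + 4 * P) := by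
  simp only [cubicDisc]; ring

/-- Dividing by `r - s` leaves a quadratic in `r` of discriminant `-(3 s² + 4 P)`, which is negative
here. -/
theorem root_unique_of_cubicDisc_pos {s r P : ℝ} (h : r ^ 3 + P * r = s ^ 3 + P * s)
    (hE : 0 < cubicDisc (P, s ^ 3 + P * s)) : r = s := by
  rw [cubicDisc_of_root] at hE
  have h4 : 0 < 3 * s ^ 2 + 4 * P := pos_of_mul_pos_right hE (sq_nonneg _)
  have h0 : (r - s) * (r ^ 2 + r * s + s ^ 2 + P) = 0 := by linear_combination h
  rcases mul_eq_zero.1 h0 with h1 | h1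
  · linarith
  · nlinarith [sq_nonneg (2 * r + s)]

/-- Cardano's formula with powers cut off near zero. -/
theorem exists_temperate_real_root :
    ∃ r : ℝ × ℝ → ℝ, r.HasTemperateGrowth ∧ ∀ s P : ℝ,
      1 ≤ cubicDisc (P, s ^ 3 + P * s) → -(1 / 10) ≤ s ^ 3 + P * s → r (P, s ^ 3 + P * s) = s := by
  obtain ⟨σ, hσ, hσ'⟩ := exists_hasTemperateGrowth_eq_rpow (1 / 2) (show (0 : ℝ) < 1 / 108 by norm_num)
  obtain ⟨κ, hκ, hκ'⟩ := exists_hasTemperateGrowth_eq_rpow (1 / 3) (show (0 : ℝ) < 1 / 30 by norm_num)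
  obtain ⟨κi, hκi, hκi'⟩ :=
    exists_hasTemperateGrowth_eq_rpow (-(1 / 3)) (show (0 : ℝ) < 1 / 30 by norm_num)
  -- Cardano: `x = R/2 + √(R²/4 + P³/27)`, `u = x^(1/3)`, `s = u - P/(3u)`. If the discriminant
  -- quantity is at least `1` and `R ≥ -1/10`, the square root is at least `9/100`, so `x` stays
  -- above the cut-off `1/30`.
  set x : ℝ × ℝ → ℝ := fun z => 1 / 2 * z.2 + σ (1 / 108 * cubicDisc z) with hx
  have hxt : x.HasTemperateGrowth :=
    ((Function.HasTemperateGrowth.const (1 / 2 : ℝ)).fun_mul hasTemperateGrowth_snd).fun_add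
      (hσ.comp ((Function.HasTemperateGrowth.const (1 / 108 : ℝ)).fun_mul
        hasTemperateGrowth_cubicDisc))
  refine ⟨fun z => κ (x z) - 1 / 3 * z.1 * κi (x z), ?_, ?_⟩
  · exact (hκ.comp hxt).fun_sub
      (((Function.HasTemperateGrowth.const (1 / 3 : ℝ)).fun_mul hasTemperateGrowth_fst).fun_mul
        (hκi.comp hxt))
  intro s P hE hR
  set R := s ^ 3 + P * s with hRdef
  set q := σ (1 / 108 * cubicDisc (P, R)) with hq
  have hq1 : q = √(1 / 108 * cubicDisc (P, R)) := by
    rw [hq, hσ' _ (by linarith), ← Real.sqrt_eq_rpow]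
  have hq2 : q ^ 2 = 1 / 108 * cubicDisc (P, R) := by
    rw [hq1, Real.sq_sqrt (by linarith)]
  have hq3 : 0 ≤ q := by rw [hq1]; exact Real.sqrt_nonneg _
  have hq4 : 9 / 100 ≤ q := by nlinarith
  have hxx : x (P, R) = 1 / 2 * R + q := rfl
  have hxl : 1 / 30 ≤ x (P, R) := by rw [hxx]; linarith
  have hx0 : 0 < x (P, R) := by linarith
  show κ (x (P, R)) - 1 / 3 * P * κi (x (P, R)) = s
  rw [hκ' _ hxl, hκi' _ hxl]
  set y := x (P, R) with hy
  set u := y ^ (1 / 3 : ℝ) with hu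
  have hu0 : 0 < u := Real.rpow_pos_of_pos hx0 _
  have hu3 : u ^ 3 = y := by
    rw [hu, ← Real.rpow_natCast, ← Real.rpow_mul hx0.le]; norm_num
  have hui : y ^ (-(1 / 3) : ℝ) = u⁻¹ := by rw [Real.rpow_neg hx0.le]
  rw [hui]
  apply root_unique_of_cubicDisc_pos (P := P) _ (by rw [← hRdef]; linarith)
  rw [← hRdef]
  have hy2 : y ^ 2 - R * y - P ^ 3 / 27 = 0 := by
    have : (y - R / 2) ^ 2 = 1 / 108 * cubicDisc (P, R) := by rw [← hq2, hxx]; ring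
    simp only [cubicDisc] at this
    linear_combination this
  have hkey : (u - 1 / 3 * P * u⁻¹) ^ 3 + P * (u - 1 / 3 * P * u⁻¹) = y - P ^ 3 / (27 * y) := by
    rw [← hu3]; field_simp; ring
  rw [hkey]
  field_simp
  linear_combination 27 * hy2

/-- Away from the discriminant locus, the value of `exp (i s)` at the unique real root. -/
theorem exists_temperate_exp_real_root :
    ∃ h : ℝ × ℝ → ℂ, h.HasTemperateGrowth ∧ ∀ s P : ℝ,
      1 ≤ cubicDisc (P, s ^ 3 + P * s) → h (P, s ^ 3 + P * s) = Complex.exp (s * Complex.I) := by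
  obtain ⟨r, hr, hr'⟩ := exists_temperate_real_root
  -- The symmetry `(s, R) ↦ (-s, -R)` handles negative `R`. The weight `θ` vanishes for `R ≤ -1/10`
  -- and is `1` for `R ≥ 1/10`, so each formula is used only where it is valid.
  set θ : ℝ × ℝ → ℝ := fun z => Real.smoothTransition (5 * z.2 + 1 / 2)
  have hθ : θ.HasTemperateGrowth := hasTemperateGrowth_smoothTransition.comp
    (((Function.HasTemperateGrowth.const (5 : ℝ)).fun_mul hasTemperateGrowth_snd).fun_add (.const _))
  have hneg : (fun z : ℝ × ℝ => (z.1, -z.2)).HasTemperateGrowth :=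
    ((ContinuousLinearMap.fst ℝ ℝ ℝ).prod (-ContinuousLinearMap.snd ℝ ℝ ℝ)).hasTemperateGrowth
  refine ⟨fun z => θ z • Complex.exp (r z * Complex.I) +
    (1 - θ z) • Complex.exp ((-r (z.1, -z.2) : ℝ) * Complex.I), ?_, ?_⟩
  · exact (hθ.fun_smul (hasTemperateGrowth_exp_mul_I.comp hr)).fun_add
      (((Function.HasTemperateGrowth.const (1 : ℝ)).fun_sub hθ).fun_smul
        (hasTemperateGrowth_exp_mul_I.comp (hr.comp hneg).fun_neg))
  intro s P hE
  have h1 : θ (P, s ^ 3 + P * s) ≠ 0 → r (P, s ^ 3 + P * s) = s := by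
    intro h
    apply hr' s P hE
    by_contra! hc
    exact h (Real.smoothTransition.zero_of_nonpos (by show 5 * (s ^ 3 + P * s) + 1 / 2 ≤ 0; linarith))
  have h2 : 1 - θ (P, s ^ 3 + P * s) ≠ 0 → -r (P, -(s ^ 3 + P * s)) = s := by
    intro h
    have e : -(s ^ 3 + P * s) = (-s) ^ 3 + P * (-s) := by ring
    rw [e, hr' (-s) P, neg_neg]
    · rw [← e]; simpa only [cubicDisc, neg_sq] using hE
    · rw [← e]
      by_contra! hc
      exact h (sub_eq_zero.2 (Real.smoothTransition.one_of_one_le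
        (by show 1 ≤ 5 * (s ^ 3 + P * s) + 1 / 2; linarith)).symm)
  simp only
  generalize θ (P, s ^ 3 + P * s) = w at h1 h2
  by_cases hw : w = 0
  · subst hw
    rw [h2 (by norm_num)]; simp
  · rw [h1 hw]
    by_cases hw' : 1 - w = 0
    · rw [show w = 1 by linarith]; simp
    · rw [h2 hw', ← add_smul]; simp

/-! ### Leibniz and Cauchy estimates for polynomial bounds on derivatives. -/

theorem iteratedFDeriv_smul_temperate_of_bound_on {E F : Type*} [NormedAddCommGroup E]
    [NormedSpace ℝ E] [NormedAddCommGroup F] [NormedSpace ℝ F] {f : E → ℝ} {g : E → F} {S : Set E}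
    (hf : f.HasTemperateGrowth) (hg : ContDiff ℝ ∞ g)
    (hgS : ∀ n : ℕ, ∃ (C : ℝ) (k : ℕ), ∀ x ∈ S, ‖iteratedFDeriv ℝ n g x‖ ≤ C * (1 + ‖x‖) ^ k)
    (hfS : ∀ x ∉ S, f =ᶠ[𝓝 x] 0) : (fun x => f x • g x).HasTemperateGrowth := by
  refine ⟨hf.1.smul hg, fun n => ?_⟩
  choose C k hCk using hgS
  obtain ⟨k₁, C₁, hC₁, h₁⟩ := hf.norm_iteratedFDeriv_le_uniform n
  set K := ∑ i ∈ Finset.range (n + 1), k i with hK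
  set D := ∑ i ∈ Finset.range (n + 1), |C i| with hD
  refine ⟨k₁ + K, ∑ i ∈ Finset.range (n + 1), (n.choose i : ℝ) * C₁ * D, fun x => ?_⟩
  by_cases hx : x ∈ S
  · refine (norm_iteratedFDeriv_smul_le hf.1 hg x (n := n) (mod_cast le_top)).trans ?_
    rw [Finset.sum_mul]
    refine Finset.sum_le_sum fun i hi => ?_
    have h1 : (1 : ℝ) ≤ 1 + ‖x‖ := by linarith [norm_nonneg x]
    have hmem : n - i ∈ Finset.range (n + 1) := by grind
    have hb : ‖iteratedFDeriv ℝ (n - i) g x‖ ≤ D * (1 + ‖x‖) ^ K := by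
      refine (hCk (n - i) x hx).trans ?_
      have e1 : C (n - i) ≤ D := (le_abs_self _).trans
        (Finset.single_le_sum (f := fun i => |C i|) (fun _ _ => abs_nonneg _) hmem)
      have e2 : k (n - i) ≤ K := Finset.single_le_sum (f := k) (fun _ _ => Nat.zero_le _) hmem
      have e3 : 0 ≤ D := Finset.sum_nonneg fun _ _ => abs_nonneg _
      gcongr
    have ha := h₁ i (by grind) x
    calc (n.choose i : ℝ) * ‖iteratedFDeriv ℝ i f x‖ * ‖iteratedFDeriv ℝ (n - i) g x‖
        ≤ (n.choose i : ℝ) * (C₁ * (1 + ‖x‖) ^ k₁) * (D * (1 + ‖x‖) ^ K) := by gcongr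
      _ = _ := by rw [pow_add]; ring
  · have : (fun x => f x • g x) =ᶠ[𝓝 x] fun _ => (0 : F) := by
      filter_upwards [hfS x hx] with y hy
      simp [hy]
    rw [(this.iteratedFDeriv ℝ n).eq_of_nhds]
    have h0 : 0 ≤ D := Finset.sum_nonneg fun _ _ => abs_nonneg _
    have : iteratedFDeriv ℝ n (fun _ : E => (0 : F)) x = 0 := by
      have := iteratedFDeriv_fun_zero (𝕜 := ℝ) (E := E) (F := F) (n := n)
      exact congrFun this x
    rw [this, norm_zero]
    positivity

/-- The one-variable Cauchy estimate on each complex line through `x`. -/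
theorem norm_fderiv_le_of_forall_closedBall {E F : Type*} [NormedAddCommGroup E]
    [NormedSpace ℂ E] [NormedAddCommGroup F] [NormedSpace ℂ F] {g : E → F}
    (hg : Differentiable ℂ g) {x : E} {r M : ℝ} (hr : 0 < r) (hM : 0 ≤ M)
    (h : ∀ y, ‖y - x‖ ≤ r → ‖g y‖ ≤ M) : ‖fderiv ℂ g x‖ ≤ M / r := by
  refine ContinuousLinearMap.opNorm_le_bound _ (by positivity) fun v => ?_
  by_cases hv : v = 0
  · simp [hv]
  have hv0 : 0 < ‖v‖ := norm_pos_iff.2 hv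
  set φ : ℂ → F := fun τ => g (x + τ • v)
  have hφ : Differentiable ℂ φ := hg.comp ((differentiable_id.smul_const v).const_add x)
  have hd : deriv φ 0 = fderiv ℂ g x v := by
    have h1 : HasDerivAt (fun τ : ℂ => x + τ • v) v 0 := by
      simpa using ((hasDerivAt_id (0 : ℂ)).smul_const v).const_add x
    have h2 : HasFDerivAt g (fderiv ℂ g x) (x + (0 : ℂ) • v) := by
      simpa using (hg x).hasFDerivAt
    exact (h2.comp_hasDerivAt (0 : ℂ) h1).deriv
  have := Complex.norm_deriv_le_of_forall_mem_sphere_norm_le (c := 0) (R := r / ‖v‖) (C := M)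
    (by positivity) hφ.diffContOnCl (fun z hz => h _ (by
      have : ‖z‖ = r / ‖v‖ := by simpa using hz
      rw [add_sub_cancel_left, norm_smul, this]; field_simp; rfl))
  rw [hd] at this
  calc _ ≤ M / (r / ‖v‖) := this
    _ = _ := by field_simp

/-- The inclusion of `ℝ²` in `ℂ²`. -/
noncomputable def realPlane : ℝ × ℝ →L[ℝ] ℂ × ℂ := Complex.ofRealCLM.prodMap Complex.ofRealCLM

/-- Cauchy estimates: polynomial bounds on a complex neighbourhood whose size shrinks at most
polynomially give polynomial bounds for all real derivatives. -/
theorem iteratedFDeriv_bound_of_tube_bound (S : Set (ℝ × ℝ)) (n : ℕ) :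
    ∀ {F : Type} [NormedAddCommGroup F] [NormedSpace ℂ F] (g : ℂ × ℂ → F) (_ : ContDiff ℂ ∞ g)
      (c : ℝ) (_ : 0 < c) (C : ℝ) (k : ℕ)
      (_ : ∀ x ∈ S, ∀ z, ‖z - realPlane x‖ ≤ c / (1 + ‖x‖) → ‖g z‖ ≤ C * (1 + ‖x‖) ^ k),
      ∃ (C' : ℝ) (k' : ℕ), ∀ x ∈ S,
        ‖iteratedFDeriv ℝ n (fun y => g (realPlane y)) x‖ ≤ C' * (1 + ‖x‖) ^ k' := by
  induction n with
  | zero =>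
    intro F _ _ g hg c hc C k h
    refine ⟨C, k, fun x hx => ?_⟩
    rw [norm_iteratedFDeriv_zero]
    exact h x hx _ (by simp; positivity)
  | succ n ih =>
    intro F _ _ g hg c hc C k h
    have hg' : ContDiff ℂ ∞ (fderiv ℂ g) := hg.fderiv_right (by simp)
    -- Each derivative halves the tube and costs one factor `1 + ‖x‖`, the inverse of its radius.
    have hb : ∀ x ∈ S, ∀ z, ‖z - realPlane x‖ ≤ (c / 2) / (1 + ‖x‖) →
        ‖fderiv ℂ g z‖ ≤ (|C| * 2 / c) * (1 + ‖x‖) ^ (k + 1) := by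
      intro x hx z hz
      have h1 : (0 : ℝ) < 1 + ‖x‖ := by linarith [norm_nonneg x]
      have := norm_fderiv_le_of_forall_closedBall (hg.differentiable (by simp)) (x := z)
        (r := (c / 2) / (1 + ‖x‖)) (M := |C| * (1 + ‖x‖) ^ k) (by positivity) (by positivity)
        (fun y hy => by
          refine (h x hx y ?_).trans ?_
          · calc ‖y - realPlane x‖ ≤ ‖y - z‖ + ‖z - realPlane x‖ := norm_sub_le_norm_sub_add_norm_sub ..
              _ ≤ (c / 2) / (1 + ‖x‖) + (c / 2) / (1 + ‖x‖) := add_le_add hy hz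
              _ = _ := by ring
          · gcongr; exact le_abs_self C)
      refine this.trans (le_of_eq ?_)
      field_simp
      ring
    obtain ⟨C', k', h'⟩ := ih (fderiv ℂ g) hg' (c / 2) (by positivity) _ _ hb
    set T : (ℂ × ℂ →L[ℂ] F) →L[ℝ] (ℝ × ℝ →L[ℝ] F) :=
      (ContinuousLinearMap.precomp F realPlane).comp
        (ContinuousLinearMap.restrictScalarsL ℂ (ℂ × ℂ) F ℝ ℝ)
    have hfd : fderiv ℝ (fun y => g (realPlane y)) = fun y => T (fderiv ℂ g (realPlane y)) := by
      ext1 y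
      have h1 : HasFDerivAt g ((fderiv ℂ g (realPlane y)).restrictScalars ℝ) (realPlane y) :=
        ((hg.differentiable (by simp) _).hasFDerivAt).restrictScalars ℝ
      exact (h1.comp y realPlane.hasFDerivAt).fderiv
    refine ⟨‖T‖ * C', k', fun x hx => ?_⟩
    rw [norm_iteratedFDeriv_fderiv.symm, hfd]
    have hcd : ContDiff ℝ ∞ (fun y => fderiv ℂ g (realPlane y)) :=
      (hg'.restrict_scalars ℝ).comp realPlane.contDiff
    refine (T.norm_iteratedFDeriv_comp_left hcd.contDiffAt (n := n) (mod_cast le_top)).trans ?_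
    rw [mul_assoc]
    gcongr
    exact h' x hx

/-! ### The remainder of `exp(i s)` modulo a cubic, and its growth. -/

/-- A complex `3 × 3` matrix as a continuous linear map. -/
noncomputable def matrixCLM (M : Matrix (Fin 3) (Fin 3) ℂ) : (Fin 3 → ℂ) →L[ℂ] (Fin 3 → ℂ) :=
  LinearMap.toContinuousLinearMap (Matrix.toLin' M)

/-- `i` times the companion matrix of `s³ + P s - R`. -/
noncomputable def companionI (z : ℂ × ℂ) : (Fin 3 → ℂ) →L[ℂ] (Fin 3 → ℂ) :=
  Complex.I • (matrixCLM !![0, 0, 0; 1, 0, 0; 0, 1, 0] + z.1 • matrixCLM !![0, 0, 0; 0, 0, -1; 0, 0, 0]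
    + z.2 • matrixCLM !![0, 0, 1; 0, 0, 0; 0, 0, 0])

theorem companionI_apply (z : ℂ × ℂ) (w : Fin 3 → ℂ) :
    companionI z w = ![Complex.I * (z.2 * w 2), Complex.I * (w 0 - z.1 * w 2), Complex.I * w 1] := by
  ext j
  fin_cases j <;>
    simp [companionI, matrixCLM, Matrix.toLin'_apply, dotProduct, Fin.sum_univ_three]
  ring

/-- The first column of `exp (i u M)`, where `M` is the companion matrix: the coefficients of the
remainder of `exp (i u s)` modulo `s³ + P s - R`. -/
noncomputable def expRemainder (u : ℂ) (z : ℂ × ℂ) : Fin 3 → ℂ :=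
  NormedSpace.exp (u • companionI z) (Pi.single 0 1)

theorem contDiff_expRemainder (u : ℂ) : ContDiff ℂ ∞ (expRemainder u) := by
  have h1 : ContDiff ℂ ∞ (fun z => u • companionI z) := by
    unfold companionI
    fun_prop
  have h2 : ContDiff ℂ ∞
      (NormedSpace.exp : ((Fin 3 → ℂ) →L[ℂ] (Fin 3 → ℂ)) → ((Fin 3 → ℂ) →L[ℂ] (Fin 3 → ℂ))) :=
    contDiff_iff_contDiffAt.2 fun x => (NormedSpace.exp_analytic (𝕂 := ℂ) x).contDiffAt
  exact (h2.comp h1).clm_apply contDiff_const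

theorem expRemainder_zero (z : ℂ × ℂ) : expRemainder 0 z = Pi.single 0 1 := by
  have h : (0 : ℂ) • companionI z = 0 :=
    ContinuousLinearMap.ext fun w => zero_smul ℂ (companionI z w)
  rw [expRemainder, h, NormedSpace.exp_zero, one_apply_eq_self]

theorem hasDerivAt_expRemainder (z : ℂ × ℂ) (u : ℝ) :
    HasDerivAt (fun u : ℝ => expRemainder u z) (companionI z (expRemainder u z)) u := by
  have h := (hasDerivAt_exp_smul_const' (companionI z) (u : ℂ)).clm_apply
    (hasDerivAt_const (u : ℂ) (Pi.single 0 1 : Fin 3 → ℂ))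
  simp only [map_zero, add_zero] at h
  simpa using! h.scomp u (Complex.ofRealCLM.hasDerivAt (x := u))

theorem hasDerivAt_expRemainder_zero (z : ℂ × ℂ) (u : ℝ) :
    HasDerivAt (fun u : ℝ => expRemainder u z 0) (Complex.I * (z.2 * expRemainder u z 2)) u := by
  have := hasDerivAt_pi.1 (hasDerivAt_expRemainder z u) 0
  simpa [companionI_apply] using this

theorem hasDerivAt_expRemainder_one (z : ℂ × ℂ) (u : ℝ) :
    HasDerivAt (fun u : ℝ => expRemainder u z 1)
      (Complex.I * (expRemainder u z 0 - z.1 * expRemainder u z 2)) u := by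
  have := hasDerivAt_pi.1 (hasDerivAt_expRemainder z u) 1
  simpa [companionI_apply] using this

theorem hasDerivAt_expRemainder_two (z : ℂ × ℂ) (u : ℝ) :
    HasDerivAt (fun u : ℝ => expRemainder u z 2) (Complex.I * expRemainder u z 1) u := by
  have := hasDerivAt_pi.1 (hasDerivAt_expRemainder z u) 2
  simpa [companionI_apply] using this

/-- For a root `s`, the row `(1, s, s²)` is a left eigenvector of the companion matrix with
eigenvalue `s`. Its pairing with the remainder therefore solves the same scalar equation as `exp(i u
s)`. -/
theorem expRemainder_eval {z : ℂ × ℂ} {s : ℂ} (hs : s ^ 3 + z.1 * s = z.2) :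
    expRemainder 1 z 0 + s * expRemainder 1 z 1 + s ^ 2 * expRemainder 1 z 2 =
      Complex.exp (s * Complex.I) := by
  set φ : ℝ → ℂ := fun u => Complex.exp (-(u * (s * Complex.I))) *
    (expRemainder u z 0 + s * expRemainder u z 1 + s ^ 2 * expRemainder u z 2) with hφ
  have hd : ∀ u : ℝ, HasDerivAt φ 0 u := by
    intro u
    have h1 : HasDerivAt (fun u : ℝ => Complex.exp (-(u * (s * Complex.I))))
        (Complex.exp (-(u * (s * Complex.I))) * (-(1 * (s * Complex.I)))) u :=
      (((Complex.ofRealCLM.hasDerivAt (x := u)).mul_const (s * Complex.I)).neg).cexp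
    have h2 := ((hasDerivAt_expRemainder_zero z u).add
      ((hasDerivAt_expRemainder_one z u).const_mul s)).add
      ((hasDerivAt_expRemainder_two z u).const_mul (s ^ 2))
    refine (h1.mul h2).congr_deriv ?_
    simp only [Pi.add_apply]
    linear_combination (-(Complex.exp (-(u * (s * Complex.I)))) * Complex.I *
      expRemainder u z 2) * hs
  have hc := is_const_of_deriv_eq_zero (fun u => (hd u).differentiableAt) (fun u => (hd u).deriv) 1 0
  simp only [hφ, Complex.ofReal_one, Complex.ofReal_zero, expRemainder_zero] at hc
  simp at hc
  rw [Complex.exp_neg] at hc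
  field_simp at hc
  linear_combination hc

/-- Energy estimate for a bidiagonal system whose diagonal has bounded imaginary parts. -/
theorem bidiagonal_energy {r₁ r₂ r₃ : ℂ} {y₁ y₂ y₃ : ℝ → ℂ}
    (h₁ : |r₁.im| ≤ 2) (h₂ : |r₂.im| ≤ 2) (h₃ : |r₃.im| ≤ 2)
    (hy₁ : ∀ u, HasDerivAt y₁ (Complex.I * (r₁ * y₁ u)) u)
    (hy₂ : ∀ u, HasDerivAt y₂ (Complex.I * (y₁ u + r₂ * y₂ u)) u)
    (hy₃ : ∀ u, HasDerivAt y₃ (Complex.I * (y₂ u + r₃ * y₃ u)) u) :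
    ‖y₁ 1‖ ^ 2 + ‖y₂ 1‖ ^ 2 + ‖y₃ 1‖ ^ 2 ≤
      Real.exp 6 * (‖y₁ 0‖ ^ 2 + ‖y₂ 0‖ ^ 2 + ‖y₃ 0‖ ^ 2) := by
  set f : ℝ → ℝ := fun u => ‖y₁ u‖ ^ 2 + ‖y₂ u‖ ^ 2 + ‖y₃ u‖ ^ 2 with hf
  have hn : ∀ w : ℂ, ‖w‖ ^ 2 = w.re ^ 2 + w.im ^ 2 := fun w => by
    rw [← Complex.normSq_eq_norm_sq, Complex.normSq_apply]; ring
  have hd : ∀ u, HasDerivAt f _ u := fun u =>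
    ((hy₁ u).norm_sq.add (hy₂ u).norm_sq).add (hy₃ u).norm_sq
  -- The diagonal contributes at most `4 f`, since `|Im rⱼ| ≤ 2`, and the two couplings at most `2
  -- f`.
  have hle : ∀ u, deriv f u ≤ 6 * f u := by
    intro u
    rw [(hd u).deriv]
    simp only [hf, hn, Complex.inner, Complex.mul_re, Complex.mul_im, Complex.I_re, Complex.I_im,
      Complex.add_re, Complex.add_im, Complex.conj_re, Complex.conj_im]
    rw [abs_le] at h₁ h₂ h₃
    generalize (y₁ u).re = a₁, (y₁ u).im = b₁, (y₂ u).re = a₂, (y₂ u).im = b₂, (y₃ u).re = a₃,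
      (y₃ u).im = b₃
    have e₁ := mul_nonneg (by linarith : 0 ≤ 2 + r₁.im) (add_nonneg (sq_nonneg a₁) (sq_nonneg b₁))
    have e₂ := mul_nonneg (by linarith : 0 ≤ 2 + r₂.im) (add_nonneg (sq_nonneg a₂) (sq_nonneg b₂))
    have e₃ := mul_nonneg (by linarith : 0 ≤ 2 + r₃.im) (add_nonneg (sq_nonneg a₃) (sq_nonneg b₃))
    nlinarith [sq_nonneg (a₂ + b₁), sq_nonneg (b₂ - a₁), sq_nonneg (a₃ + b₂), sq_nonneg (b₃ - a₂),
      sq_nonneg a₁, sq_nonneg b₁, sq_nonneg a₃, sq_nonneg b₃]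
  set g : ℝ → ℝ := fun u => Real.exp (-6 * u) * f u with hg
  have hgd : ∀ u, HasDerivAt g (Real.exp (-6 * u) * (-6 * 1) * f u + Real.exp (-6 * u) * deriv f u) u :=
    fun u => (((hasDerivAt_id u).const_mul (-6)).exp).mul (hd u).differentiableAt.hasDerivAt
  have hanti : Antitone g := antitone_of_deriv_nonpos (fun u => (hgd u).differentiableAt) (fun u => by
    rw [(hgd u).deriv]
    have := mul_le_mul_of_nonneg_left (hle u) (Real.exp_pos (-6 * u)).le
    linarith)
  have h := hanti (zero_le_one)
  simp only [hg, mul_one, mul_zero, Real.exp_zero, one_mul] at h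
  rw [Real.exp_neg] at h
  have h6 := Real.exp_pos 6
  calc f 1 = Real.exp 6 * ((Real.exp 6)⁻¹ * f 1) := by field_simp
    _ ≤ _ := by gcongr

theorem exists_cubic_roots (P R : ℂ) : ∃ r₁ r₂ r₃ : ℂ, r₁ + r₂ + r₃ = 0 ∧
    r₁ * r₂ + r₁ * r₃ + r₂ * r₃ = P ∧ r₁ * r₂ * r₃ = R := by
  obtain ⟨r, hr⟩ : ∃ r : ℂ, r ^ 3 + P * r - R = 0 := by
    have hdeg : (Polynomial.X ^ 3 + Polynomial.C P * Polynomial.X - Polynomial.C R).degree = 3 := by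
      compute_degree!
    obtain ⟨r, hr⟩ := Complex.exists_root (f := Polynomial.X ^ 3 + Polynomial.C P * Polynomial.X
      - Polynomial.C R) (by rw [hdeg]; norm_num)
    exact ⟨r, by simpa [Polynomial.IsRoot] using hr⟩
  obtain ⟨d, hd⟩ := IsAlgClosed.exists_pow_nat_eq (r ^ 2 - 4 * (r ^ 2 + P)) (n := 2) (by norm_num)
  refine ⟨r, (-r + d) / 2, (-r - d) / 2, by ring, ?_, ?_⟩
  · linear_combination (-1 / 4) * hd
  · linear_combination hr - r / 4 * hd

theorem norm_root_le {P R r : ℂ} (hr : r ^ 3 + P * r = R) : ‖r‖ ≤ 1 + ‖P‖ + ‖R‖ := by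
  by_contra! h
  have hP := norm_nonneg P
  have hR := norm_nonneg R
  have h1 : 1 < ‖r‖ := by linarith
  have h3 : ‖r‖ ^ 3 ≤ ‖R‖ + ‖P‖ * ‖r‖ := by
    have : r ^ 3 = R - P * r := by rw [← hr]; ring
    rw [← norm_pow, this, ← norm_mul]
    exact norm_sub_le _ _
  nlinarith [mul_pos (by linarith : 0 < ‖r‖) (by linarith : 0 < ‖r‖)]

/-- In the Newton basis `1`, `s - r₁`, `(s - r₁)(s - r₂)` the companion system becomes bidiagonal
with the roots on the diagonal. No difference of roots is inverted, so the bound is uniform as roots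
merge. Returning to the monomial basis costs only powers of the roots. -/
theorem norm_expRemainder_le {z : ℂ × ℂ}
    (h : ∀ r : ℂ, r ^ 3 + z.1 * r = z.2 → |r.im| ≤ 2) :
    ‖expRemainder 1 z‖ ≤ 20 * Real.exp 3 * (1 + 2 * ‖z‖) ^ 3 := by
  obtain ⟨r₁, r₂, r₃, hs, hP, hR⟩ := exists_cubic_roots z.1 z.2
  have root₁ : r₁ ^ 3 + z.1 * r₁ = z.2 := by
    rw [← hP, ← hR]; linear_combination r₁ ^ 2 * hs
  have root₂ : r₂ ^ 3 + z.1 * r₂ = z.2 := by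
    rw [← hP, ← hR]; linear_combination r₂ ^ 2 * hs
  have root₃ : r₃ ^ 3 + z.1 * r₃ = z.2 := by
    rw [← hP, ← hR]; linear_combination r₃ ^ 2 * hs
  set A := 1 + 2 * ‖z‖ with hA
  have hA1 : 1 ≤ A := by linarith [norm_nonneg z]
  have hle : ∀ r : ℂ, r ^ 3 + z.1 * r = z.2 → ‖r‖ ≤ A := fun r hr => by
    linarith [norm_root_le hr, norm_fst_le z, norm_snd_le z]
  have b₁ := hle _ root₁
  have b₂ := hle _ root₂
  have en := bidiagonal_energy (r₁ := r₁) (r₂ := r₂) (r₃ := r₃)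
    (y₁ := fun u => expRemainder u z 0 + r₁ * expRemainder u z 1 + r₁ ^ 2 * expRemainder u z 2)
    (y₂ := fun u => expRemainder u z 1 + (r₁ + r₂) * expRemainder u z 2)
    (y₃ := fun u => expRemainder u z 2) (h _ root₁) (h _ root₂) (h _ root₃)
    (fun u => (((hasDerivAt_expRemainder_zero z u).add
      ((hasDerivAt_expRemainder_one z u).const_mul r₁)).add
      ((hasDerivAt_expRemainder_two z u).const_mul (r₁ ^ 2))).congr_deriv (by
        linear_combination (-Complex.I * expRemainder u z 2) * root₁))
    (fun u => ((hasDerivAt_expRemainder_one z u).add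
      ((hasDerivAt_expRemainder_two z u).const_mul (r₁ + r₂))).congr_deriv (by
        rw [← hP]
        linear_combination (-Complex.I * expRemainder u z 2 * (r₁ + r₂)) * hs))
    (fun u => (hasDerivAt_expRemainder_two z u).congr_deriv (by
        linear_combination (-Complex.I * expRemainder u z 2) * hs))
  simp only [Complex.ofReal_one, Complex.ofReal_zero, expRemainder_zero] at en
  simp only [Pi.single_eq_same, ne_eq, one_ne_zero, not_false_eq_true, Pi.single_eq_of_ne,
    Fin.reduceEq, mul_zero, add_zero, norm_one, norm_zero] at en
  set w := expRemainder 1 z with hw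
  set e := Real.exp 3 with he
  have he0 : 0 < e := Real.exp_pos 3
  have he6 : Real.exp 6 = e ^ 2 := by
    rw [he, ← Real.exp_nat_mul]; norm_num
  rw [he6] at en
  norm_num at en
  have n₁ : ‖w 0 + r₁ * w 1 + r₁ ^ 2 * w 2‖ ≤ e := abs_le_of_sq_le_sq' (by nlinarith [sq_nonneg ‖w 2‖, sq_nonneg ‖w 1 + (r₁ + r₂) * w 2‖]) he0.le |>.2
  have n₂ : ‖w 1 + (r₁ + r₂) * w 2‖ ≤ e := abs_le_of_sq_le_sq' (by nlinarith [sq_nonneg ‖w 2‖, sq_nonneg ‖w 0 + r₁ * w 1 + r₁ ^ 2 * w 2‖]) he0.le |>.2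
  have n₃ : ‖w 2‖ ≤ e := abs_le_of_sq_le_sq' (by nlinarith [sq_nonneg ‖w 1 + (r₁ + r₂) * w 2‖, sq_nonneg ‖w 0 + r₁ * w 1 + r₁ ^ 2 * w 2‖]) he0.le |>.2
  have m₁ : ‖w 1‖ ≤ e + 2 * A * e := by
    have : w 1 = (w 1 + (r₁ + r₂) * w 2) - (r₁ + r₂) * w 2 := by ring
    rw [this]
    refine (norm_sub_le _ _).trans (add_le_add n₂ ?_)
    rw [norm_mul]
    have := norm_add_le r₁ r₂
    gcongr
    linarith
  have m₀ : ‖w 0‖ ≤ e + A * (e + 2 * A * e) + A ^ 2 * e := by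
    have : w 0 = (w 0 + r₁ * w 1 + r₁ ^ 2 * w 2) - r₁ * w 1 - r₁ ^ 2 * w 2 := by ring
    rw [this]
    refine (norm_sub_le _ _).trans (add_le_add ((norm_sub_le _ _).trans (add_le_add n₁ ?_)) ?_)
    · rw [norm_mul]; gcongr
    · rw [norm_mul, norm_pow]; gcongr
  have a2 : A ≤ A ^ 3 := le_self_pow₀ hA1 (by norm_num)
  have a3 : A ^ 2 ≤ A ^ 3 := pow_le_pow_right₀ hA1 (by norm_num)
  have a1 : 1 ≤ A ^ 3 := one_le_pow₀ hA1
  rw [pi_norm_le_iff_of_nonneg (by positivity)]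
  intro j
  fin_cases j
  · exact m₀.trans (by nlinarith)
  · exact m₁.trans (by nlinarith)
  · exact n₃.trans (by nlinarith)

theorem abs_im_root_le_one {P R : ℝ} (hE : cubicDisc (P, R) ≤ 2) {r : ℂ}
    (hr : r ^ 3 + P * r = R) : |r.im| ≤ 1 := by
  set x := r.re with hx
  set y := r.im with hy
  by_cases hy0 : y = 0
  · rw [hy0]; simp
  have hre := congrArg Complex.re hr
  have him := congrArg Complex.im hr
  simp only [pow_succ, pow_zero, one_mul, Complex.add_re, Complex.add_im, Complex.mul_re,
    Complex.mul_im, Complex.ofReal_re, Complex.ofReal_im, ← hx, ← hy] at hre him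
  have hP : P = y ^ 2 - 3 * x ^ 2 := by
    have : y * (3 * x ^ 2 - y ^ 2 + P) = 0 := by linear_combination him
    rcases mul_eq_zero.1 this with h | h
    · exact absurd h hy0
    · linarith
  have hR : R = -2 * x * (x ^ 2 + y ^ 2) := by
    rw [hP] at hre; linear_combination -hre
  -- For a non-real root `x + i y`, the real and imaginary parts determine `P` and `R`, and the
  -- discriminant quantity becomes this expression.
  have hE' : 4 * y ^ 2 * (9 * x ^ 2 + y ^ 2) ^ 2 ≤ 2 := by
    calc _ = cubicDisc (P, R) := by simp only [cubicDisc]; rw [hP, hR]; ring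
      _ ≤ 2 := hE
  rw [abs_le_one_iff_mul_self_le_one]
  by_contra! h
  have h2 : 1 < y ^ 2 := by rw [sq]; exact h
  have h3 : 1 ≤ (9 * x ^ 2 + y ^ 2) ^ 2 := one_le_pow₀ (by nlinarith [sq_nonneg x])
  nlinarith

/-- A root `r` of the perturbed cubic satisfies `∏ (r - rⱼ) = (z₂ - R) - (z₁ - P) r`. As `r` may be
as large as `2 (1 + ‖x‖)`, a tube of radius proportional to `1 / (1 + ‖x‖)` keeps this product below
`1`, so some unperturbed root lies within distance `1`. -/
theorem abs_im_root_le_two_of_near {x : ℝ × ℝ} (hE : cubicDisc x ≤ 2) {z : ℂ × ℂ}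
    (hz : ‖z - realPlane x‖ ≤ (1 / 5) / (1 + ‖x‖)) {r : ℂ} (hr : r ^ 3 + z.1 * r = z.2) :
    |r.im| ≤ 2 := by
  obtain ⟨P, R⟩ := x
  obtain ⟨r₁, r₂, r₃, hs, hP, hR⟩ := exists_cubic_roots P R
  have i₁ := abs_im_root_le_one hE (r := r₁) (by rw [← hP, ← hR]; linear_combination r₁ ^ 2 * hs)
  have i₂ := abs_im_root_le_one hE (r := r₂) (by rw [← hP, ← hR]; linear_combination r₂ ^ 2 * hs)
  have i₃ := abs_im_root_le_one hE (r := r₃) (by rw [← hP, ← hR]; linear_combination r₃ ^ 2 * hs)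
  have hx0 := norm_nonneg (P, R)
  set m := ‖(P, R)‖ with hm
  have hm1 : 0 < 1 + m := by linarith
  have d₁ : ‖z.1 - P‖ ≤ (1 / 5) / (1 + m) := (norm_fst_le (z - realPlane (P, R))).trans hz
  have d₂ : ‖z.2 - R‖ ≤ (1 / 5) / (1 + m) := (norm_snd_le (z - realPlane (P, R))).trans hz
  have hsmall : (1 / 5) / (1 + m) ≤ 1 / 5 := div_le_self (by norm_num) (by linarith)
  have hP' : ‖z.1‖ ≤ m + 1 / 5 := by
    have h1 : ‖(P : ℂ)‖ ≤ m := by rw [Complex.norm_real]; exact norm_fst_le (P, R)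
    have := norm_le_norm_add_norm_sub' z.1 (P : ℂ)
    linarith
  have hR' : ‖z.2‖ ≤ m + 1 / 5 := by
    have h1 : ‖(R : ℂ)‖ ≤ m := by rw [Complex.norm_real]; exact norm_snd_le (P, R)
    have := norm_le_norm_add_norm_sub' z.2 (R : ℂ)
    linarith
  have hrn : ‖r‖ ≤ 2 * (1 + m) := by linarith [norm_root_le hr]
  have hprod : ‖r - r₁‖ * ‖r - r₂‖ * ‖r - r₃‖ ≤ 1 := by
    rw [← norm_mul, ← norm_mul]
    have : (r - r₁) * (r - r₂) * (r - r₃) = (z.2 - R) - (z.1 - P) * r := by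
      rw [← hP, ← hR]; linear_combination hr - r ^ 2 * hs
    rw [this]
    calc _ ≤ ‖z.2 - R‖ + ‖z.1 - P‖ * ‖r‖ := by
          rw [← norm_mul]; exact norm_sub_le _ _
      _ ≤ 1 / 5 + (1 / 5) / (1 + m) * (2 * (1 + m)) := by gcongr; exact d₂.trans hsmall
      _ = 3 / 5 := by field_simp; norm_num
      _ ≤ 1 := by norm_num
  have key : ∀ r' : ℂ, |r'.im| ≤ 1 → ‖r - r'‖ ≤ 1 → |r.im| ≤ 2 := by
    intro r' h1 h2
    have h3 : |r.im - r'.im| ≤ 1 := by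
      rw [← Complex.sub_im]; exact (Complex.abs_im_le_norm _).trans h2
    rw [abs_le] at *
    constructor <;> linarith [h1.1, h1.2, h3.1, h3.2]
  by_contra hcon
  have n₁ : 1 < ‖r - r₁‖ := by by_contra! h; exact hcon (key _ i₁ h)
  have n₂ : 1 < ‖r - r₂‖ := by by_contra! h; exact hcon (key _ i₂ h)
  have n₃ : 1 < ‖r - r₃‖ := by by_contra! h; exact hcon (key _ i₃ h)
  have := one_lt_mul_of_lt_of_le n₁ n₂.le
  have := one_lt_mul_of_lt_of_le this n₃.le
  linarith

/-- The cubic division of `exp (i s)` with coefficients of temperate growth. -/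
theorem exists_temperate_cubic_division_exp :
    ∃ H : Fin 3 → ℝ × ℝ → ℂ, (∀ j, (H j).HasTemperateGrowth) ∧ ∀ s P : ℝ,
      Complex.exp (s * Complex.I) = ∑ j : Fin 3, (s : ℂ) ^ (j : ℕ) * H j (P, s ^ 3 + P * s) := by
  obtain ⟨h, hh, hh'⟩ := exists_temperate_exp_real_root
  -- `χ` is `1` where `cubicDisc ≤ 1` and `0` where `cubicDisc ≥ 2`. The algebraic remainder is used
  -- on the support of `χ`; elsewhere the unique real root allows a remainder constant in `s`, which
  -- enters only the coefficient `j = 0`.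
  set χ : ℝ × ℝ → ℝ := fun x => Real.smoothTransition (2 - cubicDisc x) with hχ
  have hχt : χ.HasTemperateGrowth := hasTemperateGrowth_smoothTransition.comp
    ((Function.HasTemperateGrowth.const (2 : ℝ)).fun_sub hasTemperateGrowth_cubicDisc)
  have hcont : Continuous cubicDisc := hasTemperateGrowth_cubicDisc.1.continuous
  have hA : (fun x => χ x • expRemainder 1 (realPlane x)).HasTemperateGrowth := by
    refine iteratedFDeriv_smul_temperate_of_bound_on (S := {x | cubicDisc x ≤ 2}) hχt
      (((contDiff_expRemainder 1).restrict_scalars ℝ).comp realPlane.contDiff) (fun n => ?_) ?_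
    · refine iteratedFDeriv_bound_of_tube_bound _ n (expRemainder 1) (contDiff_expRemainder 1)
        (1 / 5) (by norm_num) (20 * Real.exp 3 * 4 ^ 3) 3 (fun x hx z hz => ?_)
      refine (norm_expRemainder_le fun r hr => abs_im_root_le_two_of_near hx hz hr).trans ?_
      rw [mul_assoc _ (4 ^ 3), ← mul_pow]
      have hx0 := norm_nonneg x
      have h1 : (1 / 5) / (1 + ‖x‖) ≤ 1 / 5 := div_le_self (by norm_num) (by linarith)
      have h2 : ‖realPlane x‖ ≤ ‖x‖ := by
        rw [Prod.norm_def]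
        refine max_le ?_ ?_
        · exact (Complex.norm_real x.1).le.trans (norm_fst_le x)
        · exact (Complex.norm_real x.2).le.trans (norm_snd_le x)
      have h3 := norm_le_norm_add_norm_sub' z (realPlane x)
      gcongr
      linarith
    · intro x hx
      have hx' : 2 < cubicDisc x := not_le.1 hx
      filter_upwards [hcont.continuousAt.eventually (lt_mem_nhds hx')] with y hy
      exact Real.smoothTransition.zero_of_nonpos (by linarith)
  refine ⟨fun j x => χ x • expRemainder 1 (realPlane x) j +
    (if j = 0 then (1 - χ x) • h x else 0), fun j => ?_, fun s P => ?_⟩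
  · refine Function.HasTemperateGrowth.fun_add ?_ ?_
    · exact ((ContinuousLinearMap.proj (R := ℝ) (φ := fun _ : Fin 3 => ℂ) j).hasTemperateGrowth).comp hA
    · split_ifs
      · exact ((Function.HasTemperateGrowth.const (1 : ℝ)).fun_sub hχt).fun_smul hh
      · exact .const 0
  · set x : ℝ × ℝ := (P, s ^ 3 + P * s) with hx
    have e1 : expRemainder 1 (realPlane x) 0 + s * expRemainder 1 (realPlane x) 1 +
        (s : ℂ) ^ 2 * expRemainder 1 (realPlane x) 2 = Complex.exp (s * Complex.I) :=
      expRemainder_eval (by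
        show (s : ℂ) ^ 3 + (P : ℂ) * s = ((s ^ 3 + P * s : ℝ) : ℂ)
        push_cast; ring)
    have e2 : (1 - χ x) • h x = (1 - χ x) • Complex.exp (s * Complex.I) := by
      by_cases hE : 1 ≤ cubicDisc x
      · rw [hh' s P hE]
      · have : χ x = 1 := Real.smoothTransition.one_of_one_le (by linarith)
        simp [this]
    rw [Fin.sum_univ_three]
    simp only [Fin.isValue, ↓reduceIte, one_ne_zero, Fin.reduceEq, Fin.coe_ofNat_eq_mod, Nat.zero_mod,
      Nat.one_mod, Nat.reduceMod, pow_zero, pow_one, one_mul, add_zero, e2, Complex.real_smul]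
    push_cast
    linear_combination (-(χ x : ℂ)) * e1

/-! ### Smooth dependence of integrals on parameters. -/

section

open MeasureTheory

theorem iteratedFDeriv_partial {Z Y F : Type*} [NormedAddCommGroup Z] [NormedSpace ℝ Z]
    [NormedAddCommGroup Y] [NormedSpace ℝ Y] [NormedAddCommGroup F] [NormedSpace ℝ F]
    {G : Z × Y → F} (hG : ContDiff ℝ ∞ G) (n : ℕ) (ζ : Z) (y : Y) :
    iteratedFDeriv ℝ n (fun y => G (ζ, y)) y =
      (iteratedFDeriv ℝ n G (ζ, y)).compContinuousLinearMap
        fun _ => ContinuousLinearMap.inr ℝ Z Y := by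
  have h : (fun y => G (ζ, y)) =
      (fun z => G ((ζ, 0) + z)) ∘ (ContinuousLinearMap.inr ℝ Z Y) := by
    ext y; simp
  have hc : ContDiff ℝ ∞ (fun z => G ((ζ, 0) + z)) := hG.comp (contDiff_const.add contDiff_id)
  rw [h, ContinuousLinearMap.iteratedFDeriv_comp_right _ hc y (i := n) (mod_cast le_top),
    iteratedFDeriv_comp_add_left]
  simp

theorem norm_iteratedFDeriv_partial_le {Z Y F : Type*} [NormedAddCommGroup Z] [NormedSpace ℝ Z]
    [NormedAddCommGroup Y] [NormedSpace ℝ Y] [NormedAddCommGroup F] [NormedSpace ℝ F]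
    {G : Z × Y → F} (hG : ContDiff ℝ ∞ G) (n : ℕ) (ζ : Z) (y : Y) :
    ‖iteratedFDeriv ℝ n (fun y => G (ζ, y)) y‖ ≤ ‖iteratedFDeriv ℝ n G (ζ, y)‖ := by
  rw [iteratedFDeriv_partial hG]
  refine (ContinuousMultilinearMap.norm_compContinuousLinearMap_le _ _).trans ?_
  refine mul_le_of_le_one_right (norm_nonneg _) (Finset.prod_le_one (fun _ _ => norm_nonneg _) ?_)
  intro _ _
  refine ContinuousLinearMap.opNorm_le_bound _ zero_le_one fun v => ?_
  simp [Prod.norm_def]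

theorem continuous_iteratedFDeriv_partial {Z Y F : Type*} [NormedAddCommGroup Z] [NormedSpace ℝ Z]
    [NormedAddCommGroup Y] [NormedSpace ℝ Y] [NormedAddCommGroup F] [NormedSpace ℝ F]
    {G : Z × Y → F} (hG : ContDiff ℝ ∞ G) (n : ℕ) (y : Y) :
    Continuous fun ζ => iteratedFDeriv ℝ n (fun y => G (ζ, y)) y := by
  simp_rw [iteratedFDeriv_partial hG]
  have h1 : Continuous (iteratedFDeriv ℝ n G) := hG.continuous_iteratedFDeriv (mod_cast le_top)
  exact (ContinuousMultilinearMap.compContinuousLinearMapL (𝕜 := ℝ) (F := F)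
    (fun _ : Fin n => ContinuousLinearMap.inr ℝ Z Y)).continuous.comp
    (h1.comp (continuous_id.prodMk continuous_const))

/-- Parametric integrals of smooth functions with locally dominated derivatives are smooth. -/
theorem contDiff_integral_of_dominated {Z Y F : Type*} [NormedAddCommGroup Z] [NormedSpace ℝ Z]
    [SecondCountableTopology Z] [MeasurableSpace Z] [BorelSpace Z] {μ : Measure Z}
    [NormedAddCommGroup Y] [NormedSpace ℝ Y] [NormedAddCommGroup F] [NormedSpace ℝ F]
    {G : Z × Y → F} (hG : ContDiff ℝ ∞ G)
    (hb : ∀ (n : ℕ) (y₀ : Y), ∃ bound : Z → ℝ, Integrable bound μ ∧ ∃ s ∈ 𝓝 y₀,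
      ∀ᵐ ζ ∂μ, ∀ y ∈ s, ‖iteratedFDeriv ℝ n (fun y => G (ζ, y)) y‖ ≤ bound ζ) :
    ContDiff ℝ ∞ (fun y => ∫ ζ, G (ζ, y) ∂μ) := by
  have hsm : ∀ ζ, ContDiff ℝ ∞ (fun y => G (ζ, y)) := fun ζ =>
    hG.comp (contDiff_const.prodMk contDiff_id)
  have hmeas : ∀ n y, AEStronglyMeasurable
      (fun ζ => iteratedFDeriv ℝ n (fun y => G (ζ, y)) y) μ := fun n y =>
    (continuous_iteratedFDeriv_partial hG n y).aestronglyMeasurable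
  have hint : ∀ n y, Integrable (fun ζ => iteratedFDeriv ℝ n (fun y => G (ζ, y)) y) μ := by
    intro n y
    obtain ⟨bound, hbi, s, hs, hle⟩ := hb n y
    exact hbi.mono' (hmeas n y) (hle.mono fun ζ h => h y (mem_of_mem_nhds hs))
  have hder : ∀ (m : ℕ) (y : Y), HasFDerivAt
      (fun y => ∫ ζ, iteratedFDeriv ℝ m (fun y => G (ζ, y)) y ∂μ)
      ((∫ ζ, iteratedFDeriv ℝ (m + 1) (fun y => G (ζ, y)) y ∂μ).curryLeft) y := by
    intro m y
    obtain ⟨bound, hbi, s, hs, hle⟩ := hb (m + 1) y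
    have hfd : ∀ ζ y, fderiv ℝ (iteratedFDeriv ℝ m (fun y => G (ζ, y))) y =
        continuousMultilinearCurryLeftEquiv ℝ (fun _ => Y) F
          (iteratedFDeriv ℝ (m + 1) (fun y => G (ζ, y)) y) := fun ζ y => by
      rw [fderiv_iteratedFDeriv]; rfl
    have h := hasFDerivAt_integral_of_dominated_of_fderiv_le (μ := μ) (𝕜 := ℝ) (x₀ := y)
      (F := fun y ζ => iteratedFDeriv ℝ m (fun y => G (ζ, y)) y)
      (F' := fun y ζ => fderiv ℝ (iteratedFDeriv ℝ m (fun y => G (ζ, y))) y) (bound := bound) hs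
      (Eventually.of_forall fun y => hmeas m y) (hint m y)
      (by
        simp_rw [hfd]
        exact (LinearIsometryEquiv.continuous _).comp_aestronglyMeasurable (hmeas (m + 1) y))
      (hle.mono fun ζ h y hy => by
        rw [norm_fderiv_iteratedFDeriv]; exact h y hy) hbi
      (Eventually.of_forall fun ζ y _ =>
        ((hsm ζ).differentiable_iteratedFDeriv (m := m) (by exact_mod_cast WithTop.coe_lt_top m)
          y).hasFDerivAt)
    simp_rw [hfd] at h
    let L : ContinuousMultilinearMap ℝ (fun _ : Fin (m + 1) => Y) F ≃L[ℝ]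
        (Y →L[ℝ] ContinuousMultilinearMap ℝ (fun _ : Fin m => Y) F) :=
      (continuousMultilinearCurryLeftEquiv ℝ (fun _ : Fin (m + 1) => Y) F).toContinuousLinearEquiv
    have e := ContinuousLinearEquiv.integral_comp_comm (𝕜 := ℝ)
      (E := ContinuousMultilinearMap ℝ (fun _ : Fin (m + 1) => Y) F)
      (F := Y →L[ℝ] ContinuousMultilinearMap ℝ (fun _ : Fin m => Y) F) (μ := μ) L
      (fun ζ => iteratedFDeriv ℝ (m + 1) (fun y => G (ζ, y)) y)
    refine h.congr_fderiv ?_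
    exact e
  have hT : HasFTaylorSeriesUpTo ((⊤ : ℕ∞) : ℕ∞ω) (fun y => ∫ ζ, G (ζ, y) ∂μ)
      (fun y n => ∫ ζ, iteratedFDeriv ℝ n (fun y => G (ζ, y)) y ∂μ) := by
    refine ⟨fun y => ?_, fun m _ y => hder m y, fun m _ => ?_⟩
    · have e := (continuousMultilinearCurryFin0 ℝ Y F).toContinuousLinearEquiv.integral_comp_comm
        (fun ζ => iteratedFDeriv ℝ 0 (fun y => G (ζ, y)) y) (μ := μ)
      refine Eq.trans (Eq.symm e) ?_
      refine integral_congr_ae (Eventually.of_forall fun ζ => ?_)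
      simp [iteratedFDeriv_zero_eq_comp]
    · exact continuous_iff_continuousAt.2 fun y => (hder m y).continuousAt
  exact hT.contDiff

/-- Rapid decay in `ζ` absorbs the polynomial growth of `Φ`, uniformly for `y` in a unit ball. -/
theorem dominated_schwartz_mul {W Y : Type*} [NormedAddCommGroup W]
    [InnerProductSpace ℝ W] [FiniteDimensional ℝ W] [MeasurableSpace W] [BorelSpace W]
    [NormedAddCommGroup Y] [NormedSpace ℝ Y] (f : SchwartzMap W ℂ) {Φ : W × Y → ℂ}
    (hΦ : Φ.HasTemperateGrowth) (n : ℕ) (y₀ : Y) :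
    ∃ bound : W → ℝ, Integrable bound ∧ ∃ s ∈ 𝓝 y₀,
      ∀ᵐ ζ, ∀ y ∈ s, ‖iteratedFDeriv ℝ n (fun y => f ζ * Φ (ζ, y)) y‖ ≤ bound ζ := by
  obtain ⟨k, C, hC⟩ := hΦ.2 n
  refine ⟨fun ζ => |C| * (2 + ‖y₀‖) ^ k * 2 ^ k * (‖ζ‖ ^ 0 * ‖f ζ‖ + ‖ζ‖ ^ k * ‖f ζ‖),
    ((f.integrable_pow_mul volume 0).add (f.integrable_pow_mul volume k)).const_mul _,
    Metric.ball y₀ 1, Metric.ball_mem_nhds _ one_pos, Eventually.of_forall fun ζ y hy => ?_⟩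
  have hsm : ContDiff ℝ ∞ (fun y => Φ (ζ, y)) := hΦ.1.comp (contDiff_const.prodMk contDiff_id)
  have e1 : iteratedFDeriv ℝ n (fun y => f ζ * Φ (ζ, y)) y =
      f ζ • iteratedFDeriv ℝ n (fun y => Φ (ζ, y)) y :=
    iteratedFDeriv_const_smul_apply (f := fun y => Φ (ζ, y)) (a := f ζ)
      (hsm.contDiffAt.of_le (mod_cast le_top))
  rw [e1, norm_smul]
  have e2 : ‖iteratedFDeriv ℝ n (fun y => Φ (ζ, y)) y‖ ≤ |C| * (1 + ‖(ζ, y)‖) ^ k :=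
    (norm_iteratedFDeriv_partial_le hΦ.1 n ζ y).trans ((hC _).trans
      (by gcongr; exact le_abs_self C))
  have hy' : ‖y‖ ≤ ‖y₀‖ + 1 := by
    have : ‖y - y₀‖ < 1 := by simpa [dist_eq_norm] using hy
    have := norm_le_norm_add_norm_sub' y y₀
    linarith
  have e3 : 1 + ‖(ζ, y)‖ ≤ (2 + ‖y₀‖) * (1 + ‖ζ‖) := by
    have h1 : ‖(ζ, y)‖ ≤ ‖ζ‖ + ‖y‖ := by
      rw [Prod.norm_def]; exact max_le_add_of_nonneg (norm_nonneg _) (norm_nonneg _)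
    nlinarith [norm_nonneg ζ, norm_nonneg y₀, mul_nonneg (norm_nonneg y₀) (norm_nonneg ζ)]
  have e4 : (1 + ‖ζ‖) ^ k ≤ 2 ^ k * (1 + ‖ζ‖ ^ k) := by
    rcases le_total ‖ζ‖ 1 with h | h
    · calc (1 + ‖ζ‖) ^ k ≤ 2 ^ k := by gcongr; linarith
        _ ≤ _ := le_mul_of_one_le_right (by positivity) (by linarith [pow_nonneg (norm_nonneg ζ) k])
    · calc (1 + ‖ζ‖) ^ k ≤ (2 * ‖ζ‖) ^ k := by gcongr; linarith
        _ = 2 ^ k * ‖ζ‖ ^ k := mul_pow ..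
        _ ≤ _ := by gcongr; linarith
  calc ‖f ζ‖ * ‖iteratedFDeriv ℝ n (fun y => Φ (ζ, y)) y‖
      ≤ ‖f ζ‖ * (|C| * ((2 + ‖y₀‖) ^ k * (2 ^ k * (1 + ‖ζ‖ ^ k)))) := by
        gcongr
        refine e2.trans ?_
        gcongr
        calc (1 + ‖(ζ, y)‖) ^ k ≤ ((2 + ‖y₀‖) * (1 + ‖ζ‖)) ^ k := by gcongr
          _ = (2 + ‖y₀‖) ^ k * (1 + ‖ζ‖) ^ k := mul_pow ..
          _ ≤ _ := by gcongr
    _ = _ := by ring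

theorem contDiff_integral_schwartz_mul {W Y : Type*} [NormedAddCommGroup W]
    [InnerProductSpace ℝ W] [FiniteDimensional ℝ W] [MeasurableSpace W] [BorelSpace W]
    [NormedAddCommGroup Y] [NormedSpace ℝ Y] (f : SchwartzMap W ℂ) {Φ : W × Y → ℂ}
    (hΦ : Φ.HasTemperateGrowth) : ContDiff ℝ ∞ (fun y => ∫ ζ, f ζ * Φ (ζ, y)) :=
  contDiff_integral_of_dominated (G := fun z : W × Y => f z.1 * Φ z)
    (((f.smooth ⊤).comp contDiff_fst).mul hΦ.1) (dominated_schwartz_mul f hΦ)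

theorem integrable_schwartz_mul {W Y : Type*} [NormedAddCommGroup W]
    [InnerProductSpace ℝ W] [FiniteDimensional ℝ W] [MeasurableSpace W] [BorelSpace W]
    [NormedAddCommGroup Y] [NormedSpace ℝ Y] (f : SchwartzMap W ℂ) {Φ : W × Y → ℂ}
    (hΦ : Φ.HasTemperateGrowth) (y : Y) : Integrable (fun ζ => f ζ * Φ (ζ, y)) := by
  obtain ⟨bound, hb, s, hs, h⟩ := dominated_schwartz_mul f hΦ 0 y
  refine hb.mono' (f.continuous.mul (hΦ.1.continuous.comp
    (continuous_id.prodMk continuous_const))).aestronglyMeasurable ?_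
  filter_upwards [h] with ζ hζ
  simpa using hζ y (mem_of_mem_nhds hs)

end

/-! ### Smooth division by the universal depressed cubic. -/

section

open MeasureTheory

/-- Fourier inversion writes `f(w + t v)` as a superposition of `exp(i t ξ)` with `ξ = 2π⟨ζ, v⟩`.
Dividing each exponential with `s = t ξ` and `P = ξ² p` turns `s³ + P s` into `ξ³ (t³ + p t)`, so
the remainders depend on `t` only through `t³ + p t`. -/
theorem exists_division_schwartz {W : Type*} [NormedAddCommGroup W] [InnerProductSpace ℝ W]
    [FiniteDimensional ℝ W] [MeasurableSpace W] [BorelSpace W] (f : SchwartzMap W ℂ) (v : W) :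
    ∃ r : Fin 3 → W × ℝ × ℝ → ℂ, (∀ j, ContDiff ℝ ∞ (r j)) ∧ ∀ (w : W) (t p : ℝ),
      f (w + t • v) = ∑ j : Fin 3, (t : ℂ) ^ (j : ℕ) * r j (w, p, t ^ 3 + p * t) := by
  obtain ⟨H, hH, hH'⟩ := exists_temperate_cubic_division_exp
  set ξ : W → ℝ := fun ζ => 2 * Real.pi * inner ℝ ζ v with hξ
  set Φ : Fin 3 → W × (W × ℝ × ℝ) → ℂ := fun j z =>
    Complex.exp ((2 * Real.pi * inner ℝ z.1 z.2.1 : ℝ) * Complex.I) * ((ξ z.1 : ℂ) ^ (j : ℕ) *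
      H j (ξ z.1 ^ 2 * z.2.2.1, ξ z.1 ^ 3 * z.2.2.2)) with hΦ
  have t2 : (fun z : W × (W × ℝ × ℝ) => z.2).HasTemperateGrowth := hasTemperateGrowth_snd
  have t22 : (fun z : W × (W × ℝ × ℝ) => z.2.2).HasTemperateGrowth := hasTemperateGrowth_snd.comp t2
  have tξ : (fun z : W × (W × ℝ × ℝ) => ξ z.1).HasTemperateGrowth :=
    (Function.HasTemperateGrowth.const _).fun_mul
      ((Function.hasTemperateGrowth_inner_left v).comp hasTemperateGrowth_fst)
  have tw : (fun z : W × (W × ℝ × ℝ) => inner ℝ z.1 z.2.1).HasTemperateGrowth :=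
    (innerSL ℝ (E := W)).bilinear_hasTemperateGrowth hasTemperateGrowth_fst
      (hasTemperateGrowth_fst.comp t2)
  have tpair : (fun z : W × (W × ℝ × ℝ) =>
      (ξ z.1 ^ 2 * z.2.2.1, ξ z.1 ^ 3 * z.2.2.2)).HasTemperateGrowth := by
    have h1 : (fun z : W × (W × ℝ × ℝ) => ξ z.1 ^ 2 * z.2.2.1).HasTemperateGrowth :=
      (tξ.fun_pow 2).fun_mul (hasTemperateGrowth_fst.comp t22)
    have h2 : (fun z : W × (W × ℝ × ℝ) => ξ z.1 ^ 3 * z.2.2.2).HasTemperateGrowth :=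
      (tξ.fun_pow 3).fun_mul (hasTemperateGrowth_snd.comp t22)
    have := ((ContinuousLinearMap.inl ℝ ℝ ℝ).hasTemperateGrowth.comp h1).fun_add
      ((ContinuousLinearMap.inr ℝ ℝ ℝ).hasTemperateGrowth.comp h2)
    simpa using this
  have hΦt : ∀ j, (Φ j).HasTemperateGrowth := fun j =>
    (hasTemperateGrowth_exp_mul_I.comp ((Function.HasTemperateGrowth.const _).fun_mul tw)).fun_mul
      (((Complex.ofRealCLM.hasTemperateGrowth.comp tξ).fun_pow (j : ℕ)).fun_mul ((hH j).comp tpair))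
  set g : SchwartzMap W ℂ := FourierTransform.fourier f
  refine ⟨fun j y => ∫ ζ, g ζ * Φ j (ζ, y), fun j => contDiff_integral_schwartz_mul g (hΦt j),
    fun w t p => ?_⟩
  have hinv : f (w + t • v) = FourierTransformInv.fourierInv (g : W → ℂ) (w + t • v) := by
    rw [← SchwartzMap.fourierInv_coe, FourierTransform.fourierInv_fourier_eq]
  rw [hinv, Real.fourierInv_eq']
  simp_rw [← integral_const_mul]
  rw [← integral_finsetSum _ fun j _ => (integrable_schwartz_mul g (hΦt j) _).const_mul _]
  refine integral_congr_ae (Eventually.of_forall fun ζ => ?_)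
  have hs := hH' (t * ξ ζ) (ξ ζ ^ 2 * p)
  have e3 : (t * ξ ζ) ^ 3 + ξ ζ ^ 2 * p * (t * ξ ζ) = ξ ζ ^ 3 * (t ^ 3 + p * t) := by ring
  rw [e3] at hs
  have he : Complex.exp ((2 * Real.pi * inner ℝ ζ (w + t • v) : ℝ) * Complex.I) =
      Complex.exp ((2 * Real.pi * inner ℝ ζ w : ℝ) * Complex.I) *
        Complex.exp ((t * ξ ζ : ℝ) * Complex.I) := by
    rw [← Complex.exp_add, inner_add_right, inner_smul_right, hξ]
    congr 1
    push_cast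
    ring
  simp only [hΦ, smul_eq_mul]
  rw [he, hs, Finset.mul_sum, Finset.sum_mul]
  refine Finset.sum_congr rfl fun j _ => ?_
  push_cast
  ring

/-- Smooth division by the universal depressed cubic, in the direction `v`. -/
theorem exists_smooth_division {E : Type*} [NormedAddCommGroup E] [NormedSpace ℝ E]
    [FiniteDimensional ℝ E] {f : E → ℝ} (hf : ContDiff ℝ ∞ f) (hs : HasCompactSupport f) (v : E) :
    ∃ r : Fin 3 → E × ℝ × ℝ → ℝ, (∀ j, ContDiff ℝ ∞ (r j)) ∧ ∀ (x : E) (t p : ℝ),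
      f (x + t • v) = ∑ j : Fin 3, t ^ (j : ℕ) * r j (x, p, t ^ 3 + p * t) := by
  set L := toEuclidean (E := E)
  have hf' : ContDiff ℝ ∞ (fun w => (f (L.symm w) : ℂ)) :=
    Complex.ofRealCLM.contDiff.comp (hf.comp L.symm.contDiff)
  have hs' : HasCompactSupport (fun w => (f (L.symm w) : ℂ)) :=
    (hs.comp_homeomorph L.symm.toHomeomorph).comp_left (g := Complex.ofReal) Complex.ofReal_zero
  obtain ⟨r, hr, hr'⟩ := exists_division_schwartz (hs'.toSchwartzMap hf') (L v)
  refine ⟨fun j z => (r j (L z.1, z.2)).re, fun j => ?_, fun x t p => ?_⟩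
  · exact Complex.reCLM.contDiff.comp ((hr j).comp ((L.contDiff.comp contDiff_fst).prodMk contDiff_snd))
  · have h := congrArg Complex.re (hr' (L x) t p)
    have e : (hs'.toSchwartzMap hf') (L x + t • L v) = (f (x + t • v) : ℂ) := by
      show (f (L.symm (L x + t • L v)) : ℂ) = _
      rw [← map_smul, ← map_add, L.symm_apply_apply]
    rw [e, Complex.ofReal_re, Complex.re_sum] at h
    rw [h]
    refine Finset.sum_congr rfl fun j _ => ?_
    rw [← Complex.ofReal_pow, Complex.re_ofReal_mul]

end

/-! ### Hadamard quotients, implicit functions and localization. -/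

section

open MeasureTheory

/-- Hadamard's lemma with smooth dependence on all variables. -/
theorem exists_hadamard_quotient {E : Type*} [NormedAddCommGroup E] [NormedSpace ℝ E]
    {g : E × ℝ → ℝ} (hg : ContDiff ℝ ∞ g) :
    ∃ K : E × ℝ × ℝ → ℝ, ContDiff ℝ ∞ K ∧
      (∀ x q q', g (x, q') - g (x, q) = (q' - q) * K (x, q, q')) ∧
      ∀ x q, K (x, q, q) = fderiv ℝ g (x, q) (0, 1) := by
  set G : ℝ × (E × ℝ × ℝ) → ℝ := fun z =>
    fderiv ℝ g (z.2.1, z.2.2.1 + z.1 * (z.2.2.2 - z.2.2.1)) (0, 1) with hGdef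
  have hG : ContDiff ℝ ∞ G := by
    have h1 : ContDiff ℝ ∞ (fderiv ℝ g) := hg.fderiv_right (by simp)
    have h2 : ContDiff ℝ ∞ (fun z : ℝ × (E × ℝ × ℝ) =>
        (z.2.1, z.2.2.1 + z.1 * (z.2.2.2 - z.2.2.1))) := by fun_prop
    exact (h1.comp h2).clm_apply contDiff_const
  set μ : Measure ℝ := volume.restrict (Ioc 0 1) with hμ
  refine ⟨fun y => ∫ s, G (s, y) ∂μ, contDiff_integral_of_dominated hG fun n y₀ => ?_,
    fun x q q' => ?_, fun x q => ?_⟩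
  · have hc : Continuous fun z => ‖iteratedFDeriv ℝ n G z‖ :=
      (hG.continuous_iteratedFDeriv (mod_cast le_top)).norm
    obtain ⟨C, hC⟩ := (isCompact_Icc (a := (0 : ℝ)) (b := 1)).exists_bound_of_continuousOn
      (f := fun s => ‖iteratedFDeriv ℝ n G (s, y₀)‖)
      (hc.comp (continuous_id.prodMk continuous_const)).continuousOn
    -- Compactness of `[0, 1]` makes the bound at `y₀` persist on one neighbourhood for all `s`.
    have hev : ∀ᶠ y in 𝓝 y₀, ∀ s ∈ Icc (0 : ℝ) 1, ‖iteratedFDeriv ℝ n G (s, y)‖ < C + 1 := by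
      refine (isCompact_Icc (a := (0 : ℝ)) (b := 1)).eventually_forall_of_forall_eventually
        fun s hs => ?_
      have hlt : ‖iteratedFDeriv ℝ n G (s, y₀)‖ < C + 1 := by
        have := hC s hs
        rw [norm_norm] at this
        linarith
      have hcs : Continuous fun z : (E × ℝ × ℝ) × ℝ => ‖iteratedFDeriv ℝ n G (z.2, z.1)‖ :=
        hc.comp continuous_swap
      have h2 : ∀ᶠ z : (E × ℝ × ℝ) × ℝ in 𝓝 (y₀, s), ‖iteratedFDeriv ℝ n G (z.2, z.1)‖ < C + 1 :=
        (hcs.tendsto (y₀, s)).eventually_lt_const hlt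
      exact h2
    refine ⟨fun _ => C + 1, ?_, _, hev, ?_⟩
    · rw [integrable_const_iff]
      right
      rw [hμ]
      infer_instance
    · rw [hμ]
      filter_upwards [ae_restrict_mem measurableSet_Ioc] with s hs y hy
      exact (norm_iteratedFDeriv_partial_le hG n s y).trans (hy s ⟨hs.1.le, hs.2⟩).le
  · have hd : ∀ s ∈ uIcc (0 : ℝ) 1, HasDerivAt (fun s : ℝ => g (x, q + s * (q' - q)))
        ((q' - q) * G (s, x, q, q')) s := by
      intro s _
      have h1 : HasDerivAt (fun s : ℝ => (x, q + s * (q' - q))) (0, 1 * (q' - q)) s :=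
        (hasDerivAt_const s x).prodMk (((hasDerivAt_id s).mul_const (q' - q)).const_add q)
      have h2 := ((hg.differentiable (by simp)) (x, q + s * (q' - q))).hasFDerivAt.comp_hasDerivAt s h1
      refine h2.congr_deriv ?_
      have : ((0 : E), 1 * (q' - q)) = (q' - q) • ((0 : E), (1 : ℝ)) := by simp
      rw [this, map_smul, smul_eq_mul]
    have hint : IntervalIntegrable (fun s => (q' - q) * G (s, x, q, q')) volume 0 1 :=
      (continuous_const.mul (hG.continuous.comp
        (continuous_id.prodMk continuous_const))).intervalIntegrable _ _
    have := intervalIntegral.integral_eq_sub_of_hasDerivAt hd hint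
    rw [intervalIntegral.integral_const_mul, intervalIntegral.integral_of_le zero_le_one] at this
    rw [this]
    simp
  · simp [hGdef, hμ]

/-- The implicit function theorem, with smoothness in a neighbourhood. -/
theorem exists_smooth_implicit {E F F' : Type*} [NormedAddCommGroup E] [NormedSpace ℝ E]
    [CompleteSpace E] [NormedAddCommGroup F] [NormedSpace ℝ F] [CompleteSpace F]
    [NormedAddCommGroup F'] [NormedSpace ℝ F'] [CompleteSpace F'] {f : E × F → F'} {u : E × F}
    (hf : ∀ᶠ v in 𝓝 u, ContDiffAt ℝ ∞ f v)
    (hinv : (fderiv ℝ f u ∘L .inr ℝ E F).IsInvertible) :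
    ∃ φ : E → F, φ u.1 = u.2 ∧ (∀ᶠ x in 𝓝 u.1, ContDiffAt ℝ ∞ φ x) ∧
      ∀ᶠ x in 𝓝 u.1, f (x, φ x) = f u := by
  have hfu : ContDiffAt ℝ ∞ f u := hf.self_of_nhds
  have h0 : (∞ : ℕ∞ω) ≠ 0 := by simp
  set φ := hfu.implicitFunction h0 hinv with hφ
  have hφu : φ u.1 = u.2 := hfu.implicitFunction_apply_self h0 hinv
  have hφs : ContDiffAt ℝ ∞ φ u.1 := hfu.contDiffAt_implicitFunction h0 hinv
  have heq : ∀ᶠ x in 𝓝 u.1, f (x, φ x) = f u := hfu.eventually_apply_implicitFunction h0 hinv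
  refine ⟨φ, hφu, ?_, heq⟩
  have hcont : ∀ᶠ x in 𝓝 u.1, ContinuousAt φ x :=
    ((hφs.of_le (m := 1) (mod_cast le_top)).eventually (by simp)).mono fun x hx => hx.continuousAt
  have hgr : Tendsto (fun x => (x, φ x)) (𝓝 u.1) (𝓝 u) := by
    have : Tendsto (fun x => (x, φ x)) (𝓝 u.1) (𝓝 (u.1, φ u.1)) :=
      (continuousAt_id.prodMk hφs.continuousAt)
    rwa [hφu] at this
  have hinv' : ∀ᶠ v in 𝓝 u, (fderiv ℝ f v ∘L .inr ℝ E F).IsInvertible := by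
    have hc : ContinuousAt (fun v => fderiv ℝ f v ∘L .inr ℝ E F) u :=
      ((hfu.fderiv_right (m := 0) (by simp)).continuousAt).clm_comp continuousAt_const
    exact hc.eventually (ContinuousLinearEquiv.isOpen.mem_nhds hinv)
  filter_upwards [hcont, hgr.eventually hf, hgr.eventually hinv', eventually_eventually_nhds.2 heq]
    with x hx1 hx2 hx3 hx4
  -- The implicit function built at the nearby point `(x, φ x)` coincides with `φ` by local
  -- uniqueness, so smoothness at a point spreads to a neighbourhood.
  have hiff := hx2.eventually_apply_eq_iff_implicitFunction h0 hx3
  have hgr' : Tendsto (fun x' => (x', φ x')) (𝓝 x) (𝓝 (x, φ x)) := continuousAt_id.prodMk hx1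
  have hee : φ =ᶠ[𝓝 x] hx2.implicitFunction h0 hx3 := by
    filter_upwards [hgr'.eventually hiff, hx4] with x' h1 h2
    exact (h1.1 (h2.trans hx4.self_of_nhds.symm)).symm
  exact (hx2.contDiffAt_implicitFunction h0 hx3).congr_of_eventuallyEq hee

theorem exists_smooth_compactSupport_eq_near {E : Type*} [NormedAddCommGroup E] [NormedSpace ℝ E]
    [FiniteDimensional ℝ E] {f : E → ℝ} {z : E} (hf : ∀ᶠ y in 𝓝 z, ContDiffAt ℝ ∞ f y) :
    ∃ g : E → ℝ, ContDiff ℝ ∞ g ∧ HasCompactSupport g ∧ g =ᶠ[𝓝 z] f := by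
  obtain ⟨R, hR, hball⟩ := Metric.eventually_nhds_iff_ball.1 hf
  let φ : ContDiffBump z := ⟨R / 4, R / 2, by positivity, by linarith⟩
  refine ⟨fun x => φ x * f x, ?_, φ.hasCompactSupport.mul_right, ?_⟩
  · rw [contDiff_iff_contDiffAt]
    intro x
    by_cases hx : x ∈ Metric.ball z R
    · exact φ.contDiff.contDiffAt.mul (hball x hx)
    · have : (fun x => φ x * f x) =ᶠ[𝓝 x] fun _ => 0 := by
        have hx' : x ∈ (Metric.closedBall z (R / 2))ᶜ := by
          simp only [mem_compl_iff, Metric.mem_closedBall, Metric.mem_ball] at hx ⊢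
          linarith
        filter_upwards [Metric.isClosed_closedBall.isOpen_compl.mem_nhds hx'] with y hy
        have : φ y = 0 := φ.zero_of_le_dist (by
          simp only [mem_compl_iff, Metric.mem_closedBall] at hy
          exact (not_le.1 hy).le)
        simp [this]
      exact contDiffAt_const.congr_of_eventuallyEq this
  · filter_upwards [φ.eventuallyEq_one] with y hy
    simp [hy]

end

/-! ### Malgrange preparation at a zero of order three. -/

/-- The three summands have different orders modulo `3`, so they can be read off by dividing
successively by `1`, `t` and `t²`. This identifies first derivatives of the division remainders
without expanding them further. -/
theorem cube_coefficients_of_tendsto {A₀ A₁ A₂ S : ℝ → ℝ} (h₀ : DifferentiableAt ℝ A₀ 0)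
    (h₁ : DifferentiableAt ℝ A₁ 0) (h₂ : DifferentiableAt ℝ A₂ 0)
    (hS : ∀ t, S t = A₀ (t ^ 3) + t * A₁ (t ^ 3) + t ^ 2 * A₂ (t ^ 3)) {m : ℝ}
    (hm : Tendsto (fun t => S t / t ^ 2) (𝓝[≠] 0) (𝓝 m)) : A₀ 0 = 0 ∧ A₁ 0 = 0 ∧ A₂ 0 = m := by
  have hid : Tendsto (fun t : ℝ => t) (𝓝[≠] 0) (𝓝 0) := tendsto_nhdsWithin_of_tendsto_nhds tendsto_id
  have hcube : Tendsto (fun t : ℝ => t ^ 3) (𝓝[≠] 0) (𝓝[≠] 0) := by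
    refine tendsto_nhdsWithin_iff.2 ⟨by simpa using hid.pow 3, ?_⟩
    filter_upwards [self_mem_nhdsWithin] with t ht
    exact pow_ne_zero 3 ht
  have lim : ∀ {h : ℝ → ℝ}, DifferentiableAt ℝ h 0 →
      Tendsto (fun t => h (t ^ 3)) (𝓝[≠] 0) (𝓝 (h 0)) := fun hh =>
    hh.continuousAt.tendsto.comp (hcube.mono_right nhdsWithin_le_nhds)
  have lim2 : ∀ {h : ℝ → ℝ}, DifferentiableAt ℝ h 0 → h 0 = 0 →
      Tendsto (fun t => h (t ^ 3) / t ^ 2) (𝓝[≠] 0) (𝓝 0) := by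
    intro h hh h0
    -- If `h 0 = 0`, then `h(t³) / t²` is the difference quotient of `h` at `t³` times `t`.
    have hs := (hasDerivAt_iff_tendsto_slope.1 hh.hasDerivAt).comp hcube
    have := hs.mul hid
    rw [mul_zero] at this
    refine this.congr' ?_
    filter_upwards [self_mem_nhdsWithin] with t ht
    have ht' : t ≠ 0 := ht
    simp only [Function.comp, slope_def_field, h0]
    field_simp
    simp [mul_comm]
  have e₀ : A₀ 0 = 0 := by
    have l1 : Tendsto S (𝓝[≠] 0) (𝓝 (A₀ 0 + 0 * A₁ 0 + 0 ^ 2 * A₂ 0)) := by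
      rw [funext hS]
      exact ((lim h₀).add (hid.mul (lim h₁))).add ((hid.pow 2).mul (lim h₂))
    have l2 : Tendsto S (𝓝[≠] 0) (𝓝 (m * 0 ^ 2)) := by
      refine (hm.mul (hid.pow 2)).congr' ?_
      filter_upwards [self_mem_nhdsWithin] with t ht
      have ht' : t ≠ 0 := ht
      field_simp
    have := tendsto_nhds_unique l1 l2
    simpa using this
  have e₁ : A₁ 0 = 0 := by
    have l1 : Tendsto (fun t => S t / t) (𝓝[≠] 0) (𝓝 (0 * 0 + A₁ 0 + 0 * A₂ 0)) := by
      refine ((((lim2 h₀ e₀).mul hid).add (lim h₁)).add (hid.mul (lim h₂))).congr' ?_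
      filter_upwards [self_mem_nhdsWithin] with t ht
      have ht' : t ≠ 0 := ht
      rw [hS]; field_simp
    have l2 : Tendsto (fun t => S t / t) (𝓝[≠] 0) (𝓝 (m * 0)) := by
      refine (hm.mul hid).congr' ?_
      filter_upwards [self_mem_nhdsWithin] with t ht
      have ht' : t ≠ 0 := ht
      field_simp
    have := tendsto_nhds_unique l1 l2
    simpa using this
  refine ⟨e₀, e₁, ?_⟩
  have l1 : Tendsto (fun t => S t / t ^ 2) (𝓝[≠] 0) (𝓝 (0 + 0 * 0 + A₂ 0)) := by
    refine (((lim2 h₀ e₀).add (hid.mul (lim2 h₁ e₁))).add (lim h₂)).congr' ?_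
    filter_upwards [self_mem_nhdsWithin] with t ht
    have ht' : t ≠ 0 := ht
    rw [hS]; field_simp
  have := tendsto_nhds_unique l1 hm
  simpa using this

/-- First order information on the remainders at a zero of exact order three. -/
theorem division_remainder_jets {Y : Type*} [NormedAddCommGroup Y] [NormedSpace ℝ Y]
    {g : ℝ × Y → ℝ} (hg : ContDiff ℝ ∞ g) {y₀ : Y} {c : ℝ} (h0 : g (0, y₀) = 0)
    (h1 : Tendsto (fun t => deriv (fun t => g (t, y₀)) t / t ^ 2) (𝓝[≠] 0) (𝓝 (3 * c)))
    {r : Fin 3 → (ℝ × Y) × ℝ × ℝ → ℝ} (hr : ∀ j, ContDiff ℝ ∞ (r j))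
    (hdiv : ∀ (x : ℝ × Y) (t p : ℝ), g (x + t • ((1 : ℝ), (0 : Y))) =
      ∑ j : Fin 3, t ^ (j : ℕ) * r j (x, p, t ^ 3 + p * t)) :
    (∀ j, r j ((0, y₀), 0, 0) = 0) ∧
    fderiv ℝ (r 0) ((0, y₀), 0, 0) (0, 0, 1) = c ∧
    fderiv ℝ (r 0) ((0, y₀), 0, 0) (0, 1, 0) = 0 ∧
    fderiv ℝ (r 1) ((0, y₀), 0, 0) (0, 1, 0) = -c ∧
    fderiv ℝ (r 0) ((0, y₀), 0, 0) ((-1, 0), 0, 0) = 0 ∧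
    fderiv ℝ (r 1) ((0, y₀), 0, 0) ((-1, 0), 0, 0) = 0 ∧
    fderiv ℝ (r 2) ((0, y₀), 0, 0) ((-1, 0), 0, 0) = -(3 * c) := by
  set G : ℝ → ℝ := fun t => g (t, y₀) with hG
  have hGd : ∀ t, HasDerivAt G (deriv G t) t := fun t =>
    (((hg.comp (contDiff_id.prodMk contDiff_const)).differentiable (by simp)) t).hasDerivAt
  have hrd : ∀ j z, HasFDerivAt (r j) (fderiv ℝ (r j) z) z := fun j z =>
    ((hr j).differentiable (by simp) z).hasFDerivAt
  set D : Fin 3 → (ℝ × Y) × ℝ × ℝ → ℝ → ℝ := fun j v q => fderiv ℝ (r j) ((0, y₀), 0, q) v with hD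
  have hDd : ∀ j v, DifferentiableAt ℝ (D j v) 0 := by
    intro j v
    have e1 : ContDiff ℝ ∞ (fderiv ℝ (r j)) := (hr j).fderiv_right (by simp)
    have e2 : ContDiff ℝ ∞ (fun q : ℝ => (((0 : ℝ), y₀), (0 : ℝ), q)) := by fun_prop
    exact ((e1.comp e2).clm_apply contDiff_const).differentiable (by simp) 0
  have hrq : ∀ j, DifferentiableAt ℝ (fun q => r j ((0, y₀), 0, q)) 0 := by
    intro j
    have e2 : ContDiff ℝ ∞ (fun q : ℝ => (((0 : ℝ), y₀), (0 : ℝ), q)) := by fun_prop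
    exact ((hr j).comp e2).differentiable (by simp) 0
  have hdiff_id : DifferentiableAt ℝ (fun q : ℝ => q) 0 := differentiableAt_id
  -- differentiation in `t`
  have ht : ∀ t, deriv G t = (r 1 ((0, y₀), 0, t ^ 3) + 3 * t ^ 3 * D 1 (0, 0, 1) (t ^ 3)) +
      t * (2 * r 2 ((0, y₀), 0, t ^ 3) + 3 * t ^ 3 * D 2 (0, 0, 1) (t ^ 3)) +
      t ^ 2 * (3 * D 0 (0, 0, 1) (t ^ 3)) := by
    intro t
    have hGe : G = fun t => r 0 ((0, y₀), 0, t ^ 3) + t * r 1 ((0, y₀), 0, t ^ 3) +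
        t ^ 2 * r 2 ((0, y₀), 0, t ^ 3) := by
      ext t
      have := hdiv (0, y₀) t 0
      simpa [Fin.sum_univ_three, hG] using this
    have hc : ∀ j, HasDerivAt (fun t : ℝ => r j ((0, y₀), 0, t ^ 3))
        (3 * t ^ 2 * D j (0, 0, 1) (t ^ 3)) t := by
      intro j
      have e1 : HasDerivAt (fun t : ℝ => (((0 : ℝ), y₀), (0 : ℝ), t ^ 3)) (0, 0, 3 * t ^ 2) t := by
        simpa using (hasDerivAt_const t ((0 : ℝ), y₀)).prodMk
          ((hasDerivAt_const t (0 : ℝ)).prodMk (hasDerivAt_pow 3 t))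
      refine ((hrd j _).comp_hasDerivAt t e1).congr_deriv ?_
      have : ((0 : ℝ × Y), (0 : ℝ), 3 * t ^ 2) = (3 * t ^ 2) • ((0 : ℝ × Y), (0 : ℝ), (1 : ℝ)) := by
        simp
      rw [this, map_smul, smul_eq_mul]
    rw [hGe]
    have := ((hc 0).add ((hasDerivAt_id t).mul (hc 1))).add ((hasDerivAt_pow 2 t).mul (hc 2))
    refine (this.congr_deriv ?_).deriv
    simp only [id]
    ring
  obtain ⟨a1, a2, a3⟩ := cube_coefficients_of_tendsto
    (A₀ := fun q => r 1 ((0, y₀), 0, q) + 3 * q * D 1 (0, 0, 1) q)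
    (A₁ := fun q => 2 * r 2 ((0, y₀), 0, q) + 3 * q * D 2 (0, 0, 1) q)
    (A₂ := fun q => 3 * D 0 (0, 0, 1) q)
    ((hrq 1).add ((hdiff_id.const_mul 3).mul (hDd 1 _)))
    (((hrq 2).const_mul 2).add ((hdiff_id.const_mul 3).mul (hDd 2 _))) ((hDd 0 _).const_mul 3) ht h1
  have r1 : r 1 ((0, y₀), 0, 0) = 0 := by simpa using a1
  have r2 : r 2 ((0, y₀), 0, 0) = 0 := by simpa using a2
  have r0 : r 0 ((0, y₀), 0, 0) = 0 := by
    have := hdiv (0, y₀) 0 0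
    simpa [Fin.sum_univ_three, h0] using this.symm
  have b0 : D 0 (0, 0, 1) 0 = c := by simpa using a3
  -- differentiation in `p`
  have hp : ∀ t : ℝ, (0 : ℝ) = (D 0 (0, 1, 0) (t ^ 3) + t ^ 3 * D 2 (0, 0, 1) (t ^ 3)) +
      t * (D 1 (0, 1, 0) (t ^ 3) + D 0 (0, 0, 1) (t ^ 3)) +
      t ^ 2 * (D 2 (0, 1, 0) (t ^ 3) + D 1 (0, 0, 1) (t ^ 3)) := by
    intro t
    have hc : ∀ j, HasDerivAt (fun p : ℝ => r j ((0, y₀), p, t ^ 3 + p * t))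
        (D j (0, 1, 0) (t ^ 3) + t * D j (0, 0, 1) (t ^ 3)) 0 := by
      intro j
      have e1 : HasDerivAt (fun p : ℝ => (((0 : ℝ), y₀), p, t ^ 3 + p * t)) (0, 1, t) 0 := by
        simpa using (hasDerivAt_const (0 : ℝ) ((0 : ℝ), y₀)).prodMk
          ((hasDerivAt_id (0 : ℝ)).prodMk (((hasDerivAt_id (0 : ℝ)).mul_const t).const_add (t ^ 3)))
      refine ((hrd j _).comp_hasDerivAt (0 : ℝ) e1).congr_deriv ?_
      have : ((0 : ℝ × Y), (1 : ℝ), t) = (0, 1, 0) + t • ((0 : ℝ × Y), (0 : ℝ), (1 : ℝ)) := by simp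
      rw [this, map_add, map_smul, smul_eq_mul]
      simp [hD]
    have hconst : (fun p : ℝ => r 0 ((0, y₀), p, t ^ 3 + p * t) + t * r 1 ((0, y₀), p, t ^ 3 + p * t) +
        t ^ 2 * r 2 ((0, y₀), p, t ^ 3 + p * t)) = fun _ => G t := by
      ext p
      have := hdiv (0, y₀) t p
      simpa [Fin.sum_univ_three, hG] using this.symm
    have h2 := ((hc 0).add ((hc 1).const_mul t)).add ((hc 2).const_mul (t ^ 2))
    have h3 : HasDerivAt (fun p : ℝ => r 0 ((0, y₀), p, t ^ 3 + p * t) +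
        t * r 1 ((0, y₀), p, t ^ 3 + p * t) + t ^ 2 * r 2 ((0, y₀), p, t ^ 3 + p * t)) 0 0 := by
      rw [hconst]; exact hasDerivAt_const _ _
    have := h3.unique h2
    linear_combination this
  -- The divided function does not depend on `p`, so the sum of cubes is identically zero. Its
  -- `t`-coefficient links `∂ₚ r₁` to `∂_q r₀ = c`.
  obtain ⟨p1, p2, -⟩ := cube_coefficients_of_tendsto (S := fun _ => 0) (m := 0)
    (A₀ := fun q => D 0 (0, 1, 0) q + q * D 2 (0, 0, 1) q)
    (A₁ := fun q => D 1 (0, 1, 0) q + D 0 (0, 0, 1) q)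
    (A₂ := fun q => D 2 (0, 1, 0) q + D 1 (0, 0, 1) q)
    ((hDd 0 _).add (hdiff_id.mul (hDd 2 _))) ((hDd 1 _).add (hDd 0 _)) ((hDd 2 _).add (hDd 1 _)) hp
    (by simp)
  -- differentiation in the direction of translations
  have hl : ∀ t, -deriv G t = D 0 ((-1, 0), 0, 0) (t ^ 3) + t * D 1 ((-1, 0), 0, 0) (t ^ 3) +
      t ^ 2 * D 2 ((-1, 0), 0, 0) (t ^ 3) := by
    intro t
    have hc : ∀ j, HasDerivAt (fun l : ℝ => r j ((-l, y₀), 0, t ^ 3))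
        (D j ((-1, 0), 0, 0) (t ^ 3)) 0 := by
      intro j
      have e1 : HasDerivAt (fun l : ℝ => ((-l, y₀), (0 : ℝ), t ^ 3)) ((-1, 0), 0, 0) 0 :=
        ((hasDerivAt_id (0 : ℝ)).neg.prodMk (hasDerivAt_const (0 : ℝ) y₀)).prodMk
          (hasDerivAt_const (0 : ℝ) ((0 : ℝ), t ^ 3))
      refine ((hrd j _).comp_hasDerivAt (0 : ℝ) e1).congr_deriv ?_
      simp [hD]
    have hconst : (fun l : ℝ => r 0 ((-l, y₀), 0, t ^ 3) + t * r 1 ((-l, y₀), 0, t ^ 3) +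
        t ^ 2 * r 2 ((-l, y₀), 0, t ^ 3)) = fun l => G (t - l) := by
      -- Moving the base point by `-l` replaces `G(t)` by `G(t - l)`.
      ext l
      have := hdiv (-l, y₀) t 0
      simp [Fin.sum_univ_three] at this
      rw [← this, hG]
      ring_nf
    have h2 := ((hc 0).add ((hc 1).const_mul t)).add ((hc 2).const_mul (t ^ 2))
    have h3 : HasDerivAt (fun l : ℝ => r 0 ((-l, y₀), 0, t ^ 3) + t * r 1 ((-l, y₀), 0, t ^ 3) +
        t ^ 2 * r 2 ((-l, y₀), 0, t ^ 3)) (-deriv G t) 0 := by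
      rw [hconst]
      have e1 : HasDerivAt (fun l : ℝ => t - l) (-1) 0 := (hasDerivAt_id (0 : ℝ)).const_sub t
      have e2 : HasDerivAt G (deriv G t) (t - 0) := by rw [sub_zero]; exact hGd t
      refine (e2.comp (0 : ℝ) e1).congr_deriv (by ring)
    exact h3.unique h2
  obtain ⟨l0, l1, l2⟩ := cube_coefficients_of_tendsto (hDd 0 _) (hDd 1 _) (hDd 2 _) hl
    (m := -(3 * c)) (by simpa [neg_div] using h1.neg)
  refine ⟨?_, b0, by simpa using p1, ?_, l0, l1, l2⟩
  · intro j
    fin_cases j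
    exacts [r0, r1, r2]
  · rw [b0] at p2
    exact eq_neg_of_add_eq_zero_left p2

/-- The Malgrange preparation theorem at a zero of exact order three. -/
theorem exists_cubic_preparation {Y : Type*} [NormedAddCommGroup Y] [NormedSpace ℝ Y]
    [FiniteDimensional ℝ Y] {F : ℝ × Y → ℝ} {y₀ : Y} {c : ℝ}
    (hF : ∀ᶠ z in 𝓝 ((0 : ℝ), y₀), ContDiffAt ℝ ∞ F z) (hc : 0 < c) (h0 : F (0, y₀) = 0)
    (h1 : Tendsto (fun t => deriv (fun t => F (t, y₀)) t / t ^ 2) (𝓝[≠] 0) (𝓝 (3 * c))) :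
    ∃ (e : ℝ × Y → ℝ) (a₁ a₂ a₃ : Y → ℝ), (∀ᶠ z in 𝓝 ((0 : ℝ), y₀), ContDiffAt ℝ ∞ e z) ∧
      (∀ᶠ y in 𝓝 y₀, ContDiffAt ℝ ∞ a₁ y) ∧ (∀ᶠ y in 𝓝 y₀, ContDiffAt ℝ ∞ a₂ y) ∧
      (∀ᶠ y in 𝓝 y₀, ContDiffAt ℝ ∞ a₃ y) ∧ a₁ y₀ = 0 ∧ a₂ y₀ = 0 ∧ a₃ y₀ = 0 ∧
      ∀ᶠ z in 𝓝 ((0 : ℝ), y₀), 0 < e z ∧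
        F z = e z * (z.1 ^ 3 + a₁ z.2 * z.1 ^ 2 + a₂ z.2 * z.1 + a₃ z.2) := by
  obtain ⟨g, hg, hgs, hgF⟩ := exists_smooth_compactSupport_eq_near hF
  have hline : Tendsto (fun t : ℝ => (t, y₀)) (𝓝 0) (𝓝 (0, y₀)) :=
    (continuous_id.prodMk continuous_const).tendsto 0
  have h0' : g (0, y₀) = 0 := by rw [hgF.self_of_nhds, h0]
  have h1' : Tendsto (fun t => deriv (fun t => g (t, y₀)) t / t ^ 2) (𝓝[≠] 0) (𝓝 (3 * c)) := by
    refine h1.congr' ?_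
    have e1 : (fun t => F (t, y₀)) =ᶠ[𝓝 0] fun t => g (t, y₀) := (hline.eventually hgF).mono
      fun t ht => ht.symm
    filter_upwards [nhdsWithin_le_nhds e1.eventuallyEq_nhds] with t ht
    rw [ht.deriv_eq]
  obtain ⟨r, hr, hdiv⟩ := exists_smooth_division hg hgs ((1 : ℝ), (0 : Y))
  obtain ⟨hr0, hq0, hp0, hp1, hl0, hl1, hl2⟩ := division_remainder_jets hg h0' h1' hr hdiv
  have hK : ∀ j, ∃ K : ((ℝ × Y) × ℝ) × ℝ × ℝ → ℝ, ContDiff ℝ ∞ K ∧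
      (∀ x p q q', r j (x, p, q') - r j (x, p, q) = (q' - q) * K ((x, p), q, q')) ∧
      ∀ x p q, K ((x, p), q, q) = fderiv ℝ (r j) (x, p, q) (0, 0, 1) := by
    intro j
    let A : (((ℝ × Y) × ℝ) × ℝ) ≃L[ℝ] (ℝ × Y) × ℝ × ℝ := ContinuousLinearEquiv.prodAssoc ℝ (ℝ × Y) ℝ ℝ
    obtain ⟨K, h1, h2, h3⟩ := exists_hadamard_quotient ((hr j).comp A.contDiff)
    refine ⟨K, h1, fun x p q q' => h2 (x, p) q q', fun x p q => ?_⟩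
    rw [h3, A.comp_right_fderiv]
    rfl
  choose K hKs hKd hKq using hK
  -- the equations for the parameters
  set z₀ : (ℝ × Y) × ℝ × ℝ := ((0, y₀), 0, 0) with hz₀
  let ι : Y × ℝ × ℝ × ℝ →L[ℝ] (ℝ × Y) × ℝ × ℝ :=
    ((-((ContinuousLinearMap.snd ℝ ℝ ℝ).comp ((ContinuousLinearMap.snd ℝ ℝ (ℝ × ℝ)).comp
      (ContinuousLinearMap.snd ℝ Y (ℝ × ℝ × ℝ))))).prod (ContinuousLinearMap.fst ℝ Y (ℝ × ℝ × ℝ))).prod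
    (((ContinuousLinearMap.fst ℝ ℝ ℝ).comp ((ContinuousLinearMap.snd ℝ ℝ (ℝ × ℝ)).comp
      (ContinuousLinearMap.snd ℝ Y (ℝ × ℝ × ℝ)))).prod ((ContinuousLinearMap.fst ℝ ℝ (ℝ × ℝ)).comp
      (ContinuousLinearMap.snd ℝ Y (ℝ × ℝ × ℝ))))
  have hι : ∀ y q p l, ι (y, q, p, l) = ((-l, y), p, q) := fun _ _ _ _ => rfl
  -- The unknowns are the shift `l` and the coefficients `p`, `q` for which all three remainders at
  -- `((-l, y), p, q)` vanish: then `(t + l)³ + p (t + l) - q` divides `F(·, y)`.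
  set R : Y × ℝ × ℝ × ℝ → ℝ × ℝ × ℝ := fun z => (r 0 (ι z), r 1 (ι z), r 2 (ι z)) with hR
  have hRs : ContDiff ℝ ∞ R :=
    ((hr 0).comp ι.contDiff).prodMk (((hr 1).comp ι.contDiff).prodMk ((hr 2).comp ι.contDiff))
  set u : Y × ℝ × ℝ × ℝ := (y₀, 0) with hu
  have hιu : ι u = z₀ := by
    show ι (y₀, 0, 0, 0) = z₀
    rw [hι, neg_zero]
  have hRu : R u = 0 := by
    simp only [hR, hιu, hr0]; rfl
  have hRd : ∀ v, fderiv ℝ R u v =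
      (fderiv ℝ (r 0) z₀ (ι v), fderiv ℝ (r 1) z₀ (ι v), fderiv ℝ (r 2) z₀ (ι v)) := by
    intro v
    have e : ∀ j, HasFDerivAt (fun z => r j (ι z)) ((fderiv ℝ (r j) z₀).comp ι) u := by
      intro j
      have h := ((hr j).differentiable (by simp) (ι u)).hasFDerivAt
      rw [hιu] at h
      exact HasFDerivAt.comp u (by rw [hιu]; exact h) ι.hasFDerivAt
    rw [((e 0).prodMk ((e 1).prodMk (e 2))).fderiv]
    rfl
  have hinv : (fderiv ℝ R u ∘L .inr ℝ Y (ℝ × ℝ × ℝ)).IsInvertible := by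
    -- In the order `q, p, l` the Jacobian is lower triangular with diagonal `c, -c, -3c`.
    have hinj : Function.Injective (fderiv ℝ R u ∘L .inr ℝ Y (ℝ × ℝ × ℝ)) := by
      rw [injective_iff_map_eq_zero]
      rintro ⟨q, p, l⟩ h
      have hι' : ι (0, q, p, l) = q • ((0 : ℝ × Y), (0 : ℝ), (1 : ℝ)) +
          p • ((0 : ℝ × Y), (1 : ℝ), (0 : ℝ)) + l • (((-1 : ℝ), (0 : Y)), (0 : ℝ), (0 : ℝ)) := by
        rw [hι]; simp
      have h' : fderiv ℝ R u (0, q, p, l) = 0 := h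
      rw [hRd, hι'] at h'
      simp only [map_add, map_smul, smul_eq_mul, Prod.mk_eq_zero, hq0, hp0, hl0, hp1, hl1, hl2,
        mul_zero, add_zero] at h'
      obtain ⟨e0, e1, e2⟩ := h'
      have hq : q = 0 := by simpa [hc.ne'] using e0
      have hp : p = 0 := by simpa [hq, hc.ne'] using e1
      have hl : l = 0 := by simpa [hq, hp, hc.ne'] using e2
      simp [hq, hp, hl]
    exact ⟨(LinearEquiv.ofInjectiveEndo
      ((fderiv ℝ R u ∘L .inr ℝ Y (ℝ × ℝ × ℝ)) : (ℝ × ℝ × ℝ) →ₗ[ℝ] (ℝ × ℝ × ℝ))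
      hinj).toContinuousLinearEquiv, by ext <;> rfl⟩
  obtain ⟨φ, hφ0, hφs, hφ⟩ := exists_smooth_implicit (f := R) (u := u)
    (Eventually.of_forall fun v => hRs.contDiffAt) hinv
  rw [hRu] at hφ
  have hφ0' : φ y₀ = 0 := hφ0
  have hφs' : ∀ᶠ y in 𝓝 y₀, ContDiffAt ℝ ∞ φ y := hφs
  have hφ' : ∀ᶠ y in 𝓝 y₀, R (y, φ y) = 0 := hφ
  -- Once the remainders vanish at `q`, Hadamard's lemma in the last variable extracts the factor
  -- `(t + l)³ + p (t + l) - q` from each of them. `E` is the resulting cofactor, with value `∂_q r₀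
  -- = c` at the base point.
  set E : ℝ × Y → ℝ := fun z => ∑ j : Fin 3, (z.1 + (φ z.2).2.2) ^ (j : ℕ) *
    K j (((-(φ z.2).2.2, z.2), (φ z.2).2.1), (φ z.2).1,
      (z.1 + (φ z.2).2.2) ^ 3 + (φ z.2).2.1 * (z.1 + (φ z.2).2.2)) with hE
  have hsnd : Tendsto (fun z : ℝ × Y => z.2) (𝓝 (0, y₀)) (𝓝 y₀) := continuous_snd.tendsto _
  have hEs : ∀ᶠ z in 𝓝 ((0 : ℝ), y₀), ContDiffAt ℝ ∞ E z := by
    filter_upwards [hsnd.eventually hφs'] with z hz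
    have hφz : ContDiffAt ℝ ∞ (fun z : ℝ × Y => φ z.2) z := hz.comp z contDiffAt_snd
    have c1 := hφz.fst
    have c2 := hφz.snd.fst
    have c3 := hφz.snd.snd
    have ct : ContDiffAt ℝ ∞ (fun z : ℝ × Y => z.1 + (φ z.2).2.2) z := contDiffAt_fst.add c3
    refine ContDiffAt.sum fun j _ => (ct.pow _).mul ((hKs j).contDiffAt.comp z ?_)
    exact ((c3.neg.prodMk contDiffAt_snd).prodMk c2).prodMk
      (c1.prodMk ((ct.pow 3).add (c2.mul ct)))
  have hE0 : E (0, y₀) = c := by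
    have := hKq 0 (0, y₀) 0 0
    simp [hE, hφ0', Fin.sum_univ_three, this]
    exact hq0
  refine ⟨E, fun y => 3 * (φ y).2.2, fun y => 3 * (φ y).2.2 ^ 2 + (φ y).2.1,
    fun y => (φ y).2.2 ^ 3 + (φ y).2.1 * (φ y).2.2 - (φ y).1, hEs, ?_, ?_, ?_,
    by simp [hφ0'], by simp [hφ0'], by simp [hφ0'], ?_⟩
  · exact hφs'.mono fun y hy => contDiffAt_const.mul hy.snd.snd
  · exact hφs'.mono fun y hy => (contDiffAt_const.mul (hy.snd.snd.pow 2)).add hy.snd.fst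
  · exact hφs'.mono fun y hy =>
      ((hy.snd.snd.pow 3).add (hy.snd.fst.mul hy.snd.snd)).sub hy.fst
  · have hpos : ∀ᶠ z in 𝓝 ((0 : ℝ), y₀), 0 < E z :=
      hEs.self_of_nhds.continuousAt.eventually (lt_mem_nhds (by rw [hE0]; exact hc))
    filter_upwards [hpos, hgF, hsnd.eventually hφ'] with z hz1 hz2 hz3
    refine ⟨hz1, ?_⟩
    obtain ⟨t, y⟩ := z
    set q := (φ y).1
    set p := (φ y).2.1
    set l := (φ y).2.2
    have hzero : ∀ j, r j ((-l, y), p, q) = 0 := by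
      have : R (y, q, p, l) = 0 := hz3
      simp only [hR, hι, Prod.mk_eq_zero] at this
      intro j
      fin_cases j
      exacts [this.1, this.2.1, this.2.2]
    have hd := hdiv (-l, y) (t + l) p
    have hx : ((-l, y) : ℝ × Y) + (t + l) • ((1 : ℝ), (0 : Y)) = (t, y) := by simp
    rw [hx, hz2] at hd
    rw [hd]
    have hk : ∀ j, r j ((-l, y), p, (t + l) ^ 3 + p * (t + l)) =
        ((t + l) ^ 3 + p * (t + l) - q) * K j (((-l, y), p), q, (t + l) ^ 3 + p * (t + l)) := by
      intro j
      rw [← hKd, hzero, sub_zero]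
    simp only [hk]
    show _ = (∑ j : Fin 3, (t + l) ^ (j : ℕ) *
      K j (((-l, y), p), q, (t + l) ^ 3 + p * (t + l))) *
      (t ^ 3 + 3 * l * t ^ 2 + (3 * l ^ 2 + p) * t + (l ^ 3 + p * l - q))
    rw [Finset.sum_mul]
    refine Finset.sum_congr rfl fun j _ => ?_
    ring

/-! ### Effective hyperbolicity at the triple point forces `∂ₜa > 0`. -/

theorem two_le_infty : (1 + 1 : ℕ∞ω) ≤ ∞ := by
  rw [one_add_one_eq_two]
  exact WithTop.coe_le_coe.2 (le_top : (2 : ℕ∞) ≤ ⊤)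

/-- First order Taylor expansion with a locally uniform quadratic remainder. -/
theorem SmoothNear.exists_taylor_bound {V : Type*} [NormedAddCommGroup V] [NormedSpace ℝ V]
    {f : V → ℝ} {z : V} (hf : SmoothNear f z) :
    ∃ K : ℝ, 0 ≤ K ∧ ∃ s ∈ 𝓝 z, ∀ x ∈ s, ∀ y ∈ s,
      |f y - f x - fderiv ℝ f x (y - x)| ≤ K * ‖y - x‖ ^ 2 := by
  have h1 : ContDiffAt ℝ 1 (fderiv ℝ f) z := hf.self_of_nhds.fderiv_right two_le_infty
  obtain ⟨K, t, ht, hK⟩ := h1.exists_lipschitzOnWith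
  obtain ⟨R, hR, hball⟩ := Metric.mem_nhds_iff.1 (inter_mem ht hf)
  refine ⟨K, K.2, Metric.ball z R, Metric.ball_mem_nhds _ hR, fun x hx y hy => ?_⟩
  have hseg : segment ℝ x y ⊆ Metric.ball z R := (convex_ball z R).segment_subset hx hy
  have := (convex_segment x y).norm_image_sub_le_of_norm_hasFDerivWithin_le' (f := f)
    (f' := fderiv ℝ f) (φ := fderiv ℝ f x) (C := K * ‖y - x‖)
    (fun w hw => ((show ContDiffAt ℝ ∞ f w from (hball (hseg hw)).2).differentiableAt
      (by simp)).hasFDerivAt.hasFDerivWithinAt) (fun w hw => by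
        refine (hK.norm_sub_le (hball (hseg hw)).1 (hball hx).1).trans ?_
        gcongr
        obtain ⟨θ, hθ, rfl⟩ := (segment_eq_image' ℝ x y ▸ hw : w ∈ (fun θ : ℝ => x + θ • (y - x)) '' Icc 0 1)
        simp only [add_sub_cancel_left, norm_smul, Real.norm_eq_abs, abs_of_nonneg hθ.1]
        exact mul_le_of_le_one_left (norm_nonneg _) hθ.2)
    (left_mem_segment ℝ x y) (right_mem_segment ℝ x y)
  rw [Real.norm_eq_abs] at this
  linarith [this]

/-- A critical zero of third order along a half-line has no second derivative in that direction. -/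
theorem second_derivative_eq_zero_of_cubic_bound {V : Type*} [NormedAddCommGroup V]
    [NormedSpace ℝ V] {p : V → ℝ} {z h : V} (hp : SmoothNear p z) (h0 : p z = 0)
    (h1 : fderiv ℝ p z = 0) {C : ℝ} (hC : ∀ᶠ s : ℝ in 𝓝[>] 0, |p (z + s • h)| ≤ C * s ^ 3) :
    fderiv ℝ (fun y => fderiv ℝ p y h) z h = 0 := by
  set m := fderiv ℝ (fun y => fderiv ℝ p y h) z h with hm
  have hline : ∀ s : ℝ, HasDerivAt (fun s : ℝ => z + s • h) h s := fun s => by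
    simpa using ((hasDerivAt_id s).smul_const h).const_add z
  have htend : Tendsto (fun s : ℝ => z + s • h) (𝓝 0) (𝓝 z) := by
    have := (hline 0).continuousAt.tendsto
    simpa using this
  have hD : HasDerivAt (fun s : ℝ => fderiv ℝ p (z + s • h) h) m 0 := by
    have e1 : ContDiffAt ℝ 1 (fun y => fderiv ℝ p y h) z :=
      (hp.self_of_nhds.fderiv_right (m := 1) two_le_infty).clm_apply contDiffAt_const
    have e2 := (e1.differentiableAt (by simp)).hasFDerivAt
    have e3 : HasFDerivAt (fun y => fderiv ℝ p y h)
      (fderiv ℝ (fun y => fderiv ℝ p y h) z) (z + (0 : ℝ) • h) := by simpa using e2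
    exact e3.comp_hasDerivAt (0 : ℝ) (hline 0)
  have hslope : Tendsto (fun s : ℝ => fderiv ℝ p (z + s • h) h / (2 * s)) (𝓝[>] 0) (𝓝 (m / 2)) := by
    have e1 := (hasDerivAt_iff_tendsto_slope.1 hD).mono_left (nhdsGT_le_nhdsNE (0 : ℝ))
    refine (e1.div_const 2).congr' ?_
    filter_upwards [self_mem_nhdsWithin] with s hs
    have hs' : s ≠ 0 := ne_of_gt hs
    simp only [slope_def_field, zero_smul, add_zero, h1, zero_apply, sub_zero]
    field_simp
  -- L'Hôpital gives `p / s² → m / 2`, whereas the cubic bound gives the limit `0`.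
  have hlim : Tendsto (fun s : ℝ => p (z + s • h) / s ^ 2) (𝓝[>] 0) (𝓝 (m / 2)) := by
    refine HasDerivAt.lhopital_zero_nhdsGT (f := fun s : ℝ => p (z + s • h)) (g := fun s => s ^ 2)
      (f' := fun s : ℝ => fderiv ℝ p (z + s • h) h) (g' := fun s => 2 * s) ?_ ?_ ?_ ?_ ?_ hslope
    · filter_upwards [nhdsWithin_le_nhds (htend.eventually hp)] with s hs
      exact (hs.differentiableAt (by simp)).hasFDerivAt.comp_hasDerivAt s (hline s)
    · exact Eventually.of_forall fun s => by simpa using hasDerivAt_pow 2 s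
    · filter_upwards [self_mem_nhdsWithin] with s hs
      have : (0 : ℝ) < s := hs
      positivity
    · have := (hp.self_of_nhds.continuousAt.tendsto.comp htend)
      rw [h0] at this
      exact this.mono_left nhdsWithin_le_nhds
    · have : Tendsto (fun s : ℝ => s ^ 2) (𝓝 0) (𝓝 (0 ^ 2)) := (continuous_pow 2).tendsto 0
      rw [zero_pow (by norm_num)] at this
      exact this.mono_left nhdsWithin_le_nhds
  have hzero : Tendsto (fun s : ℝ => p (z + s • h) / s ^ 2) (𝓝[>] 0) (𝓝 0) := by
    refine squeeze_zero_norm' (a := fun s => C * s) ?_ ?_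
    · filter_upwards [hC, self_mem_nhdsWithin] with s hs hs0
      have hs0' : (0 : ℝ) < s := hs0
      rw [Real.norm_eq_abs, abs_div, abs_of_pos (by positivity : 0 < s ^ 2),
        div_le_iff₀ (by positivity)]
      linarith [hs]
    · have : Tendsto (fun s : ℝ => C * s) (𝓝 0) (𝓝 (C * 0)) :=
        (continuous_const.mul continuous_id).tendsto 0
      rw [mul_zero] at this
      exact this.mono_left nhdsWithin_le_nhds
  have := tendsto_nhds_unique hlim hzero
  linarith

/-- The second derivative vanishes if it vanishes on the diagonal. -/
theorem secondPartial_eq_zero_of_diagonal {d : ℕ} {p : PhaseSpace d → ℝ} {z : PhaseSpace d}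
    (hp : SmoothNear p z)
    (h : ∀ v : PhaseSpace d, 0 ≤ v.1.1 → fderiv ℝ (fun y => fderiv ℝ p y v) z v = 0)
    (v w : PhaseSpace d) : secondPartial p z v w = 0 := by
  have hd : DifferentiableAt ℝ (fderiv ℝ p) z :=
    (hp.self_of_nhds.fderiv_right (m := 1) two_le_infty).differentiableAt (by simp)
  have hB : ∀ v w, fderiv ℝ (fun y => fderiv ℝ p y v) z w = fderiv ℝ (fderiv ℝ p) z w v := by
    intro v w
    rw [(hd.hasFDerivAt.clm_apply (hasFDerivAt_const v z)).fderiv]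
    simp
  have hsymm : IsSymmSndFDerivAt ℝ p z := hp.self_of_nhds.isSymmSndFDerivAt (by
    rw [minSmoothness_of_isRCLikeNormedField, ← one_add_one_eq_two]; exact two_le_infty)
  have hdiag : ∀ v, fderiv ℝ (fderiv ℝ p) z v v = 0 := by
    intro v
    -- Only directions into `t ≥ 0` are controlled, but the quadratic form takes the same value at
    -- `-v`; polarization then gives the mixed entries.
    rcases le_total 0 v.1.1 with hv | hv
    · rw [← hB]; exact h v hv
    · have := h (-v) (by simpa using hv)
      rw [hB] at this
      simpa using this
  have := hdiag (v + w)
  simp only [map_add, add_apply, hdiag, zero_add, add_zero] at this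
  rw [hsymm v w] at this
  show fderiv ℝ (fun y => fderiv ℝ p y v) z w = 0
  rw [hB]
  linarith

theorem hamiltonMap_eq_zero {d : ℕ} {p : PhaseSpace d → ℝ} {z : PhaseSpace d}
    (h : ∀ v w, secondPartial p z v w = 0) : hamiltonMap p z = 0 := by
  ext i j
  rcases i with i | i <;> rcases j with j | j <;> simp [hamiltonMap, h]

theorem not_hasEigenvalue_toLin'_zero {ι : Type*} [Fintype ι] [DecidableEq ι] {μ : ℝ} (hμ : μ ≠ 0) :
    ¬ Module.End.HasEigenvalue (Matrix.toLin' (0 : Matrix ι ι ℝ)) μ := by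
  intro h
  obtain ⟨v, hv⟩ := h.exists_hasEigenvector
  have := hv.apply_eq_smul
  rw [map_zero, LinearMap.zero_apply] at this
  exact hv.2 ((smul_eq_zero.1 this.symm).resolve_left hμ)

theorem principalSymbol_apply {d : ℕ} (a b : ℝ × Eucl d × Eucl d → ℝ) (z : PhaseSpace d) :
    principalSymbol a b z = z.2.1 ^ 3 - a (z.1.1, z.1.2, z.2.2) * ‖z.2.2‖ ^ 2 * z.2.1 -
      b (z.1.1, z.1.2, z.2.2) * ‖z.2.2‖ ^ 3 := by
  simp [principalSymbol, charPolynomial]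

theorem coefficients_eq_zero_of_triple_root {d : ℕ} {a b : ℝ × Eucl d × Eucl d → ℝ} {ξ₀ : Eucl d}
    (hξ₀ : ‖ξ₀‖ = 1) (h : (charPolynomial a b 0 0 ξ₀).rootMultiplicity 0 = 3) :
    a (0, 0, ξ₀) = 0 ∧ b (0, 0, ξ₀) = 0 := by
  have hd := Polynomial.pow_rootMultiplicity_dvd (charPolynomial a b 0 0 ξ₀) 0
  rw [h, Polynomial.C_0, sub_zero, Polynomial.X_pow_dvd_iff] at hd
  constructor
  · have := hd 1 (by norm_num)
    simpa [charPolynomial, hξ₀, Polynomial.coeff_X_pow, Polynomial.coeff_C] using this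
  · have := hd 0 (by norm_num)
    simpa [charPolynomial, hξ₀, Polynomial.coeff_X_pow, Polynomial.coeff_C] using this

theorem smoothNear_principalSymbol {d : ℕ} {a b : ℝ × Eucl d × Eucl d → ℝ} {ξ₀ : Eucl d}
    (ha : SmoothNear a (0, 0, ξ₀)) (hb : SmoothNear b (0, 0, ξ₀)) (hξ₀ : ξ₀ ≠ 0) :
    SmoothNear (principalSymbol a b) ((0, 0), (0, ξ₀)) := by
  let π : PhaseSpace d →L[ℝ] ℝ × Eucl d × Eucl d :=
    ((ContinuousLinearMap.fst ℝ ℝ (Eucl d)).comp (ContinuousLinearMap.fst ℝ _ _)).prod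
      (((ContinuousLinearMap.snd ℝ ℝ (Eucl d)).comp (ContinuousLinearMap.fst ℝ _ _)).prod
        ((ContinuousLinearMap.snd ℝ ℝ (Eucl d)).comp (ContinuousLinearMap.snd ℝ _ _)))
  have hπ : Tendsto π (𝓝 ((0, 0), (0, ξ₀))) (𝓝 (0, 0, ξ₀)) := π.continuous.tendsto _
  have hξ : ∀ᶠ z : PhaseSpace d in 𝓝 ((0, 0), (0, ξ₀)), z.2.2 ≠ 0 :=
    (continuous_snd.comp continuous_snd).continuousAt.eventually_ne hξ₀
  have hfun : principalSymbol a b = fun z : PhaseSpace d => z.2.1 ^ 3 - a (π z) * ‖z.2.2‖ ^ 2 * z.2.1 -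
      b (π z) * ‖z.2.2‖ ^ 3 := funext (principalSymbol_apply a b)
  filter_upwards [hπ.eventually ha, hπ.eventually hb, hξ] with z h1 h2 h3
  rw [hfun]
  have c1 : ContDiffAt ℝ ∞ (fun z : PhaseSpace d => a (π z)) z := h1.comp z π.contDiff.contDiffAt
  have c2 : ContDiffAt ℝ ∞ (fun z : PhaseSpace d => b (π z)) z := h2.comp z π.contDiff.contDiffAt
  have c3 : ContDiffAt ℝ ∞ (fun z : PhaseSpace d => z.2.2) z := contDiffAt_snd.snd
  have c4 : ContDiffAt ℝ ∞ (fun z : PhaseSpace d => z.2.1) z := contDiffAt_snd.fst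
  have c5 : ContDiffAt ℝ ∞ (fun z : PhaseSpace d => ‖z.2.2‖) z := (contDiffAt_norm ℝ h3).comp z c3
  exact ((c4.pow 3).sub ((c1.mul (c5.pow 2)).mul c4)).sub (c2.mul (c5.pow 3))

theorem nonneg_of_discriminant {x y : ℝ} (h : 27 * y ^ 2 ≤ 4 * x ^ 3) : 0 ≤ x := by
  by_contra! hx
  have : x ^ 3 < 0 := Odd.pow_neg (by decide) hx
  nlinarith [sq_nonneg y]

/-- At `t = 0` the function `a(0,·) ≥ 0` has a minimum at `X₀`, which kills the remaining partial
derivatives. -/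
theorem fderiv_eq_zero_of_time_derivative_eq_zero {d : ℕ} {a : ℝ × Eucl d × Eucl d → ℝ}
    {X₀ : Eucl d × Eucl d} (ha : SmoothNear a (0, X₀)) (ha0 : a (0, X₀) = 0)
    (hnn : ∀ᶠ z in 𝓝 ((0 : ℝ), X₀), 0 ≤ z.1 → 0 ≤ a z) (ht : fderiv ℝ a (0, X₀) (1, 0) = 0) :
    fderiv ℝ a (0, X₀) = 0 := by
  have hd := (ha.self_of_nhds.differentiableAt (by simp)).hasFDerivAt
  have hcomp : HasFDerivAt (fun X => a (0, X))
      ((fderiv ℝ a (0, X₀)).comp (ContinuousLinearMap.inr ℝ ℝ (Eucl d × Eucl d))) X₀ :=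
    hd.comp X₀ (hasFDerivAt_prodMk_right (𝕜 := ℝ) (0 : ℝ) X₀)
  have hmin : IsLocalMin (fun X => a (0, X)) X₀ := by
    have htend : Tendsto (fun X : Eucl d × Eucl d => ((0 : ℝ), X)) (𝓝 X₀) (𝓝 (0, X₀)) :=
      (continuous_const.prodMk continuous_id).tendsto _
    filter_upwards [htend.eventually hnn] with X hX
    rw [ha0]
    exact hX le_rfl
  have h0 := hmin.hasFDerivAt_eq_zero hcomp
  refine ContinuousLinearMap.ext fun v => ?_
  have hv : v = v.1 • ((1 : ℝ), (0 : Eucl d × Eucl d)) + ((0 : ℝ), v.2) := by ext <;> simp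
  have h1 : fderiv ℝ a (0, X₀) (0, v.2) = 0 := DFunLike.congr_fun h0 v.2
  rw [hv, map_add, map_smul, ht, h1]
  simp

/-- At an effectively hyperbolic triple point, `∂ₜ a > 0`. -/
theorem time_derivative_pos {d : ℕ} {a b : ℝ × Eucl d × Eucl d → ℝ} {ξ₀ : Eucl d}
    (hξ₀ : ‖ξ₀‖ = 1) (ha : SmoothNear a (0, 0, ξ₀)) (hb : SmoothNear b (0, 0, ξ₀))
    (ha0 : a (0, 0, ξ₀) = 0)
    (hhyp : ∀ᶠ z in 𝓝 ((0 : ℝ), (0 : Eucl d), ξ₀), 0 ≤ z.1 → 27 * b z ^ 2 ≤ 4 * a z ^ 3)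
    (heff : EffectivelyHyperbolic (principalSymbol a b) ((0, 0), (0, ξ₀))) :
    0 < fderiv ℝ a (0, 0, ξ₀) (1, 0) := by
  have hnn : ∀ᶠ z in 𝓝 ((0 : ℝ), (0 : Eucl d), ξ₀), 0 ≤ z.1 → 0 ≤ a z :=
    hhyp.mono fun z hz h => nonneg_of_discriminant (hz h)
  have hd := (ha.self_of_nhds.differentiableAt (by simp)).hasFDerivAt
  have hge : 0 ≤ fderiv ℝ a (0, 0, ξ₀) (1, 0) := by
    have hline : HasDerivAt (fun t : ℝ => a (t, 0, ξ₀)) (fderiv ℝ a (0, 0, ξ₀) (1, 0)) 0 :=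
      hd.comp_hasDerivAt (0 : ℝ) ((hasDerivAt_id (0 : ℝ)).prodMk
        (hasDerivAt_const (0 : ℝ) ((0 : Eucl d), ξ₀)))
    have hs := (hasDerivAt_iff_tendsto_slope.1 hline).mono_left (nhdsGT_le_nhdsNE (0 : ℝ))
    refine ge_of_tendsto hs ?_
    have htend : Tendsto (fun t : ℝ => (t, (0 : Eucl d), ξ₀)) (𝓝 0) (𝓝 (0, 0, ξ₀)) :=
      (continuous_id.prodMk continuous_const).tendsto 0
    filter_upwards [nhdsWithin_le_nhds (htend.eventually hnn), self_mem_nhdsWithin] with t h1 h2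
    have h2' : (0 : ℝ) < t := h2
    rw [slope_def_field, ha0, sub_zero, sub_zero]
    exact div_nonneg (h1 h2'.le) h2'.le
  refine lt_of_le_of_ne hge fun hzero => ?_
  have hDa := fderiv_eq_zero_of_time_derivative_eq_zero ha ha0 hnn hzero.symm
  have hξne : ξ₀ ≠ 0 := by rintro rfl; simp at hξ₀
  have hps := smoothNear_principalSymbol ha hb hξne
  obtain ⟨K, hK, s, hs, hTay⟩ := ha.exists_taylor_bound
  obtain ⟨hp0, hp1, μ, hμ, hev, -⟩ := heff
  refine not_hasEigenvalue_toLin'_zero hμ (ι := (Unit ⊕ Fin d) ⊕ (Unit ⊕ Fin d)) ?_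
  rw [hamiltonMap_eq_zero] at hev
  · exact hev
  refine secondPartial_eq_zero_of_diagonal hps fun h hh => ?_
  set n := ‖h‖ with hn
  have hn0 : 0 ≤ n := norm_nonneg h
  -- The three summands of `C` bound `τ³`, `a|ξ|²τ` and `b|ξ|³`, with `|ξ| < 2` along the short
  -- segment.
  refine second_derivative_eq_zero_of_cubic_bound hps hp0 hp1
    (C := n ^ 3 + 4 * K * n ^ 3 + 8 * (1 + K) ^ 2 * n ^ 3) ?_
  set y : ℝ → ℝ × Eucl d × Eucl d := fun σ => (σ * h.1.1, σ • h.1.2, ξ₀ + σ • h.2.2) with hy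
  have hytend : Tendsto y (𝓝 0) (𝓝 (0, 0, ξ₀)) := by
    have hc : Continuous y := by fun_prop
    have := hc.tendsto 0
    simpa [hy] using this
  have hξ2 : ∀ᶠ σ : ℝ in 𝓝 0, ‖ξ₀ + σ • h.2.2‖ < 2 := by
    have hc : Continuous fun σ : ℝ => ‖ξ₀ + σ • h.2.2‖ := by fun_prop
    refine hc.continuousAt.eventually (gt_mem_nhds ?_)
    simp [hξ₀]
  filter_upwards [nhdsWithin_le_nhds (hytend.eventually hhyp),
    nhdsWithin_le_nhds (hytend.eventually hs), nhdsWithin_le_nhds hξ2, self_mem_nhdsWithin]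
    with σ e1 e2 e3 e4
  have hσ : (0 : ℝ) < σ := e4
  have n11 : |h.1.1| ≤ n := (norm_fst_le h.1).trans (norm_fst_le h)
  have n12 : ‖h.1.2‖ ≤ n := (norm_snd_le h.1).trans (norm_fst_le h)
  have n21 : |h.2.1| ≤ n := (norm_fst_le h.2).trans (norm_snd_le h)
  have n22 : ‖h.2.2‖ ≤ n := (norm_snd_le h.2).trans (norm_snd_le h)
  have hdisc := e1 (mul_nonneg hσ.le hh)
  have hann := nonneg_of_discriminant hdisc
  have hnorm : ‖y σ - (0, 0, ξ₀)‖ ≤ σ * n := by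
    have : y σ - (0, 0, ξ₀) = σ • (h.1.1, h.1.2, h.2.2) := by simp [hy]
    rw [this, norm_smul, Real.norm_of_nonneg hσ.le]
    gcongr
    simp only [Prod.norm_def]
    exact max_le n11 (max_le n12 n22)
  have hale : a (y σ) ≤ K * (σ * n) ^ 2 := by
    have := hTay _ (mem_of_mem_nhds hs) _ e2
    rw [hDa, ha0] at this
    simp only [zero_apply, sub_zero] at this
    refine (le_abs_self _).trans (this.trans ?_)
    gcongr
  -- From `27 b² ≤ 4 a³` and `a ≤ K (σ n)²`. The constant `(1 + K)²` replaces `K^(3/2)` to avoid a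
  -- fractional power.
  have hble : |b (y σ)| ≤ (1 + K) ^ 2 * (σ * n) ^ 3 := by
    refine abs_le_of_sq_le_sq ?_ (by positivity)
    have h3 : a (y σ) ^ 3 ≤ (K * (σ * n) ^ 2) ^ 3 := by gcongr
    have h4 : K ^ 3 ≤ (1 + K) ^ 4 := by
      calc K ^ 3 ≤ (1 + K) ^ 3 := by gcongr; linarith
        _ ≤ (1 + K) ^ 4 := pow_le_pow_right₀ (by linarith) (by norm_num)
    have h5 : K ^ 3 * (σ * n) ^ 6 ≤ (1 + K) ^ 4 * (σ * n) ^ 6 := by gcongr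
    nlinarith [h3, h5, sq_nonneg (b (y σ))]
  have hval : principalSymbol a b (((0, 0), (0, ξ₀)) + σ • h) = (σ * h.2.1) ^ 3 -
      a (y σ) * ‖ξ₀ + σ • h.2.2‖ ^ 2 * (σ * h.2.1) - b (y σ) * ‖ξ₀ + σ • h.2.2‖ ^ 3 := by
    rw [principalSymbol_apply]
    simp [hy]
  have hτ : |σ * h.2.1| ≤ σ * n := by
    rw [abs_mul, abs_of_pos hσ]; gcongr
  rw [hval]
  have t1 : |(σ * h.2.1) ^ 3| ≤ (σ * n) ^ 3 := by rw [abs_pow]; gcongr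
  have t2 : |a (y σ) * ‖ξ₀ + σ • h.2.2‖ ^ 2 * (σ * h.2.1)| ≤ K * (σ * n) ^ 2 * 2 ^ 2 * (σ * n) := by
    rw [abs_mul, abs_mul, abs_of_nonneg hann, abs_of_nonneg (by positivity : 0 ≤ ‖ξ₀ + σ • h.2.2‖ ^ 2)]
    gcongr
  have t3 : |b (y σ) * ‖ξ₀ + σ • h.2.2‖ ^ 3| ≤ (1 + K) ^ 2 * (σ * n) ^ 3 * 2 ^ 3 := by
    rw [abs_mul, abs_of_nonneg (by positivity : 0 ≤ ‖ξ₀ + σ • h.2.2‖ ^ 3)]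
    gcongr
  calc _ ≤ (σ * n) ^ 3 + K * (σ * n) ^ 2 * 2 ^ 2 * (σ * n) + (1 + K) ^ 2 * (σ * n) ^ 3 * 2 ^ 3 :=
        (abs_sub _ _).trans (add_le_add ((abs_sub _ _).trans (add_le_add t1 t2)) t3)
    _ = _ := by ring

/-! ### Factorization of `a` and preparation of the discriminant. -/

/-- `-α` is the implicit solution of `a(t, X) = 0`, and `e` is the Hadamard quotient in `t`, equal
to `∂ₜa > 0` at the base point. -/
theorem exists_isTimeFactorization {d : ℕ} {a : ℝ × Eucl d × Eucl d → ℝ} {X₀ : Eucl d × Eucl d}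
    (ha : SmoothNear a (0, X₀)) (ha0 : a (0, X₀) = 0) (hpos : 0 < fderiv ℝ a (0, X₀) (1, 0)) :
    ∃ (e : ℝ × Eucl d × Eucl d → ℝ) (α : Eucl d × Eucl d → ℝ), IsTimeFactorization a X₀ e α := by
  obtain ⟨g, hg, -, hga⟩ := exists_smooth_compactSupport_eq_near ha
  set f : (Eucl d × Eucl d) × ℝ → ℝ := fun z => g (z.2, z.1) with hf
  have hfs : ContDiff ℝ ∞ f := hg.comp (contDiff_snd.prodMk contDiff_fst)
  have hfd : ∀ v, fderiv ℝ f (X₀, 0) v = fderiv ℝ a (0, X₀) (v.2, v.1) := by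
    intro v
    rw [← hga.fderiv_eq]
    have h1 := (hg.differentiable (by simp) (0, X₀)).hasFDerivAt
    have h2 : HasFDerivAt (fun z : (Eucl d × Eucl d) × ℝ => (z.2, z.1))
        ((ContinuousLinearMap.snd ℝ (Eucl d × Eucl d) ℝ).prod (ContinuousLinearMap.fst ℝ _ _))
        (X₀, (0 : ℝ)) := hasFDerivAt_snd.prodMk hasFDerivAt_fst
    have h3 : HasFDerivAt f ((fderiv ℝ g (0, X₀)).comp
        ((ContinuousLinearMap.snd ℝ (Eucl d × Eucl d) ℝ).prod (ContinuousLinearMap.fst ℝ _ _)))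
        (X₀, (0 : ℝ)) := HasFDerivAt.comp (X₀, (0 : ℝ)) (by exact h1) h2
    rw [h3.fderiv]
    rfl
  set A := fderiv ℝ a (0, X₀) (1, 0) with hA
  have hf0 : f (X₀, 0) = 0 := by
    simp only [hf]; rw [hga.self_of_nhds, ha0]
  have hinv : (fderiv ℝ f (X₀, 0) ∘L .inr ℝ (Eucl d × Eucl d) ℝ).IsInvertible := by
    refine ⟨ContinuousLinearEquiv.unitsEquivAut ℝ (Units.mk0 A hpos.ne'), ?_⟩
    ext
    simp [hfd, hA]
  obtain ⟨φ, hφ0, hφs, hφ⟩ := exists_smooth_implicit (f := f) (u := (X₀, (0 : ℝ)))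
    (Eventually.of_forall fun v => hfs.contDiffAt) hinv
  rw [hf0] at hφ
  obtain ⟨K, hKs, hK, hKd⟩ := exists_hadamard_quotient hfs
  have hφ0' : φ X₀ = 0 := hφ0
  have hφs' : ∀ᶠ X in 𝓝 X₀, ContDiffAt ℝ ∞ φ X := hφs
  have hsnd : Tendsto (fun z : ℝ × Eucl d × Eucl d => z.2) (𝓝 (0, X₀)) (𝓝 X₀) :=
    continuous_snd.tendsto _
  set e : ℝ × Eucl d × Eucl d → ℝ := fun z => K (z.2, φ z.2, z.1) with he
  have hes : SmoothNear e (0, X₀) := by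
    filter_upwards [hsnd.eventually hφs'] with z hz
    exact hKs.contDiffAt.comp z (contDiffAt_snd.prodMk ((hz.comp z contDiffAt_snd).prodMk contDiffAt_fst))
  have he0 : e (0, X₀) = A := by
    simp only [he, hφ0', hKd, hfd, hA]
  refine ⟨e, fun X => -φ X, hes, hφs'.mono fun X hX => hX.neg, ?_⟩
  have hpos' : ∀ᶠ z in 𝓝 ((0 : ℝ), X₀), 0 < e z :=
    hes.self_of_nhds.continuousAt.eventually (lt_mem_nhds (by rw [he0]; exact hpos))
  filter_upwards [hpos', hga, hsnd.eventually hφ] with z h1 h2 h3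
  refine ⟨h1, ?_⟩
  have := hK z.2 (φ z.2) z.1
  rw [h3, sub_zero] at this
  rw [← h2]
  show f (z.2, z.1) = _
  rw [this]
  ring

theorem tendsto_div_of_hasDerivAt {f : ℝ → ℝ} {f' : ℝ} (h : HasDerivAt f f' 0) (h0 : f 0 = 0) :
    Tendsto (fun t => f t / t) (𝓝[≠] 0) (𝓝 f') := by
  refine (hasDerivAt_iff_tendsto_slope.1 h).congr fun t => ?_
  rw [slope_def_field, h0, sub_zero, sub_zero]

/-- After division by `t²` the left side tends to `27 g'²` and the right side is `O(t)`. -/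
theorem derivative_eq_zero_of_sq_le_cube {f g : ℝ → ℝ} {f' g' : ℝ} (hf : HasDerivAt f f' 0)
    (hg : HasDerivAt g g' 0) (hf0 : f 0 = 0) (hg0 : g 0 = 0)
    (h : ∀ᶠ t in 𝓝[>] 0, 27 * g t ^ 2 ≤ 4 * f t ^ 3) : g' = 0 := by
  have tf := (tendsto_div_of_hasDerivAt hf hf0).mono_left (nhdsGT_le_nhdsNE (0 : ℝ))
  have tg := (tendsto_div_of_hasDerivAt hg hg0).mono_left (nhdsGT_le_nhdsNE (0 : ℝ))
  have tid : Tendsto (fun t : ℝ => t) (𝓝[>] 0) (𝓝 0) := nhdsWithin_le_nhds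
  have hle : 27 * g' ^ 2 ≤ 4 * f' ^ 3 * 0 := by
    refine le_of_tendsto_of_tendsto ((tg.pow 2).const_mul 27) (((tf.pow 3).const_mul 4).mul tid) ?_
    filter_upwards [h, self_mem_nhdsWithin] with t ht ht0
    have ht0' : (0 : ℝ) < t := ht0
    have e1 : 27 * (g t / t) ^ 2 = 27 * g t ^ 2 / t ^ 2 := by ring
    have e2 : 4 * (f t / t) ^ 3 * t = 4 * f t ^ 3 / t ^ 2 := by field_simp
    rw [e1, e2]
    gcongr
  nlinarith [sq_nonneg g']

theorem SmoothNear.comp_prodMk_right {V : Type*} [NormedAddCommGroup V] [NormedSpace ℝ V]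
    {f : ℝ × V → ℝ} {t : ℝ} {X : V} (hf : SmoothNear f (t, X)) : SmoothNear (fun s => f (s, X)) t := by
  have htend : Tendsto (fun s : ℝ => (s, X)) (𝓝 t) (𝓝 (t, X)) :=
    (continuous_id.prodMk continuous_const).tendsto t
  filter_upwards [htend.eventually hf] with s hs
  exact hs.comp s (contDiffAt_id.prodMk contDiffAt_const)

theorem hasDerivAt_prodMk_right {V : Type*} [NormedAddCommGroup V] [NormedSpace ℝ V]
    {f : ℝ × V → ℝ} {t : ℝ} {X : V} (hf : DifferentiableAt ℝ f (t, X)) :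
    HasDerivAt (fun s => f (s, X)) (fderiv ℝ f (t, X) (1, 0)) t :=
  hf.hasFDerivAt.comp_hasDerivAt t ((hasDerivAt_id t).prodMk (hasDerivAt_const t X))

theorem SmoothNear.contDiffAt_deriv {f : ℝ → ℝ} {t : ℝ} (hf : SmoothNear f t) :
    ContDiffAt ℝ 1 (deriv f) t :=
  (hf.self_of_nhds.fderiv_right (m := 1) two_le_infty).clm_apply contDiffAt_const

/-- The derivative is `12 f² f' - 54 g g'`. Since `g / t → 0` and `g' / t` converges, only the first
term survives at order `t²`. -/
theorem tendsto_deriv_discriminant {f g : ℝ → ℝ} {c : ℝ} (hf : SmoothNear f 0) (hg : SmoothNear g 0)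
    (hfd : HasDerivAt f c 0) (hgd : HasDerivAt g 0 0) (hf0 : f 0 = 0) (hg0 : g 0 = 0) :
    Tendsto (fun t => deriv (fun t => 4 * f t ^ 3 - 27 * g t ^ 2) t / t ^ 2) (𝓝[≠] 0)
      (𝓝 (3 * (4 * c ^ 3))) := by
  have tf := tendsto_div_of_hasDerivAt hfd hf0
  have tg := tendsto_div_of_hasDerivAt hgd hg0
  have tf' : Tendsto (deriv f) (𝓝[≠] 0) (𝓝 c) := by
    rw [← hfd.deriv]
    exact hf.contDiffAt_deriv.continuousAt.tendsto.mono_left nhdsWithin_le_nhds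
  obtain ⟨m, tg'⟩ : ∃ m, Tendsto (fun t => deriv g t / t) (𝓝[≠] 0) (𝓝 m) := by
    have h1 : DifferentiableAt ℝ (deriv g) 0 := hg.contDiffAt_deriv.differentiableAt (by simp)
    exact ⟨_, tendsto_div_of_hasDerivAt h1.hasDerivAt hgd.deriv⟩
  have key := (((tf.pow 2).mul tf').const_mul 12).sub ((tg.mul tg').const_mul 54)
  have : 12 * (c ^ 2 * c) - 54 * (0 * m) = 3 * (4 * c ^ 3) := by ring
  rw [this] at key
  refine key.congr' ?_
  filter_upwards [nhdsWithin_le_nhds hf, nhdsWithin_le_nhds hg, self_mem_nhdsWithin] with t h1 h2 h3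
  have h3' : t ≠ 0 := h3
  have d1 := (h1.differentiableAt (by simp)).hasDerivAt
  have d2 := (h2.differentiableAt (by simp)).hasDerivAt
  have d3 := (((d1.pow 3).const_mul 4).sub ((d2.pow 2).const_mul 27)).deriv
  have d4 : deriv (fun t => 4 * f t ^ 3 - 27 * g t ^ 2) t = _ := d3
  rw [d4]
  push_cast
  field_simp
  ring

theorem time_derivative_eq_zero_of_discriminant {d : ℕ} {a b : ℝ × Eucl d × Eucl d → ℝ}
    {X₀ : Eucl d × Eucl d} (ha : SmoothNear a (0, X₀)) (hb : SmoothNear b (0, X₀))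
    (ha0 : a (0, X₀) = 0) (hb0 : b (0, X₀) = 0)
    (hhyp : ∀ᶠ z in 𝓝 ((0 : ℝ), X₀), 0 ≤ z.1 → 27 * b z ^ 2 ≤ 4 * a z ^ 3) :
    fderiv ℝ b (0, X₀) (1, 0) = 0 := by
  refine derivative_eq_zero_of_sq_le_cube
    (hasDerivAt_prodMk_right (ha.self_of_nhds.differentiableAt (by simp)))
    (hasDerivAt_prodMk_right (hb.self_of_nhds.differentiableAt (by simp))) ha0 hb0 ?_
  have htend : Tendsto (fun s : ℝ => (s, X₀)) (𝓝 0) (𝓝 (0, X₀)) :=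
    (continuous_id.prodMk continuous_const).tendsto 0
  filter_upwards [nhdsWithin_le_nhds (htend.eventually hhyp), self_mem_nhdsWithin] with t h1 h2
  exact h1 (le_of_lt h2)

theorem IsTimeFactorization.alpha_eq_zero {d : ℕ} {a : ℝ × Eucl d × Eucl d → ℝ}
    {X₀ : Eucl d × Eucl d} {e : ℝ × Eucl d × Eucl d → ℝ} {α : Eucl d × Eucl d → ℝ}
    (h : IsTimeFactorization a X₀ e α) (ha0 : a (0, X₀) = 0) : α X₀ = 0 := by
  obtain ⟨h1, h2⟩ := h.2.2.self_of_nhds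
  rw [ha0] at h2
  have := (mul_eq_zero.1 h2.symm).resolve_left h1.ne'
  simpa using this

theorem smoothNear_perturbedDiscriminant {d : ℕ} {b e : ℝ × Eucl d × Eucl d → ℝ}
    {α : Eucl d × Eucl d → ℝ} {X₀ : Eucl d × Eucl d} (hb : SmoothNear b (0, X₀))
    (he : SmoothNear e (0, X₀)) (hα : SmoothNear α X₀) :
    ∀ᶠ z in 𝓝 ((0 : ℝ), X₀, (0 : ℝ)), ContDiffAt ℝ ∞
      (fun z : ℝ × (Eucl d × Eucl d) × ℝ => perturbedDiscriminant b e α z.1 z.2.1 z.2.2) z := by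
  have t1 : Tendsto (fun z : ℝ × (Eucl d × Eucl d) × ℝ => (z.1, z.2.1)) (𝓝 (0, X₀, 0)) (𝓝 (0, X₀)) :=
    (continuous_fst.prodMk continuous_snd.fst).tendsto _
  have t2 : Tendsto (fun z : ℝ × (Eucl d × Eucl d) × ℝ => z.2.1) (𝓝 (0, X₀, 0)) (𝓝 X₀) :=
    continuous_snd.fst.tendsto _
  filter_upwards [t1.eventually hb, t1.eventually he, t2.eventually hα] with z z1 z2 z3
  have c0 : ContDiffAt ℝ ∞ (fun z : ℝ × (Eucl d × Eucl d) × ℝ => (z.1, z.2.1)) z :=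
    contDiffAt_fst.prodMk contDiffAt_snd.fst
  have c1 : ContDiffAt ℝ ∞ (fun z : ℝ × (Eucl d × Eucl d) × ℝ => b (z.1, z.2.1)) z := z1.comp z c0
  have c2 : ContDiffAt ℝ ∞ (fun z : ℝ × (Eucl d × Eucl d) × ℝ => e (z.1, z.2.1)) z := z2.comp z c0
  have c3 : ContDiffAt ℝ ∞ (fun z : ℝ × (Eucl d × Eucl d) × ℝ => α z.2.1) z :=
    z3.comp z contDiffAt_snd.fst
  have c4 : ContDiffAt ℝ ∞ (fun z : ℝ × (Eucl d × Eucl d) × ℝ => z.2.2) z := contDiffAt_snd.snd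
  exact (contDiffAt_const.mul ((c2.mul (contDiffAt_fst.add (c3.add (c4.pow 2)))).pow 3)).sub
    (contDiffAt_const.mul (c1.pow 2))

/-- Since `α(X₀) = 0`, the perturbed discriminant at `(X₀, 0)` is `4 a³ - 27 b²`, with leading term
`4 (∂ₜa)³ t³`. -/
theorem exists_isCubicNormalization {d : ℕ} {a b e : ℝ × Eucl d × Eucl d → ℝ}
    {α : Eucl d × Eucl d → ℝ} {X₀ : Eucl d × Eucl d} (ha : SmoothNear a (0, X₀))
    (hb : SmoothNear b (0, X₀)) (ha0 : a (0, X₀) = 0) (hb0 : b (0, X₀) = 0)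
    (hpos : 0 < fderiv ℝ a (0, X₀) (1, 0)) (hbd : fderiv ℝ b (0, X₀) (1, 0) = 0)
    (h : IsTimeFactorization a X₀ e α) :
    ∃ (e' : ℝ × (Eucl d × Eucl d) × ℝ → ℝ) (a₁ a₂ a₃ : (Eucl d × Eucl d) × ℝ → ℝ),
      IsCubicNormalization (perturbedDiscriminant b e α) X₀ e' a₁ a₂ a₃ := by
  have hα0 := h.alpha_eq_zero ha0
  have hc : 0 < 4 * fderiv ℝ a (0, X₀) (1, 0) ^ 3 := by positivity
  have hF0 : perturbedDiscriminant b e α 0 X₀ 0 = 0 := by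
    simp [perturbedDiscriminant, rho, hα0, hb0]
  have hline : ∀ᶠ t in 𝓝 (0 : ℝ), perturbedDiscriminant b e α t X₀ 0 =
      4 * a (t, X₀) ^ 3 - 27 * b (t, X₀) ^ 2 := by
    have htend : Tendsto (fun s : ℝ => (s, X₀)) (𝓝 0) (𝓝 (0, X₀)) :=
      (continuous_id.prodMk continuous_const).tendsto 0
    filter_upwards [htend.eventually h.2.2] with t ht
    rw [ht.2]
    simp [perturbedDiscriminant, rho]
  have hbl := hasDerivAt_prodMk_right (hb.self_of_nhds.differentiableAt (by simp))
  rw [hbd] at hbl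
  have hlim := tendsto_deriv_discriminant ha.comp_prodMk_right hb.comp_prodMk_right
    (hasDerivAt_prodMk_right (ha.self_of_nhds.differentiableAt (by simp)))
    hbl ha0 hb0
  have hlim' : Tendsto (fun t => deriv (fun t => perturbedDiscriminant b e α t X₀ 0) t / t ^ 2)
      (𝓝[≠] 0) (𝓝 (3 * (4 * fderiv ℝ a (0, X₀) (1, 0) ^ 3))) := by
    refine hlim.congr' ?_
    filter_upwards [nhdsWithin_le_nhds hline.eventually_nhds] with t ht
    rw [EventuallyEq.deriv_eq ht]
  obtain ⟨e', a₁, a₂, a₃, s0, s1, s2, s3, z1, z2, z3, hfac⟩ := exists_cubic_preparation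
    (F := fun z : ℝ × (Eucl d × Eucl d) × ℝ => perturbedDiscriminant b e α z.1 z.2.1 z.2.2)
    (y₀ := (X₀, (0 : ℝ))) (smoothNear_perturbedDiscriminant hb h.1 h.2.1) hc hF0 hlim'
  exact ⟨e', a₁, a₂, a₃, s0, s1, s2, s3, z1, z2, z3, hfac⟩

/-! ### Elementary inequalities for real cubics. -/

theorem cubic_sInf_pos {a₁ a₂ a₃ : ℝ} (h0 : 0 < a₃) :
    sInf {t : ℝ | 0 < t ^ 3 + a₁ * t ^ 2 + a₂ * t + a₃} ≤ 0 ∧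
      (sInf {t : ℝ | 0 < t ^ 3 + a₁ * t ^ 2 + a₂ * t + a₃}) ^ 3 +
        a₁ * (sInf {t : ℝ | 0 < t ^ 3 + a₁ * t ^ 2 + a₂ * t + a₃}) ^ 2 +
        a₂ * (sInf {t : ℝ | 0 < t ^ 3 + a₁ * t ^ 2 + a₂ * t + a₃}) + a₃ = 0 := by
  set f : ℝ → ℝ := fun t => t ^ 3 + a₁ * t ^ 2 + a₂ * t + a₃ with hf
  set S : Set ℝ := {t : ℝ | 0 < t ^ 3 + a₁ * t ^ 2 + a₂ * t + a₃} with hS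
  have hfc : Continuous f := by fun_prop
  have hmem : (0 : ℝ) ∈ S := by simpa [hS] using h0
  have hbdd : BddBelow S := by
    -- Cauchy's root bound: to the left of this point the leading term dominates and the cubic is
    -- not positive.
    refine ⟨-(1 + |a₁| + |a₂| + |a₃|), fun t ht => ?_⟩
    by_contra! hlt
    set M := 1 + |a₁| + |a₂| + |a₃| with hM
    have hr : M < -t := by linarith
    have p1 := abs_nonneg a₁
    have p2 := abs_nonneg a₂
    have p3 := abs_nonneg a₃
    set r := -t with hrdef
    have hr1 : 1 ≤ r := by linarith
    have ht' : t = -r := by simp [hrdef]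
    have ht2 : 0 < t ^ 3 + a₁ * t ^ 2 + a₂ * t + a₃ := ht
    rw [ht'] at ht2
    have hr2 : r ≤ r ^ 2 := by nlinarith
    have hr3 : 1 ≤ r ^ 2 := by nlinarith
    have e1 : a₁ * r ^ 2 ≤ |a₁| * r ^ 2 := mul_le_mul_of_nonneg_right (le_abs_self _) (by positivity)
    have e2 : -a₂ * r ≤ |a₂| * r ^ 2 :=
      mul_le_mul (neg_le_abs _) hr2 (by linarith) p2
    have e3 : a₃ ≤ |a₃| * r ^ 2 := (le_abs_self _).trans (le_mul_of_one_le_right p3 hr3)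
    have e4 : M * r ^ 2 ≤ r * r ^ 2 := mul_le_mul_of_nonneg_right hr.le (by positivity)
    nlinarith
  have hopen : IsOpen S := isOpen_lt continuous_const hfc
  refine ⟨csInf_le hbdd hmem, le_antisymm ?_ ?_⟩
  -- An open set bounded below does not contain its infimum, so the value there cannot be positive;
  -- as a point of the closure it has value at least zero.
  · by_contra! hpos
    obtain ⟨l, u, hlu, hsub⟩ := mem_nhds_iff_exists_Ioo_subset.1 (hopen.mem_nhds hpos)
    obtain ⟨y, hy1, hy2⟩ := exists_between hlu.1
    exact absurd (csInf_le hbdd (hsub ⟨hy1, hy2.trans hlu.2⟩)) (not_le.2 hy2)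
  · have hcl := csInf_mem_closure ⟨0, hmem⟩ hbdd
    have : closure S ⊆ {t | 0 ≤ f t} :=
      closure_minimal (fun t (ht : 0 < f t) => ht.le) (isClosed_le continuous_const hfc)
    exact this hcl

/-- A cubic `(t + n) (t² - 2 s t + c)` without small coefficients is bounded below on `[0, ∞)`. -/
theorem cubic_lower_bound {a₁ a₂ a₃ ν ρ ψ : ℝ} (hρ : 0 < ρ)
    (hroot : ν ^ 3 + a₁ * ν ^ 2 + a₂ * ν + a₃ = 0) (hν : ν ≤ 0)
    (hpos : ∀ t, 0 ≤ t → 0 < t ^ 3 + a₁ * t ^ 2 + a₂ * t + a₃)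
    (hψ1 : ν + a₁ ≤ 0 → ψ = -((ν + a₁) / 2))
    (hbig : ¬ (|a₁| ≤ ρ / 4 + ρ / 32 ∧ |a₂| ≤ ρ ^ 2 / 50 ∧ 0 < a₃ ∧ a₃ ≤ ρ ^ 3 / 1000))
    {t : ℝ} (ht : 0 ≤ t) :
    (1 / 32) * min (t ^ 2) ((t - ψ) ^ 2) * (t + ρ) ≤ t ^ 3 + a₁ * t ^ 2 + a₂ * t + a₃ := by
  -- The cubic is `(t + n)(t² - 2 s t + c)` with `n = -ν`; the vertex `s = -(ν + a₁)/2` equals `ψ`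
  -- when `s ≥ 0`.
  obtain ⟨n, rfl⟩ : ∃ n, ν = -n := ⟨-ν, by ring⟩
  obtain ⟨s, rfl⟩ : ∃ s, a₁ = n - 2 * s := ⟨(n - a₁) / 2, by ring⟩
  obtain ⟨c, rfl⟩ : ∃ c, a₂ = c - 2 * s * n := ⟨a₂ + 2 * s * n, by ring⟩
  have h3 : a₃ = n * c := by linear_combination hroot
  subst h3
  have hfac : ∀ t : ℝ, t ^ 3 + (n - 2 * s) * t ^ 2 + (c - 2 * s * n) * t + n * c =
      (t + n) * (t ^ 2 - 2 * s * t + c) := fun t => by ring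
  simp only [hfac] at hpos ⊢
  have hn : 0 < n := by
    rcases (by linarith : 0 ≤ n).eq_or_lt with h | h
    · have := hpos 0 le_rfl
      rw [← h] at this
      simp at this
    · exact h
  have hq : ∀ t, 0 ≤ t → 0 < t ^ 2 - 2 * s * t + c := fun t ht =>
    pos_of_mul_pos_right (hpos t ht) (by linarith)
  have hc : 0 < c := by simpa using hq 0 le_rfl
  have hm1 : min (t ^ 2) ((t - ψ) ^ 2) ≤ t ^ 2 := min_le_left _ _
  have hm0 : 0 ≤ min (t ^ 2) ((t - ψ) ^ 2) := le_min (sq_nonneg _) (sq_nonneg _)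
  rcases lt_or_ge s 0 with hs | hs
  -- For `s < 0` no term is negative on `t ≥ 0` and the bound by `t²` suffices, whatever `ψ` is. It
  -- can fail only if `n`, `-2 s` and `c` are all small relative to `ρ`, which is the excluded case.
  · have hst : 0 ≤ -s * t := mul_nonneg (by linarith) ht
    suffices h : (1 / 32) * t ^ 2 * (t + ρ) ≤ (t + n) * (t ^ 2 - 2 * s * t + c) by
      refine le_trans ?_ h
      gcongr
    rcases le_or_gt (ρ / 32) n with h1 | h1
    · calc (1 / 32) * t ^ 2 * (t + ρ) = (t / 32 + ρ / 32) * t ^ 2 := by ring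
        _ ≤ (t + n) * (t ^ 2 - 2 * s * t + c) := by gcongr <;> linarith
    rcases le_or_gt (ρ / 32) (-2 * s) with h2 | h2
    · have : ρ / 32 * t ≤ -2 * s * t := by gcongr
      calc (1 / 32) * t ^ 2 * (t + ρ) = t * (t ^ 2 / 32 + ρ / 32 * t) := by ring
        _ ≤ (t + n) * (t ^ 2 - 2 * s * t + c) := by
          refine mul_le_mul (by linarith) ?_ (by positivity) (by linarith)
          nlinarith [sq_nonneg t]
    rcases le_or_gt (ρ ^ 2 / 900) c with h3 | h3
    · calc (1 / 32) * t ^ 2 * (t + ρ) = t * (t ^ 2 / 32 + ρ / 32 * t) := by ring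
        _ ≤ (t + n) * (t ^ 2 - 2 * s * t + c) := by
          refine mul_le_mul (by linarith) ?_ (by positivity) (by linarith)
          nlinarith [sq_nonneg (t - ρ / 32), sq_nonneg t, sq_nonneg ρ]
    · refine absurd ⟨?_, ?_, by positivity, ?_⟩ hbig
      · rw [abs_le]; constructor <;> linarith
      · have : -2 * s * n ≤ ρ / 32 * (ρ / 32) := by gcongr
        have h0 : 0 ≤ -2 * s * n := mul_nonneg (by linarith) hn.le
        rw [abs_le]; constructor <;> nlinarith [sq_nonneg ρ]
      · calc n * c ≤ ρ / 32 * (ρ ^ 2 / 900) := by gcongr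
          _ ≤ ρ ^ 3 / 1000 := by nlinarith [pow_pos hρ 3]
  · have hψ : ψ = s := by rw [hψ1 (by linarith)]; ring
    subst hψ
    have hm2 : min (t ^ 2) ((t - ψ) ^ 2) ≤ (t - ψ) ^ 2 := min_le_right _ _
    obtain ⟨κ, rfl⟩ : ∃ κ, c = ψ ^ 2 + κ := ⟨c - ψ ^ 2, by ring⟩
    have hκ : 0 < κ := by have := hq ψ hs; nlinarith
    have hqe : t ^ 2 - 2 * ψ * t + (ψ ^ 2 + κ) = (t - ψ) ^ 2 + κ := by ring
    rw [hqe]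
    set m := min (t ^ 2) ((t - ψ) ^ 2) with hm
    have hsimple : (t + ρ) / 32 ≤ t + n → 1 / 32 * m * (t + ρ) ≤ (t + n) * ((t - ψ) ^ 2 + κ) := by
      intro h
      calc 1 / 32 * m * (t + ρ) = (t + ρ) / 32 * m := by ring
        _ ≤ (t + n) * ((t - ψ) ^ 2 + κ) := by gcongr; linarith
    rcases le_or_gt (ρ / 32) n with h1 | h1
    · exact hsimple (by linarith)
    -- `ρ ≤ 31 t` is equivalent to `(t + ρ) / 32 ≤ t`.
    rcases le_or_gt (ρ / 31) t with h2 | h2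
    · exact hsimple (by linarith)
    -- For `t < ρ / 31` one has `t (t + ρ) / 32 ≤ ρ² / 961`, so a quadratic factor of at least `ρ² /
    -- 900` suffices.
    have hquad : ρ ^ 2 / 900 ≤ (t - ψ) ^ 2 + κ → 1 / 32 * m * (t + ρ) ≤ (t + n) * ((t - ψ) ^ 2 + κ) := by
      intro h
      have e1 : t * (t + ρ) ≤ ρ / 31 * (ρ / 31 + ρ) := by gcongr
      calc 1 / 32 * m * (t + ρ) ≤ 1 / 32 * t ^ 2 * (t + ρ) := by gcongr
        _ = t * (t * (t + ρ) / 32) := by ring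
        _ ≤ (t + n) * ((t - ψ) ^ 2 + κ) := by
          gcongr
          · linarith
          · nlinarith [sq_nonneg ρ]
    rcases le_or_gt (ρ / 8) ψ with h3 | h3
    · refine hquad ?_
      have : (ρ / 30) ^ 2 ≤ (ψ - t) ^ 2 := by gcongr; linarith
      nlinarith
    rcases le_or_gt (ρ ^ 2 / 900) κ with h4 | h4
    · exact hquad (by nlinarith [sq_nonneg (t - ψ)])
    · have e1 : ψ ^ 2 ≤ (ρ / 8) ^ 2 := by gcongr
      refine absurd ⟨?_, ?_, by positivity, ?_⟩ hbig
      · rw [abs_le]; constructor <;> linarith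
      · have e2 : 2 * ψ * n ≤ 2 * (ρ / 8) * (ρ / 32) := by gcongr
        have e3 : 0 ≤ 2 * ψ * n := by positivity
        rw [abs_le]; constructor <;> nlinarith [sq_nonneg ρ]
      · calc n * (ψ ^ 2 + κ) ≤ ρ / 32 * ((ρ / 8) ^ 2 + ρ ^ 2 / 900) := by gcongr
          _ ≤ ρ ^ 3 / 1000 := by nlinarith [pow_pos hρ 3]

/-- The values `±1, 0` of a cubic with small coefficients are incompatible with a square whose
root has a small second difference. -/
theorem small_cubic_contradiction {A₁ A₂ A₃ E₀ E₁ E₂ G₀ G₁ B₀ B₁ B₂ : ℝ}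
    (hA₁ : |A₁| ≤ 1 / 4 + 1 / 32) (hA₂ : |A₂| ≤ 1 / 50) (hA₃ : 0 < A₃) (hA₃' : A₃ ≤ 1 / 1000)
    (hE₀ : |E₀ - 1| ≤ 1 / 1000) (hE₁ : |E₁ - 1| ≤ 1 / 1000) (hE₂ : |E₂ - 1| ≤ 1 / 1000)
    (hG₀ : |G₀ - 1| ≤ 1 / 1000) (hG₁ : |G₁ - 1| ≤ 1 / 1000)
    (h₀ : E₀ * A₃ = G₀ - B₀ ^ 2) (h₁ : E₁ * (1 + A₁ + A₂ + A₃) = 8 * G₁ - B₁ ^ 2)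
    (h₂ : E₂ * (-1 + A₁ - A₂ + A₃) = -B₂ ^ 2) (hD : |B₁ + B₂ - 2 * B₀| ≤ 1 / 1000) : False := by
  obtain ⟨D, hDe⟩ : ∃ D, D = B₁ + B₂ - 2 * B₀ := ⟨_, rfl⟩
  rw [← hDe] at hD
  rw [abs_le] at hA₁ hA₂ hG₀ hG₁
  have hR : |B₀ ^ 2 - 1| ≤ 1 / 200 := by
    have : |(E₀ - 1) * A₃| ≤ 1 / 1000 * 1 := by
      rw [abs_mul, abs_of_pos hA₃]
      gcongr
      linarith
    rw [abs_le] at this ⊢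
    constructor <;> linarith
  rw [abs_le] at hR
  have hB0 : |B₀| ≤ 2 := abs_le_of_sq_le_sq (by linarith) (by norm_num)
  -- Without errors the squares would be `B₀² = 1`, `B₁² = 7 - A₁`, `B₂² = 1 - A₁`, and `B₁ + B₂ = 2
  -- B₀` would give `B₁ B₂ = A₁ - 2`. Equating `(B₁ B₂)²` with `B₁² B₂²` leaves `3 - 4 A₁ = 0`,
  -- incompatible with `|A₁| ≤ 9/32`. The errors `p`, `q`, `r` are too small to repair this.
  obtain ⟨p, hp⟩ : ∃ p, B₁ ^ 2 = 7 - A₁ + p := ⟨B₁ ^ 2 - (7 - A₁), by ring⟩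
  obtain ⟨q, hq⟩ : ∃ q, B₂ ^ 2 = 1 - A₁ + q := ⟨B₂ ^ 2 - (1 - A₁), by ring⟩
  have hpb : |p| ≤ 1 / 20 := by
    have : |(E₁ - 1) * (1 + A₁ + A₂ + A₃)| ≤ 1 / 1000 * 2 := by
      rw [abs_mul]
      refine mul_le_mul hE₁ ?_ (abs_nonneg _) (by norm_num)
      rw [abs_le]; constructor <;> linarith
    rw [abs_le] at this ⊢
    constructor <;> linarith
  have hqb : |q| ≤ 1 / 20 := by
    have : |(E₂ - 1) * (-1 + A₁ - A₂ + A₃)| ≤ 1 / 1000 * 2 := by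
      rw [abs_mul]
      refine mul_le_mul hE₂ ?_ (abs_nonneg _) (by norm_num)
      rw [abs_le]; constructor <;> linarith
    rw [abs_le] at this ⊢
    constructor <;> linarith
  have hDb : |4 * B₀ * D + D ^ 2| ≤ 1 / 100 := by
    have e1 : |B₀ * D| ≤ 2 * (1 / 1000) := by
      rw [abs_mul]; exact mul_le_mul hB0 hD (abs_nonneg _) (by norm_num)
    have e2 : D ^ 2 ≤ (1 / 1000) ^ 2 := sq_le_sq.2 (hD.trans (le_abs_self _))
    rw [abs_le] at e1 ⊢
    constructor <;> linarith [sq_nonneg D]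
  obtain ⟨r, hr⟩ : ∃ r, B₁ * B₂ = -2 + A₁ + r := ⟨B₁ * B₂ - (-2 + A₁), by ring⟩
  have hrr : 2 * r = 4 * (B₀ ^ 2 - 1) + (4 * B₀ * D + D ^ 2) - p - q := by
    rw [hDe]; linear_combination -hp - hq - 2 * hr
  have hrb : |r| ≤ 1 / 10 := by
    rw [abs_le] at hpb hqb hDb ⊢
    constructor <;> linarith
  have key : (7 - A₁ + p) * (1 - A₁ + q) = (-2 + A₁ + r) ^ 2 := by
    rw [← hp, ← hq, ← hr]; ring
  have prod : ∀ {x y u v : ℝ}, |x| ≤ u → |y| ≤ v → -(u * v) ≤ x * y ∧ x * y ≤ u * v := fun hx hy => by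
    rw [← abs_le, abs_mul]
    exact mul_le_mul hx hy (abs_nonneg _) ((abs_nonneg _).trans hx)
  have f1 := prod hpb (show |1 - A₁| ≤ 2 by rw [abs_le]; constructor <;> linarith)
  have f2 := prod hqb (show |7 - A₁| ≤ 8 by rw [abs_le]; constructor <;> linarith)
  have f3 := prod hpb hqb
  have f4 := prod hrb (show |A₁ - 2| ≤ 5 / 2 by rw [abs_le]; constructor <;> linarith)
  have f5 := prod hrb hrb
  have f6 : (7 - A₁ + p) * (1 - A₁ + q) - (-2 + A₁ + r) ^ 2 = 3 - 4 * A₁ + p * (1 - A₁) +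
      q * (7 - A₁) + p * q - 2 * (r * (A₁ - 2)) - r * r := by ring
  rw [key, sub_self] at f6
  linarith

/-- The previous contradiction after scaling time by `ρ`, the discriminant by `E ρ³` and `b` by
`√(27 / (E ρ³))`. The factors `1`, `8` and `0` in front of `ρ³` are `(t + ρ)³ / ρ³` at `t = 0, ρ,
-ρ`. -/
theorem not_small_coefficients {a₁ a₂ a₃ ρ E e₀ e₁ e₂ g₀ g₁ b₀ b₁ b₂ : ℝ} (hρ : 0 < ρ) (hE : 0 < E)
    (he₀ : |e₀ - E| ≤ E / 1000) (he₁ : |e₁ - E| ≤ E / 1000) (he₂ : |e₂ - E| ≤ E / 1000)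
    (hg₀ : |g₀ - E| ≤ E / 1000) (hg₁ : |g₁ - E| ≤ E / 1000)
    (h₀ : e₀ * a₃ = g₀ * ρ ^ 3 - 27 * b₀ ^ 2)
    (h₁ : e₁ * (ρ ^ 3 + a₁ * ρ ^ 2 + a₂ * ρ + a₃) = 8 * g₁ * ρ ^ 3 - 27 * b₁ ^ 2)
    (h₂ : e₂ * (-ρ ^ 3 + a₁ * ρ ^ 2 - a₂ * ρ + a₃) = -(27 * b₂ ^ 2))
    (hD : 27 * (b₁ + b₂ - 2 * b₀) ^ 2 ≤ E * ρ ^ 3 * (1 / 1000) ^ 2) :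
    ¬ (|a₁| ≤ ρ / 4 + ρ / 32 ∧ |a₂| ≤ ρ ^ 2 / 50 ∧ 0 < a₃ ∧ a₃ ≤ ρ ^ 3 / 1000) := by
  rintro ⟨s1, s2, s3, s4⟩
  set k := √(27 / (E * ρ ^ 3)) with hk
  have hk2 : k ^ 2 = 27 / (E * ρ ^ 3) := Real.sq_sqrt (by positivity)
  have hratio : ∀ {x : ℝ}, |x - E| ≤ E / 1000 → |x / E - 1| ≤ 1 / 1000 := fun {x} hx => by
    have : x / E - 1 = (x - E) / E := by field_simp
    rw [this, abs_div, abs_of_pos hE, div_le_iff₀ hE]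
    linarith
  refine small_cubic_contradiction (A₁ := a₁ / ρ) (A₂ := a₂ / ρ ^ 2) (A₃ := a₃ / ρ ^ 3)
    (E₀ := e₀ / E) (E₁ := e₁ / E) (E₂ := e₂ / E) (G₀ := g₀ / E) (G₁ := g₁ / E)
    (B₀ := k * b₀) (B₁ := k * b₁) (B₂ := k * b₂) ?_ ?_ (by positivity) ?_ (hratio he₀) (hratio he₁)
    (hratio he₂) (hratio hg₀) (hratio hg₁) ?_ ?_ ?_ ?_
  · rw [abs_div, abs_of_pos hρ, div_le_iff₀ hρ]; linarith
  · rw [abs_div, abs_of_pos (pow_pos hρ 2), div_le_iff₀ (pow_pos hρ 2)]; linarith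
  · rw [div_le_iff₀ (pow_pos hρ 3)]; linarith
  · rw [mul_pow, hk2]; field_simp; linear_combination h₀
  · rw [mul_pow, hk2]; field_simp; linear_combination h₁
  · rw [mul_pow, hk2]; field_simp; linear_combination h₂
  · refine abs_le_of_sq_le_sq ?_ (by norm_num)
    have : (k * b₁ + k * b₂ - 2 * (k * b₀)) ^ 2 = 27 * (b₁ + b₂ - 2 * b₀) ^ 2 / (E * ρ ^ 3) := by
      rw [show k * b₁ + k * b₂ - 2 * (k * b₀) = k * (b₁ + b₂ - 2 * b₀) by ring, mul_pow, hk2]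
      ring
    rw [this, div_le_iff₀ (by positivity)]
    linarith

/-! ### The prepared discriminant near the base point. -/

/-- On the time axis `b = O(t²)`, so `b²` is negligible against `t³` and the cubic coefficients on
both sides agree. Thus `e'` and `4 e³` share one reference constant in the scaling argument. -/
theorem IsCubicNormalization.apply_base {d : ℕ} {b e : ℝ × Eucl d × Eucl d → ℝ}
    {α : Eucl d × Eucl d → ℝ} {X₀ : Eucl d × Eucl d}
    {e' : ℝ × (Eucl d × Eucl d) × ℝ → ℝ} {a₁ a₂ a₃ : (Eucl d × Eucl d) × ℝ → ℝ}
    (hb : SmoothNear b (0, X₀)) (hb0 : b (0, X₀) = 0) (hbd : fderiv ℝ b (0, X₀) (1, 0) = 0)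
    (he : SmoothNear e (0, X₀)) (hα0 : α X₀ = 0)
    (h : IsCubicNormalization (perturbedDiscriminant b e α) X₀ e' a₁ a₂ a₃) :
    e' (0, X₀, 0) = 4 * e (0, X₀) ^ 3 := by
  obtain ⟨hs, -, -, -, z1, z2, z3, hfac⟩ := h
  obtain ⟨K, hK, s, hs', hT⟩ := hb.exists_taylor_bound
  have t1 : Tendsto (fun t : ℝ => (t, X₀)) (𝓝 0) (𝓝 (0, X₀)) :=
    (continuous_id.prodMk continuous_const).tendsto 0
  have t2 : Tendsto (fun t : ℝ => (t, X₀, (0 : ℝ))) (𝓝 0) (𝓝 (0, X₀, 0)) :=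
    (continuous_id.prodMk continuous_const).tendsto 0
  have l1 := (hs.self_of_nhds.continuousAt.tendsto.comp t2).mono_left
    (nhdsWithin_le_nhds (s := Ioi (0 : ℝ)))
  have l2 := (he.self_of_nhds.continuousAt.tendsto.comp t1).mono_left
    (nhdsWithin_le_nhds (s := Ioi (0 : ℝ)))
  have l3 := (l1.sub ((l2.pow 3).const_mul 4)).abs
  have l4 : Tendsto (fun t : ℝ => 27 * K ^ 2 * t) (𝓝[>] 0) (𝓝 (27 * K ^ 2 * 0)) :=
    Tendsto.mono_left (Continuous.tendsto (by fun_prop) 0) nhdsWithin_le_nhds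
  rw [mul_zero] at l4
  have hle := le_of_tendsto_of_tendsto l3 l4 (by
    filter_upwards [nhdsWithin_le_nhds (t1.eventually hs'), nhdsWithin_le_nhds (t2.eventually hfac),
      self_mem_nhdsWithin] with t m1 m2 m3
    have ht : (0 : ℝ) < t := m3
    have hbt : |b (t, X₀)| ≤ K * t ^ 2 := by
      have := hT _ (mem_of_mem_nhds hs') _ m1
      have hv : (t, X₀) - ((0 : ℝ), X₀) = t • ((1 : ℝ), (0 : Eucl d × Eucl d)) := by
        ext <;> simp
      rw [hv, map_smul, hbd, hb0, norm_smul] at this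
      simpa using this
    have heq : e' (t, X₀, 0) * t ^ 3 = 4 * e (t, X₀) ^ 3 * t ^ 3 - 27 * b (t, X₀) ^ 2 := by
      have := m2.2
      simp only [perturbedDiscriminant, normalizedDiscriminant, rho, hα0, z1, z2, z3] at this
      linear_combination -this
    have hb2 : b (t, X₀) ^ 2 ≤ (K * t ^ 2) ^ 2 := by
      rw [← sq_abs]; gcongr
    have habs : |e' (t, X₀, 0) - 4 * e (t, X₀) ^ 3| * t ^ 3 ≤ 27 * K ^ 2 * t * t ^ 3 := by
      rw [← abs_of_pos (pow_pos ht 3), ← abs_mul, abs_of_pos (pow_pos ht 3),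
        show (e' (t, X₀, 0) - 4 * e (t, X₀) ^ 3) * t ^ 3 = -(27 * b (t, X₀) ^ 2) by
          linear_combination heq, abs_neg, abs_of_nonneg (by positivity)]
      linarith
    exact le_of_mul_le_mul_right habs (pow_pos ht 3))
  exact sub_eq_zero.1 (abs_nonpos_iff.1 hle)

/-- `a(0, X) ≥ 0` gives `α ≥ 0`. Adding `ε²` to `α` then strictly increases `a³` while `b` is
unchanged, so the non-negative discriminant becomes positive. -/
theorem eventually_normalizedDiscriminant_pos {d : ℕ} {a b e : ℝ × Eucl d × Eucl d → ℝ}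
    {α : Eucl d × Eucl d → ℝ} {X₀ : Eucl d × Eucl d}
    {e' : ℝ × (Eucl d × Eucl d) × ℝ → ℝ} {a₁ a₂ a₃ : (Eucl d × Eucl d) × ℝ → ℝ}
    (hhyp : ∀ᶠ z in 𝓝 ((0 : ℝ), X₀), 0 ≤ z.1 → 27 * b z ^ 2 ≤ 4 * a z ^ 3)
    (hfac : IsTimeFactorization a X₀ e α)
    (h : IsCubicNormalization (perturbedDiscriminant b e α) X₀ e' a₁ a₂ a₃) :
    ∀ᶠ p in 𝓝 (X₀, (0 : ℝ)), p.2 ≠ 0 → 0 < rho α p.1 p.2 ∧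
      ∀ t, 0 ≤ t → 0 < normalizedDiscriminant a₁ a₂ a₃ t p.1 p.2 := by
  obtain ⟨-, s1, s2, s3, z1, z2, z3, hn⟩ := h
  have t1 : Tendsto (fun z : ℝ × (Eucl d × Eucl d) × ℝ => (z.1, z.2.1)) (𝓝 (0, X₀, 0)) (𝓝 (0, X₀)) :=
    (continuous_fst.prodMk continuous_snd.fst).tendsto _
  have t2 : Tendsto (fun p : (Eucl d × Eucl d) × ℝ => ((0 : ℝ), p.1)) (𝓝 (X₀, 0)) (𝓝 (0, X₀)) :=
    (continuous_const.prodMk continuous_fst).tendsto _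
  have hα : ∀ᶠ p in 𝓝 (X₀, (0 : ℝ)), 0 ≤ α p.1 := by
    filter_upwards [t2.eventually hhyp, t2.eventually hfac.2.2] with p h1 h2
    have h3 := nonneg_of_discriminant (h1 le_rfl)
    rw [h2.2, zero_add] at h3
    exact nonneg_of_mul_nonneg_right h3 h2.1
  have hnear : ∀ᶠ z in 𝓝 ((0 : ℝ), X₀, (0 : ℝ)), 0 ≤ z.1 → 0 ≤ α z.2.1 → z.2.2 ≠ 0 →
      0 < normalizedDiscriminant a₁ a₂ a₃ z.1 z.2.1 z.2.2 := by
    filter_upwards [t1.eventually hhyp, t1.eventually hfac.2.2, hn] with z h1 h2 h3 ht hαz hε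
    have hε2 : 0 < z.2.2 ^ 2 := by positivity
    have h4 : perturbedDiscriminant b e α z.1 z.2.1 z.2.2 > 0 := by
      have h5 := h1 ht
      rw [h2.2] at h5
      have h6 : (e (z.1, z.2.1) * (z.1 + α z.2.1)) ^ 3 <
          (e (z.1, z.2.1) * (z.1 + rho α z.2.1 z.2.2)) ^ 3 := by
        have h7 := h2.1
        refine pow_lt_pow_left₀ ?_ (mul_nonneg h7.le (add_nonneg ht hαz)) (by norm_num)
        refine mul_lt_mul_of_pos_left ?_ h7
        simp only [rho]
        linarith
      simp only [perturbedDiscriminant]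
      linarith
    rw [h3.2] at h4
    exact pos_of_mul_pos_right h4 h3.1.le
  rw [nhds_prod_eq, eventually_prod_iff] at hnear
  obtain ⟨P, hP, Q, hQ, hPQ⟩ := hnear
  obtain ⟨t₀, ht₀, hball⟩ := Metric.eventually_nhds_iff.1 hP
  have hsmall : ∀ {f : (Eucl d × Eucl d) × ℝ → ℝ} {c : ℝ}, SmoothNear f (X₀, 0) → f (X₀, 0) = 0 →
      0 < c → ∀ᶠ p in 𝓝 (X₀, (0 : ℝ)), -c < f p := fun hf hf0 hc =>
    hf.self_of_nhds.continuousAt.eventually (lt_mem_nhds (by rw [hf0]; linarith))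
  filter_upwards [hα, hQ, hsmall s1 z1 (show 0 < t₀ / 4 by positivity),
    hsmall s2 z2 (show 0 < t₀ ^ 2 / 4 by positivity),
    hsmall s3 z3 (show 0 < t₀ ^ 3 / 4 by positivity)] with p p1 p2 p3 p4 p5 hε
  have hε2 : 0 < p.2 ^ 2 := by positivity
  refine ⟨by simp only [rho]; linarith, fun t ht => ?_⟩
  rcases lt_or_ge t t₀ with hlt | hge
  · exact hPQ (x := t) (hball (by rwa [Real.dist_eq, sub_zero, abs_of_nonneg ht])) p2 ht p1 hε
  -- Away from `t = 0` the factorization is not available, but each lower-order term is above `-t³ /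
  -- 4`, so `t³` dominates.
  · have ht' : 0 < t := ht₀.trans_le hge
    have e1 : -(t / 4) * t ^ 2 ≤ a₁ p * t ^ 2 := by gcongr; linarith
    have e2 : -(t ^ 2 / 4) * t ≤ a₂ p * t := by
      have : t₀ ^ 2 ≤ t ^ 2 := by gcongr
      gcongr; linarith
    have e3 : t₀ ^ 3 ≤ t ^ 3 := by gcongr
    have e4 : 0 < t ^ 3 := by positivity
    simp only [normalizedDiscriminant]
    linarith

/-- Taylor's formula bounds the second difference of `b` with step `ρ` by `2 K ρ²`. Its square is
`O(ρ⁴)`, hence negligible against `E ρ³` once `ρ` is small. -/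
theorem eventually_not_small_coefficients {d : ℕ} {a b e : ℝ × Eucl d × Eucl d → ℝ}
    {α : Eucl d × Eucl d → ℝ} {X₀ : Eucl d × Eucl d}
    {e' : ℝ × (Eucl d × Eucl d) × ℝ → ℝ} {a₁ a₂ a₃ : (Eucl d × Eucl d) × ℝ → ℝ}
    (hb : SmoothNear b (0, X₀)) (hb0 : b (0, X₀) = 0) (hbd : fderiv ℝ b (0, X₀) (1, 0) = 0)
    (hfac : IsTimeFactorization a X₀ e α) (hα0 : α X₀ = 0)
    (h : IsCubicNormalization (perturbedDiscriminant b e α) X₀ e' a₁ a₂ a₃) :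
    ∀ᶠ p in 𝓝 (X₀, (0 : ℝ)), 0 < rho α p.1 p.2 →
      ¬ (|a₁ p| ≤ rho α p.1 p.2 / 4 + rho α p.1 p.2 / 32 ∧ |a₂ p| ≤ rho α p.1 p.2 ^ 2 / 50 ∧
        0 < a₃ p ∧ a₃ p ≤ rho α p.1 p.2 ^ 3 / 1000) := by
  have hbase := h.apply_base hb hb0 hbd hfac.1 hα0
  obtain ⟨hs, -, -, -, -, -, -, hn⟩ := h
  set E := e' (0, X₀, 0) with hEdef
  have hE : 0 < E := hn.self_of_nhds.1
  obtain ⟨K, hK, s, hs', hT⟩ := hb.exists_taylor_bound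
  set r : (Eucl d × Eucl d) × ℝ → ℝ := fun p => rho α p.1 p.2 with hr
  have hrc : ContinuousAt r (X₀, 0) := by
    have h1 : ContinuousAt (fun p : (Eucl d × Eucl d) × ℝ => α p.1) (X₀, 0) :=
      ContinuousAt.comp (x := (X₀, (0 : ℝ))) (g := α) hfac.2.1.self_of_nhds.continuousAt continuousAt_fst
    exact h1.add (continuousAt_snd.pow 2)
  have hr0 : r (X₀, 0) = 0 := by simp [hr, rho, hα0]
  have t1 : Tendsto (fun z : ℝ × (Eucl d × Eucl d) × ℝ => (z.1, z.2.1)) (𝓝 (0, X₀, 0)) (𝓝 (0, X₀)) :=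
    (continuous_fst.prodMk continuous_snd.fst).tendsto _
  have hgood : ∀ᶠ z in 𝓝 ((0 : ℝ), X₀, (0 : ℝ)),
      (perturbedDiscriminant b e α z.1 z.2.1 z.2.2 =
        e' z * normalizedDiscriminant a₁ a₂ a₃ z.1 z.2.1 z.2.2) ∧ |e' z - E| ≤ E / 1000 ∧
      |4 * e (z.1, z.2.1) ^ 3 - E| ≤ E / 1000 ∧ (z.1, z.2.1) ∈ s := by
    have c1 := hs.self_of_nhds.continuousAt
    have c2 : ContinuousAt (fun z : ℝ × (Eucl d × Eucl d) × ℝ => 4 * e (z.1, z.2.1) ^ 3) (0, X₀, 0) :=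
      ((ContinuousAt.comp (x := ((0 : ℝ), X₀, (0 : ℝ))) (g := e)
        hfac.1.self_of_nhds.continuousAt t1).pow 3).const_mul 4
    have hE' : 0 < E / 1000 := by positivity
    have b1 := c1.eventually (Metric.closedBall_mem_nhds _ hE')
    have b2 := c2.eventually (Metric.closedBall_mem_nhds _ hE')
    filter_upwards [hn, b1, b2, t1.eventually hs'] with z m1 m2 m3 m4
    refine ⟨m1.2, m2, ?_, m4⟩
    simpa [hbase, Real.dist_eq] using m3
  have tz : Tendsto (fun p => ((0 : ℝ), p)) (𝓝 (X₀, (0 : ℝ))) (𝓝 (0, X₀, 0)) :=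
    (continuous_const.prodMk continuous_id).tendsto _
  have tp : Tendsto (fun p => (r p, p)) (𝓝 (X₀, (0 : ℝ))) (𝓝 (0, X₀, 0)) := by
    have := hrc.prodMk (continuousAt_id (x := (X₀, (0 : ℝ))))
    simpa only [ContinuousAt, hr0, id] using this
  have tm : Tendsto (fun p => (-r p, p)) (𝓝 (X₀, (0 : ℝ))) (𝓝 (0, X₀, 0)) := by
    have := hrc.neg.prodMk (continuousAt_id (x := (X₀, (0 : ℝ))))
    simpa only [ContinuousAt, Pi.neg_apply, hr0, id, neg_zero] using this
  have hrs : ∀ᶠ p in 𝓝 (X₀, (0 : ℝ)), 27 * (2 * K) ^ 2 * r p < E * (1 / 1000) ^ 2 := by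
    have c : ContinuousAt (fun p => 27 * (2 * K) ^ 2 * r p) (X₀, 0) := hrc.const_mul _
    exact c.eventually (gt_mem_nhds (by simp only [hr0, mul_zero]; positivity))
  filter_upwards [tz.eventually hgood, tp.eventually hgood, tm.eventually hgood, hrs]
    with p ⟨u1, u2, u3, u4⟩ ⟨v1, v2, v3, v4⟩ ⟨w1, w2, w3, w4⟩ hsm hρ
  change 0 < r p at hρ
  change ¬ (|a₁ p| ≤ r p / 4 + r p / 32 ∧ |a₂ p| ≤ r p ^ 2 / 50 ∧ 0 < a₃ p ∧ a₃ p ≤ r p ^ 3 / 1000)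
  simp only [perturbedDiscriminant, normalizedDiscriminant] at u1 v1 w1
  have hrp : rho α p.1 p.2 = r p := rfl
  rw [hrp] at u1 v1 w1
  refine not_small_coefficients hρ hE u2 v2 w2 u3 v3 (b₀ := b (0, p.1)) (b₁ := b (r p, p.1))
    (b₂ := b (-r p, p.1)) ?_ ?_ ?_ ?_
  · linear_combination -u1
  · linear_combination -v1
  · linear_combination -w1
  · have k1 := hT _ u4 _ v4
    have k2 := hT _ u4 _ w4
    have hv1 : (r p, p.1) - ((0 : ℝ), p.1) = r p • ((1 : ℝ), (0 : Eucl d × Eucl d)) := by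
      ext <;> simp
    have hv2 : (-r p, p.1) - ((0 : ℝ), p.1) = -r p • ((1 : ℝ), (0 : Eucl d × Eucl d)) := by
      ext <;> simp
    simp only [hv1, hv2, map_smul, norm_smul, norm_neg, smul_eq_mul] at k1 k2
    have hn1 : ‖((1 : ℝ), (0 : Eucl d × Eucl d))‖ = 1 := by simp
    rw [hn1, mul_one, Real.norm_eq_abs, sq_abs, abs_le] at k1 k2
    have k3 : |b (r p, p.1) + b (-r p, p.1) - 2 * b (0, p.1)| ≤ 2 * K * r p ^ 2 := by
      rw [abs_le]; constructor <;> linarith [k1.1, k1.2, k2.1, k2.2]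
    have k4 : (b (r p, p.1) + b (-r p, p.1) - 2 * b (0, p.1)) ^ 2 ≤ (2 * K * r p ^ 2) ^ 2 := by
      rw [← sq_abs]; gcongr
    calc 27 * (b (r p, p.1) + b (-r p, p.1) - 2 * b (0, p.1)) ^ 2 ≤ 27 * (2 * K * r p ^ 2) ^ 2 := by
          gcongr
      _ = 27 * (2 * K) ^ 2 * r p * r p ^ 3 := by ring
      _ ≤ E * (1 / 1000) ^ 2 * r p ^ 3 := by gcongr
      _ = E * r p ^ 3 * (1 / 1000) ^ 2 := by ring

/-! ### Assembly of the three assertions. -/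

theorem mainTheorem10 {d : ℕ} (T : ℝ) (hT : 0 < T)
    (U : Set (Eucl d)) (hU : U ∈ 𝓝 (0 : Eucl d))
    (a b : ℝ × Eucl d × Eucl d → ℝ)
    (ha : ∀ t ∈ Ico 0 T, ∀ x ∈ U, ∀ ξ : Eucl d, ξ ≠ 0 → SmoothNear a (t, x, ξ))
    (hb : ∀ t ∈ Ico 0 T, ∀ x ∈ U, ∀ ξ : Eucl d, ξ ≠ 0 → SmoothNear b (t, x, ξ))
    (ha_hom : HomogeneousDegreeZero a) (hb_hom : HomogeneousDegreeZero b)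
    (h_hyp : ∀ t ∈ Ico 0 T, ∀ x ∈ U, ∀ ξ : Eucl d, ξ ≠ 0 →
      0 ≤ 4 * a (t, x, ξ) ^ 3 - 27 * b (t, x, ξ) ^ 2)
    (ξ₀ : Eucl d) (hξ₀ : ‖ξ₀‖ = 1)
    (h_triple : (charPolynomial a b 0 0 ξ₀).rootMultiplicity 0 = 3)
    (h_eff : EffectivelyHyperbolic (principalSymbol a b) ((0, 0), (0, ξ₀)))
    (χ : ℝ → ℝ) (hχ : ContDiff ℝ ∞ χ) (hχ_mem : ∀ s, χ s ∈ Icc (0 : ℝ) 1)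
    (hχ_one : ∀ s ≤ 0, χ s = 1) (hχ_zero : ∀ s, 1 ≤ s → χ s = 0)
    (c₁ : ℝ) (hc₁ : 0 < c₁) :
    (∃ (e : ℝ × Eucl d × Eucl d → ℝ) (α : Eucl d × Eucl d → ℝ),
      IsTimeFactorization a (0, ξ₀) e α) ∧
    ∀ (e : ℝ × Eucl d × Eucl d → ℝ) (α : Eucl d × Eucl d → ℝ),
      IsTimeFactorization a (0, ξ₀) e α →
      (∃ (e' : ℝ × (Eucl d × Eucl d) × ℝ → ℝ) (a₁ a₂ a₃ : (Eucl d × Eucl d) × ℝ → ℝ),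
        IsCubicNormalization (perturbedDiscriminant b e α) (0, ξ₀) e' a₁ a₂ a₃) ∧
      ∀ (e' : ℝ × (Eucl d × Eucl d) × ℝ → ℝ) (a₁ a₂ a₃ : (Eucl d × Eucl d) × ℝ → ℝ),
        IsCubicNormalization (perturbedDiscriminant b e α) (0, ξ₀) e' a₁ a₂ a₃ →
        ∃ N ∈ 𝓝 (((0 : Eucl d), ξ₀), (0 : ℝ)),
          ∀ (X : Eucl d × Eucl d) (ε : ℝ), (X, ε) ∈ N → ε ≠ 0 →
            0 < rho α X ε ∧
            nuOne a₁ a₂ a₃ X ε ≤ 0 ∧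
            normalizedDiscriminant a₁ a₂ a₃ (nuOne a₁ a₂ a₃ X ε) X ε = 0 ∧
            ∀ t ∈ Icc 0 T,
              (1 / 32) * min (t ^ 2) ((t - psiFun χ c₁ α a₁ a₂ a₃ X ε) ^ 2) * (t + rho α X ε)
                ≤ normalizedDiscriminant a₁ a₂ a₃ t X ε := by
  have h0 : ((0 : ℝ) ∈ Ico 0 T) := ⟨le_rfl, hT⟩
  have hξne : ξ₀ ≠ 0 := by rintro rfl; simp at hξ₀
  have sa := ha 0 h0 0 (mem_of_mem_nhds hU) ξ₀ hξne
  have sb := hb 0 h0 0 (mem_of_mem_nhds hU) ξ₀ hξne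
  obtain ⟨ha0, hb0⟩ := coefficients_eq_zero_of_triple_root hξ₀ h_triple
  have hhyp : ∀ᶠ z in 𝓝 ((0 : ℝ), (0 : Eucl d), ξ₀), 0 ≤ z.1 → 27 * b z ^ 2 ≤ 4 * a z ^ 3 := by
    have c1 : Tendsto (fun z : ℝ × Eucl d × Eucl d => z.2.1) (𝓝 (0, 0, ξ₀)) (𝓝 0) :=
      continuous_snd.fst.tendsto _
    have c2 : ContinuousAt (fun z : ℝ × Eucl d × Eucl d => z.2.2) (0, 0, ξ₀) :=
      continuous_snd.snd.continuousAt
    filter_upwards [continuousAt_fst.eventually (gt_mem_nhds hT), c1.eventually hU,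
      c2.eventually_ne hξne] with z z1 z2 z3 z0
    exact sub_nonneg.1 (h_hyp z.1 ⟨z0, z1⟩ z.2.1 z2 z.2.2 z3)
  have hpos := time_derivative_pos hξ₀ sa sb ha0 hhyp h_eff
  have hbd := time_derivative_eq_zero_of_discriminant sa sb ha0 hb0 hhyp
  refine ⟨exists_isTimeFactorization sa ha0 hpos, fun e α hfac =>
    ⟨exists_isCubicNormalization sa sb ha0 hb0 hpos hbd hfac, fun e' a₁ a₂ a₃ hn => ?_⟩⟩
  refine ⟨_, (eventually_normalizedDiscriminant_pos hhyp hfac hn).and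
    (eventually_not_small_coefficients sb hb0 hbd hfac (hfac.alpha_eq_zero ha0) hn),
    fun X ε hmem hε => ?_⟩
  obtain ⟨hρ, hδ⟩ := hmem.1 hε
  have ha₃ : 0 < a₃ (X, ε) := by
    simpa [normalizedDiscriminant] using hδ 0 le_rfl
  obtain ⟨hν, hroot⟩ := cubic_sInf_pos (a₁ := a₁ (X, ε)) (a₂ := a₂ (X, ε)) ha₃
  refine ⟨hρ, hν, hroot, fun t ht => ?_⟩
  refine cubic_lower_bound hρ hroot hν hδ (fun hle => ?_) (hmem.2 hρ) ht.1
  -- The cut-off matters only when `ν₁ + a₁ ≤ 0`; its argument is then non-positive because `ρ > 0`,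
  -- so `χ = 1`.
  rw [psiFun, hχ_one]
  · exact neg_one_mul _
  · exact div_nonpos_of_nonpos_of_nonneg hle (by positivity)
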